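/- **Setting.** Consider the system $x_{t+1}=Ax_t+Bu_t+\Gamma e_t+w_t$, $y_t=Cx_t+\Psi e_t+v_t$ with $x_t\in\mathbb R^n$, $u_t\in\mathbb R^m$, attack $e_t\in\mathbb R^s$, $y_t\in\mathbb R^p$, where $w_t\sim\mathcal N(0,\Sigma_w)$ i.i.d., $v_t\sim\mathcal N(0,\Sigma_v)$ i.i.d., with $\Sigma_w,\Sigma_v\succ0$, the two noise sequences are independent, $(A,C)$ is observable, $(A,B)$ is controllable, and $\begin{bmatrix}\Gamma\\ \Psi\end{bmatrix}$ is injective. Let $P\succeq0$ solve $P=APA^T+\Sigma_w-APC^T\Sigma_\nu^{-1}CPA^T$ with $\Sigma_\nu=CPC^T+\Sigma_v$, and let $K=PC^T\Sigma_\nu^{-1}$. The system runs the Kalman filter $\widehat x_t^e=\widehat x_{t|t-1}^e+K\nu_t^e$, $\nu_t^e=y_t-C\widehat x_{t|t-1}^e$, $\widehat x_{t+1|t}^e=A\widehat x_t^e+Bu_t$, and the feedback $u_t=L\widehat x_t^e$, where $A+BL$ is stable. It has been running since $t=-\infty$ from a Gaussian initial state with positive definite covariance, independent of the noises, and $e_t=0$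 for $t<0$. A superscript $0$ denotes the quantities obtained when $e_t=0$ for all $t$. For $t=0,\dots,N$ the attacker chooses $e_t$ as a (measurable) function of its information $\mathcal I_t$, consisting of the measurements before time $0$, the prediction $\widehat x_{0|-1}$, $\widetilde y_0,\dots,\widetilde y_t$ and $e_0,\dots,e_{t-1}$, where $\widetilde y_t=Cx_t+v_t$. It runs its own Kalman filter $\widehat x_t=\widehat x_{t|t-1}+K\nu_t$, $\nu_t=\widetilde y_t-C\widehat x_{t|t-1}$, $\widehat x_{t+1|t}=A\widehat x_t+Bu_t+\Gamma e_t$, started from $\widehat x_{0|-1}=\widehat x^e_{0|-1}$. Given a target $x^*\in\mathbb R^n$ and symmetric $Q_t,R_t\succ0$, let $$J_d=\mathbb E\Big[\sum_{t=0}^N(\nu_t^e)^TR_t\,\nu_t^e\Big],\qquad J_c=\mathbb E\Big[\sum_{t=0}^N(x_t-x^*)^TQ_t(x_t-x^*)\Big].$$ Put $\Omega=\begin{bmatrix}(I-KC)A+BL&KC&KC\end{bmatrix}$, $$\widehat{\mathcal A}=\begin{bmatrix}(I-KC)A+BL&KC&KC\\ABL&A&0\\0&0&A\end{bmatrix},\quad\widehat{\mathcal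 B}=\begin{bmatrix}K\Psi\\0\\\Gamma\end{bmatrix},\quad\widehat{\mathcal C}=\begin{bmatrix}-CA&C&C\end{bmatrix},$$ $\theta_0=0$, $\theta_{t+1}=\widehat{\mathcal A}\theta_t+\widehat{\mathcal B}e_t$, $\xi_t=(\widehat x_t,\theta_t,\widehat x_t^0,x^*)\in\mathbb R^{6n}$, and $$\mathcal A=\begin{bmatrix}A&BL\Omega&BL&0\\0&\widehat{\mathcal A}&0&0\\0&0&A+BL&0\\0&0&0&I\end{bmatrix},\quad\mathcal B=\begin{bmatrix}\Gamma+BLK\Psi\\\widehat{\mathcal B}\\0\\0\end{bmatrix},\quad\mathcal H=\begin{bmatrix}I&0&0&-I\end{bmatrix},\quad\widetilde{\mathcal C}=\begin{bmatrix}0&\widehat{\mathcal C}&0&0\end{bmatrix}.$$ **Theorem (Asymptotically weighted optimal attacks).** Call an attack optimal for $\alpha=0$ if it minimizes $J_d$, and optimal for $\alpha=\infty$ if it minimizes $J_c$, among all attacks $e_0,\dots,e_N$ as above. For $\alpha=0$ and for $\alpha=\infty$ the linear feedback $$e_{\alpha,t}=\mathcal L_{\alpha,t}\,\xi_t+\mathcal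 O_{\alpha,t}\,\nu_t,\qquad t=0,\dots,N,$$ with the gains below is an admissible attack and is optimal, with finite cost. Moreover, under this attack $\widehat x_{t|t-1}=\mathbb E[x_t\mid\mathcal I_{t-1},e_{t-1}]$ (for $t=0$: given the measurements before time $0$ and $\widehat x_{0|-1}$) and $\widehat x_t=\mathbb E[x_t\mid\mathcal I_t]$ almost surely. ($M^\dagger$ is the Moore-Penrose pseudoinverse.) For $\alpha=0$ and $t=0,\dots,N$, $$\mathcal L_{0,t}=-\big(\Psi^TR_t\Psi+\mathcal B^T\mathcal V_{t+1}\mathcal B\big)^\dagger\big(\Psi^TR_t\widetilde{\mathcal C}+\mathcal B^T\mathcal V_{t+1}\mathcal A\big),\qquad\mathcal O_{0,t}=-\big(\Psi^TR_t\Psi+\mathcal B^T\mathcal V_{t+1}\mathcal B\big)^\dagger\Psi^TR_t,$$ where $\mathcal V_{N+1}=0$ and $$\mathcal V_t=\widetilde{\mathcal C}^TR_t\widetilde{\mathcal C}+\mathcal A^T\mathcal V_{t+1}\mathcal A-\big(\Psi^TR_t\widetilde{\mathcal C}+\mathcal B^T\mathcal V_{t+1}\mathcal A\big)^T\big(\Psi^TR_t\Psi+\mathcal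 B^T\mathcal V_{t+1}\mathcal B\big)^\dagger\big(\Psi^TR_t\widetilde{\mathcal C}+\mathcal B^T\mathcal V_{t+1}\mathcal A\big).$$ For $\alpha=\infty$ and $t=0,\dots,N$, $$\mathcal L_{\infty,t}=-\big(\mathcal B^T\mathcal W_{t+1}\mathcal B\big)^\dagger\mathcal B^T\mathcal W_{t+1}\mathcal A,\qquad\mathcal O_{\infty,t}=0,$$ where $\mathcal W_{N+1}=0$ and $$\mathcal W_t=\mathcal H^TQ_t\mathcal H+\mathcal A^T\mathcal W_{t+1}\mathcal A-\mathcal A^T\mathcal W_{t+1}\mathcal B\big(\mathcal B^T\mathcal W_{t+1}\mathcal B\big)^\dagger\mathcal B^T\mathcal W_{t+1}\mathcal A.$$ -/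

import Mathlib

open MeasureTheory ProbabilityTheory Filter Topology
open scoped Matrix ENNReal

/-! ### The Moore-Penrose pseudoinverse of a real matrix -/

/-- `X` is the Moore-Penrose pseudoinverse of the real matrix `M`: the four Penrose equations. -/
structure IsMoorePenrose {ι κ : Type*} [Fintype ι] [Fintype κ]
    (M : Matrix ι κ ℝ) (X : Matrix κ ι ℝ) : Prop where
  mul_mul_self : M * X * M = M
  self_mul_mul : X * M * X = X
  left_symm : (M * X)ᵀ = M * X
  right_symm : (X * M)ᵀ = X * M

theorem IsMoorePenrose.unique {ι κ : Type*} [Fintype ι] [Fintype κ]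
    {M : Matrix ι κ ℝ} {X Y : Matrix κ ι ℝ}
    (hX : IsMoorePenrose M X) (hY : IsMoorePenrose M Y) : X = Y := by
  have h1 : M * X = M * Y := by
    calc M * X = (M * X)ᵀ := hX.left_symm.symm
      _ = ((M * Y) * (M * X))ᵀ := by
          rw [← Matrix.mul_assoc, hY.mul_mul_self]
      _ = (M * X) * (M * Y) := by
          rw [Matrix.transpose_mul, hX.left_symm, hY.left_symm]
      _ = M * Y := by rw [← Matrix.mul_assoc, hX.mul_mul_self]
  have h2 : X * M = Y * M := by
    calc X * M = (X * M)ᵀ := hX.right_symm.symm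
      _ = ((X * M) * (Y * M))ᵀ := by
          rw [Matrix.mul_assoc, ← Matrix.mul_assoc M, hY.mul_mul_self]
      _ = (Y * M) * (X * M) := by
          rw [Matrix.transpose_mul, hX.right_symm, hY.right_symm]
      _ = Y * M := by rw [Matrix.mul_assoc, ← Matrix.mul_assoc M, hX.mul_mul_self]
  calc X = X * M * X := hX.self_mul_mul.symm
    _ = Y * (M * X) := by rw [h2, Matrix.mul_assoc]
    _ = Y * M * Y := by rw [h1, Matrix.mul_assoc]
    _ = Y := hY.self_mul_mul

theorem exists_isMoorePenrose {ι κ : Type*} [Fintype ι] [Fintype κ]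
    (M : Matrix ι κ ℝ) : ∃ X : Matrix κ ι ℝ, IsMoorePenrose M X := by
  classical
  obtain ⟨G, h1, h2, h3, h4⟩ : ∃ G : Matrix κ κ ℝ, Gᵀ = G ∧
      (Mᵀ * M) * G * (Mᵀ * M) = Mᵀ * M ∧ G * (Mᵀ * M) * G = G ∧
      G * (Mᵀ * M) = (Mᵀ * M) * G := by
    have hH : (Mᵀ * M).IsHermitian := by
      have := Matrix.isHermitian_conjTranspose_mul_self M
      rwa [Matrix.conjTranspose_eq_transpose_of_trivial] at this
    obtain ⟨U, d, hUU, hspec⟩ : ∃ (U : Matrix κ κ ℝ) (d : κ → ℝ), Uᵀ * U = 1 ∧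
        Mᵀ * M = U * Matrix.diagonal d * Uᵀ := by
      refine ⟨(hH.eigenvectorUnitary : Matrix κ κ ℝ), hH.eigenvalues, ?_, ?_⟩
      · exact Unitary.coe_star_mul_self hH.eigenvectorUnitary
      · have := hH.spectral_theorem
        rw [Unitary.conjStarAlgAut_apply] at this
        exact this
    rw [hspec]
    have key : ∀ a b : κ → ℝ, (U * Matrix.diagonal a * Uᵀ) * (U * Matrix.diagonal b * Uᵀ)
        = U * Matrix.diagonal (fun i => a i * b i) * Uᵀ := by
      intro a b
      calc _ = U * Matrix.diagonal a * (Uᵀ * U) * Matrix.diagonal b * Uᵀ := by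
            simp only [Matrix.mul_assoc]
        _ = _ := by
            rw [hUU, Matrix.mul_one, Matrix.mul_assoc U, Matrix.diagonal_mul_diagonal]
    refine ⟨U * Matrix.diagonal (fun i => (d i)⁻¹) * Uᵀ, ?_, ?_, ?_, ?_⟩
    · simp [Matrix.transpose_mul, Matrix.mul_assoc]
    · rw [key, key]
      congr 3
      funext i
      exact mul_inv_mul_cancel _
    · rw [key, key]
      congr 3
      funext i
      by_cases h : d i = 0 <;> simp [h]
    · rw [key, key]
      congr 3
      funext i
      exact mul_comm _ _
  have h5 : M * G * (Mᵀ * M) = M := by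
    have hz : Mᴴ * M * (G * (Mᵀ * M) - 1) = 0 := by
      rw [Matrix.conjTranspose_eq_transpose_of_trivial, Matrix.mul_sub, ← Matrix.mul_assoc, h2,
        Matrix.mul_one, sub_self]
    have := (Matrix.conjTranspose_mul_self_mul_eq_zero M _).1 hz
    rw [Matrix.mul_sub, Matrix.mul_one, sub_eq_zero, ← Matrix.mul_assoc] at this
    exact this
  refine ⟨G * Mᵀ, ?_, ?_, ?_, ?_⟩
  · simpa only [Matrix.mul_assoc] using h5
  · calc G * Mᵀ * M * (G * Mᵀ) = (G * (Mᵀ * M) * G) * Mᵀ := by simp only [Matrix.mul_assoc]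
      _ = _ := by rw [h3]
  · simp [Matrix.transpose_mul, h1, Matrix.mul_assoc]
  · rw [Matrix.mul_assoc, Matrix.transpose_mul, Matrix.transpose_mul, Matrix.transpose_transpose,
      h1, h4]

/-- The Moore-Penrose pseudoinverse `M†`. -/
noncomputable def pinv {ι κ : Type*} [Fintype ι] [Fintype κ]
    (M : Matrix ι κ ℝ) : Matrix κ ι ℝ :=
  (exists_isMoorePenrose M).choose

theorem isMoorePenrose_pinv {ι κ : Type*} [Fintype ι] [Fintype κ]
    (M : Matrix ι κ ℝ) : IsMoorePenrose M (pinv M) :=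
  (exists_isMoorePenrose M).choose_spec

/-! ### The cyber-physical system -/

/-- Column vectors. -/
abbrev Vec (n : ℕ) : Type := Fin n → ℝ

/-- Data of the system `x⁺ = A x + B u + Γ e + w`, `y = C x + Ψ e + v` with feedback gain `L`,
noise covariances `Sw`, `Sv`, mean `xbar` and covariance `Sx` of the initial state, and the
steady-state prediction error covariance `P` of its Kalman filter. -/
structure CPS (n m p s : ℕ) where
  A : Matrix (Fin n) (Fin n) ℝ
  B : Matrix (Fin n) (Fin m) ℝ
  C : Matrix (Fin p) (Fin n) ℝ
  L : Matrix (Fin m) (Fin n) ℝ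
  Γ : Matrix (Fin n) (Fin s) ℝ
  Ψ : Matrix (Fin p) (Fin s) ℝ
  Sw : Matrix (Fin n) (Fin n) ℝ
  Sv : Matrix (Fin p) (Fin p) ℝ
  Sx : Matrix (Fin n) (Fin n) ℝ
  xbar : Vec n
  P : Matrix (Fin n) (Fin n) ℝ

namespace CPS

variable {n m p s : ℕ}

/-- Covariance of the nominal innovations. -/
def Snu (S : CPS n m p s) : Matrix (Fin p) (Fin p) ℝ := S.C * S.P * S.Cᵀ + S.Sv

/-- The steady-state Kalman gain. -/
noncomputable def K (S : CPS n m p s) : Matrix (Fin n) (Fin p) ℝ := S.P * S.Cᵀ * S.Snu⁻¹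

/-- The standing assumptions on the system data. -/
structure Standing (S : CPS n m p s) : Prop where
  Sw_posDef : S.Sw.PosDef
  Sv_posDef : S.Sv.PosDef
  Sx_posDef : S.Sx.PosDef
  /-- `(A, C)` is observable -/
  observable : ∀ x : Vec n, (∀ k : ℕ, (S.C * S.A ^ k) *ᵥ x = 0) → x = 0
  /-- `(A, B)` is controllable -/
  controllable : ∀ x : Vec n, (∀ k : ℕ, x ᵥ* (S.A ^ k * S.B) = 0) → x = 0
  /-- `A + B L` is (asymptotically) stable -/
  stable : Tendsto (fun k : ℕ => (S.A + S.B * S.L) ^ k) atTop (𝓝 0)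
  /-- `[Γ; Ψ]` is injective -/
  attack_injective : Function.Injective (Matrix.fromRows S.Γ S.Ψ).mulVec
  P_posSemidef : S.P.PosSemidef
  /-- the algebraic Riccati equation of the Kalman filter -/
  riccati : S.P = S.A * S.P * S.Aᵀ + S.Sw - S.A * S.P * S.Cᵀ * S.Snu⁻¹ * S.C * S.P * S.Aᵀ

/-! #### Trajectories for given inputs and noises -/

/-- One step of the plant with the system's own filter and controller. The argument is the pair of
the state `x_t` and the system's prediction `x̂_{t|t-1}`. -/
noncomputable def step (S : CPS n m p s) (e : Vec s) (w : Vec n) (v : Vec p)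
    (q : Vec n × Vec n) : Vec n × Vec n :=
  let y := S.C *ᵥ q.1 + S.Ψ *ᵥ e + v
  let xh := q.2 + S.K *ᵥ (y - S.C *ᵥ q.2)
  let u := S.L *ᵥ xh
  (S.A *ᵥ q.1 + S.B *ᵥ u + S.Γ *ᵥ e + w, S.A *ᵥ xh + S.B *ᵥ u)

/-- State and system prediction after `t` steps from `q` under the attack `e`. -/
noncomputable def run (S : CPS n m p s) (q : Vec n × Vec n) (e : ℕ → Vec s) (w : ℕ → Vec n)
    (v : ℕ → Vec p) : ℕ → Vec n × Vec n
  | 0 => q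
  | t + 1 => S.step (e t) (w t) (v t) (S.run q e w v t)

/-- The measurement `C x_t + v_t` before its modification by the attack at time `t`. -/
noncomputable def ytilde (S : CPS n m p s) (q : Vec n × Vec n) (e : ℕ → Vec s) (w : ℕ → Vec n)
    (v : ℕ → Vec p) (t : ℕ) : Vec p :=
  S.C *ᵥ (S.run q e w v t).1 + v t

/-- The innovation of the system's filter. -/
noncomputable def sysInnov (S : CPS n m p s) (q : Vec n × Vec n) (e : ℕ → Vec s) (w : ℕ → Vec n)
    (v : ℕ → Vec p) (t : ℕ) : Vec p :=
  S.ytilde q e w v t + S.Ψ *ᵥ e t - S.C *ᵥ (S.run q e w v t).2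

/-- The filtered estimate `x̂_t` of the system's filter. -/
noncomputable def sysEst (S : CPS n m p s) (q : Vec n × Vec n) (e : ℕ → Vec s) (w : ℕ → Vec n)
    (v : ℕ → Vec p) (t : ℕ) : Vec n :=
  (S.run q e w v t).2 + S.K *ᵥ S.sysInnov q e w v t

/-- The prediction `x̂_{t|t-1}` of the attacker's Kalman filter. -/
noncomputable def attPred (S : CPS n m p s) (q : Vec n × Vec n) (e : ℕ → Vec s) (w : ℕ → Vec n)
    (v : ℕ → Vec p) : ℕ → Vec n
  | 0 => q.2
  | t + 1 =>
    let z := S.attPred q e w v t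
    S.A *ᵥ (z + S.K *ᵥ (S.ytilde q e w v t - S.C *ᵥ z))
      + S.B *ᵥ (S.L *ᵥ S.sysEst q e w v t) + S.Γ *ᵥ e t

/-- The attacker's innovation `ν_t`. -/
noncomputable def attInnov (S : CPS n m p s) (q : Vec n × Vec n) (e : ℕ → Vec s) (w : ℕ → Vec n)
    (v : ℕ → Vec p) (t : ℕ) : Vec p :=
  S.ytilde q e w v t - S.C *ᵥ S.attPred q e w v t

/-- The attacker's filtered estimate `x̂_t`. -/
noncomputable def attEst (S : CPS n m p s) (q : Vec n × Vec n) (e : ℕ → Vec s) (w : ℕ → Vec n)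
    (v : ℕ → Vec p) (t : ℕ) : Vec n :=
  S.attPred q e w v t + S.K *ᵥ S.attInnov q e w v t

/-! #### Block matrices -/

/-- Indices of `θ = (ω, π, ρ)`. -/
abbrev ThetaIdx (n : ℕ) : Type := Fin n ⊕ Fin n ⊕ Fin n

/-- Indices of `ξ = (x̂, θ, x̂⁰, x*)`. -/
abbrev XiIdx (n : ℕ) : Type := Fin n ⊕ ThetaIdx n ⊕ Fin n ⊕ Fin n

open Matrix in
/-- `Ω = [(I - K C) A + B L, K C, K C]`. -/
noncomputable def Omega (S : CPS n m p s) : Matrix (Fin n) (ThetaIdx n) ℝ :=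
  fromCols ((1 - S.K * S.C) * S.A + S.B * S.L) (fromCols (S.K * S.C) (S.K * S.C))

open Matrix in
/-- State matrix of the `θ` system. -/
noncomputable def Ahat (S : CPS n m p s) : Matrix (ThetaIdx n) (ThetaIdx n) ℝ :=
  fromRows (fromCols ((1 - S.K * S.C) * S.A + S.B * S.L) (fromCols (S.K * S.C) (S.K * S.C)))
    (fromRows (fromCols (S.A * S.B * S.L) (fromCols S.A 0))
      (fromCols 0 (fromCols 0 S.A)))

open Matrix in
/-- Input matrix of the `θ` system. -/
noncomputable def Bhat (S : CPS n m p s) : Matrix (ThetaIdx n) (Fin s) ℝ :=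
  fromRows (S.K * S.Ψ) (fromRows 0 S.Γ)

open Matrix in
/-- Output matrix of the `θ` system. -/
def Chat (S : CPS n m p s) : Matrix (Fin p) (ThetaIdx n) ℝ :=
  fromCols (-(S.C * S.A)) (fromCols S.C S.C)

open Matrix in
/-- State matrix of the `ξ` system. -/
noncomputable def calA (S : CPS n m p s) : Matrix (XiIdx n) (XiIdx n) ℝ :=
  fromRows (fromCols S.A (fromCols (S.B * S.L * S.Omega) (fromCols (S.B * S.L) 0)))
    (fromRows (fromCols 0 (fromCols S.Ahat (fromCols 0 0)))
      (fromRows (fromCols 0 (fromCols 0 (fromCols (S.A + S.B * S.L) 0)))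
        (fromCols 0 (fromCols 0 (fromCols 0 1)))))

open Matrix in
/-- Input matrix of the `ξ` system. -/
noncomputable def calB (S : CPS n m p s) : Matrix (XiIdx n) (Fin s) ℝ :=
  fromRows (S.Γ + S.B * S.L * S.K * S.Ψ) (fromRows S.Bhat (fromRows 0 0))

open Matrix in
/-- `H = [I, 0, 0, -I]`. -/
def calH (_S : CPS n m p s) : Matrix (Fin n) (XiIdx n) ℝ :=
  fromCols 1 (fromCols 0 (fromCols 0 (-1)))

open Matrix in
/-- `C̃ = [0, Ĉ, 0, 0]`. -/
def Ctilde (S : CPS n m p s) : Matrix (Fin p) (XiIdx n) ℝ :=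
  fromCols 0 (fromCols S.Chat (fromCols 0 0))

/-- The state `θ_t` of the system from the attack to the innovation bias. -/
noncomputable def theta (S : CPS n m p s) (e : ℕ → Vec s) : ℕ → ThetaIdx n → ℝ
  | 0 => 0
  | t + 1 => S.Ahat *ᵥ S.theta e t + S.Bhat *ᵥ e t

/-- `ξ_t = (x̂_t, θ_t, x̂⁰_t, x*)`, where `x̂⁰` is the system's estimate in the absence of attack. -/
noncomputable def xi (S : CPS n m p s) (xstar : Vec n) (q : Vec n × Vec n) (e : ℕ → Vec s)
    (w : ℕ → Vec n) (v : ℕ → Vec p) (t : ℕ) : XiIdx n → ℝ :=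
  Sum.elim (S.attEst q e w v t)
    (Sum.elim (S.theta e t) (Sum.elim (S.sysEst q 0 w v t) xstar))

end CPS

/-! ### The stochastic model -/

/-- Random elements of the model: the initial state `x0`, the noises `w`, `v`, and, for times
`t ≤ 0`, the state `x t` and the system's prediction `z t` of it. -/
structure RandomCPS (n p : ℕ) (Ω : Type*) where
  x0 : Ω → Vec n
  w : ℤ → Ω → Vec n
  v : ℤ → Ω → Vec p
  x : ℤ → Ω → Vec n
  z : ℤ → Ω → Vec n

namespace RandomCPS

variable {n m p s : ℕ} {Ω : Type*}

/-- State and prediction at time `t ≥ -T` of the unattacked system that is started at time `-T`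
from the state `x0` and the prediction `xbar`. -/
noncomputable def started (D : RandomCPS n p Ω) (S : CPS n m p s) (T : ℕ) (t : ℤ) (ω : Ω) :
    Vec n × Vec n :=
  S.run (D.x0 ω, S.xbar) 0 (fun k => D.w (k - T) ω) (fun k => D.v (k - T) ω) (t + T).toNat

/-- The probabilistic assumptions: i.i.d. centred Gaussian noises, mutually independent and
independent of the Gaussian initial state, and a system running, without attack before time `0`,
since `t = -∞`, that is, its state and prediction at times `t ≤ 0` are the mean square limits of
those of the systems started at time `-T` as `T → ∞`. -/
structure IsModel [MeasurableSpace Ω] (D : RandomCPS n p Ω) (S : CPS n m p s) (μ : Measure Ω) :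
    Prop where
  measurable_x0 : Measurable D.x0
  measurable_w : ∀ t, Measurable (D.w t)
  measurable_v : ∀ t, Measurable (D.v t)
  law_x0 : HasLaw (fun ω => WithLp.toLp 2 (D.x0 ω))
    (multivariateGaussian (WithLp.toLp 2 S.xbar) S.Sx) μ
  law_w : ∀ t, HasLaw (fun ω => WithLp.toLp 2 (D.w t ω)) (multivariateGaussian 0 S.Sw) μ
  law_v : ∀ t, HasLaw (fun ω => WithLp.toLp 2 (D.v t ω)) (multivariateGaussian 0 S.Sv) μ
  indep_w : iIndepFun D.w μ
  indep_v : iIndepFun D.v μ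
  indep_w_v : IndepFun (fun ω t => D.w t ω) (fun ω t => D.v t ω) μ
  indep_x0 : IndepFun D.x0 (fun ω => (fun t => D.w t ω, fun t => D.v t ω)) μ
  measurable_x : ∀ t ≤ 0, Measurable (D.x t)
  measurable_z : ∀ t ≤ 0, Measurable (D.z t)
  limit : ∀ t ≤ 0, Tendsto
    (fun T : ℕ => eLpNorm (fun ω => D.started S T t ω - (D.x t ω, D.z t ω)) 2 μ) atTop (𝓝 0)

/-- An attack (a random sequence `e_0, e_1, …`) at the sample point `ω`. -/
def path {E : Type*} (e : ℕ → Ω → E) (ω : Ω) : ℕ → E := fun t => e t ω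

/-- State and prediction at time `0`. -/
def q0 (D : RandomCPS n p Ω) (ω : Ω) : Vec n × Vec n := (D.x 0 ω, D.z 0 ω)

/-- Noises from time `0` on. -/
def wPos (D : RandomCPS n p Ω) (ω : Ω) : ℕ → Vec n := fun t => D.w t ω

/-- Noises from time `0` on. -/
def vPos (D : RandomCPS n p Ω) (ω : Ω) : ℕ → Vec p := fun t => D.v t ω

/-- The state `x_t` under the attack `e`. -/
noncomputable def state (D : RandomCPS n p Ω) (S : CPS n m p s) (e : ℕ → Ω → Vec s) (t : ℕ)
    (ω : Ω) : Vec n :=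
  (S.run (D.q0 ω) (path e ω) (D.wPos ω) (D.vPos ω) t).1

/-- The innovation `ν_t^e` of the system's filter under the attack `e`. -/
noncomputable def sysInnov (D : RandomCPS n p Ω) (S : CPS n m p s) (e : ℕ → Ω → Vec s) (t : ℕ)
    (ω : Ω) : Vec p :=
  S.sysInnov (D.q0 ω) (path e ω) (D.wPos ω) (D.vPos ω) t

/-- The measurement `ỹ_t = C x_t + v_t` under the attack `e`. -/
noncomputable def ytilde (D : RandomCPS n p Ω) (S : CPS n m p s) (e : ℕ → Ω → Vec s) (t : ℕ)
    (ω : Ω) : Vec p :=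
  S.ytilde (D.q0 ω) (path e ω) (D.wPos ω) (D.vPos ω) t

/-- The prediction `x̂_{t|t-1}` of the attacker's filter. -/
noncomputable def attPred (D : RandomCPS n p Ω) (S : CPS n m p s) (e : ℕ → Ω → Vec s) (t : ℕ)
    (ω : Ω) : Vec n :=
  S.attPred (D.q0 ω) (path e ω) (D.wPos ω) (D.vPos ω) t

/-- The estimate `x̂_t` of the attacker's filter. -/
noncomputable def attEst (D : RandomCPS n p Ω) (S : CPS n m p s) (e : ℕ → Ω → Vec s) (t : ℕ)
    (ω : Ω) : Vec n :=
  S.attEst (D.q0 ω) (path e ω) (D.wPos ω) (D.vPos ω) t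

/-- The innovation `ν_t` of the attacker's filter. -/
noncomputable def attInnov (D : RandomCPS n p Ω) (S : CPS n m p s) (e : ℕ → Ω → Vec s) (t : ℕ)
    (ω : Ω) : Vec p :=
  S.attInnov (D.q0 ω) (path e ω) (D.wPos ω) (D.vPos ω) t

/-- The vector `ξ_t`. -/
noncomputable def xi (D : RandomCPS n p Ω) (S : CPS n m p s) (xstar : Vec n)
    (e : ℕ → Ω → Vec s) (t : ℕ) (ω : Ω) : CPS.XiIdx n → ℝ :=
  S.xi xstar (D.q0 ω) (path e ω) (D.wPos ω) (D.vPos ω) t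

/-- The information of the attacker just before `ỹ_t` becomes available: the measurements before
the attack, the prediction of `x_0`, and `ỹ_j`, `e_j` for `0 ≤ j < t`. -/
noncomputable abbrev priorInfo (D : RandomCPS n p Ω) (S : CPS n m p s) (e : ℕ → Ω → Vec s) (t : ℕ) :
    MeasurableSpace Ω :=
  (⨆ k : ℤ, ⨆ _ : k < 0, MeasurableSpace.comap (fun ω => S.C *ᵥ D.x k ω + D.v k ω) inferInstance)
    ⊔ MeasurableSpace.comap (D.z 0) inferInstance
    ⊔ (⨆ j : ℕ, ⨆ _ : j < t, MeasurableSpace.comap (D.ytilde S e j) inferInstance)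
    ⊔ (⨆ j : ℕ, ⨆ _ : j < t, MeasurableSpace.comap (e j) inferInstance)

/-- The information `I_t` of the attacker when it chooses `e_t`. -/
noncomputable abbrev info (D : RandomCPS n p Ω) (S : CPS n m p s) (e : ℕ → Ω → Vec s) (t : ℕ) :
    MeasurableSpace Ω :=
  D.priorInfo S e t ⊔ MeasurableSpace.comap (D.ytilde S e t) inferInstance

/-- The attack `e_t` depends only on the information `I_t`, for `t = 0, …, N`. -/
def Admissible (D : RandomCPS n p Ω) (S : CPS n m p s) (N : ℕ) (e : ℕ → Ω → Vec s) : Prop :=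
  ∀ t ≤ N, Measurable[D.info S e t] (e t)

/-- The detection statistic cost `J_d`. -/
noncomputable def detCost [MeasurableSpace Ω] (D : RandomCPS n p Ω) (S : CPS n m p s)
    (μ : Measure Ω) (N : ℕ) (R : ℕ → Matrix (Fin p) (Fin p) ℝ) (e : ℕ → Ω → Vec s) : ℝ≥0∞ :=
  ∫⁻ ω, ENNReal.ofReal (∑ t ∈ Finset.range (N + 1),
    D.sysInnov S e t ω ⬝ᵥ (R t *ᵥ D.sysInnov S e t ω)) ∂μ

/-- The control error cost `J_c`. -/
noncomputable def ctrlCost [MeasurableSpace Ω] (D : RandomCPS n p Ω) (S : CPS n m p s)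
    (μ : Measure Ω) (N : ℕ) (xstar : Vec n) (Q : ℕ → Matrix (Fin n) (Fin n) ℝ)
    (e : ℕ → Ω → Vec s) : ℝ≥0∞ :=
  ∫⁻ ω, ENNReal.ofReal (∑ t ∈ Finset.range (N + 1),
    (D.state S e t ω - xstar) ⬝ᵥ (Q t *ᵥ (D.state S e t ω - xstar))) ∂μ

/-- The attack `e` is admissible, has finite cost, and minimizes the cost among all admissible
attacks. -/
def IsOptimal (D : RandomCPS n p Ω) (S : CPS n m p s) (N : ℕ)
    (cost : (ℕ → Ω → Vec s) → ℝ≥0∞) (e : ℕ → Ω → Vec s) : Prop :=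
  D.Admissible S N e ∧ cost e < ∞ ∧ ∀ e', D.Admissible S N e' → cost e ≤ cost e'

/-- The attack follows `e_t = 𝓛_t ξ_t + 𝓞_t ν_t` for `t = 0, …, N`. -/
def IsLinearFeedback (D : RandomCPS n p Ω) (S : CPS n m p s) (N : ℕ) (xstar : Vec n)
    (Lg : ℕ → Matrix (Fin s) (CPS.XiIdx n) ℝ) (Og : ℕ → Matrix (Fin s) (Fin p) ℝ)
    (e : ℕ → Ω → Vec s) : Prop :=
  ∀ t ≤ N, ∀ ω, e t ω = Lg t *ᵥ D.xi S xstar e t ω + Og t *ᵥ D.attInnov S e t ω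

/-- The attacker's prediction and estimate are the conditional expectations (minimum mean squared
error estimates) of the state. -/
def IsMMSE [MeasurableSpace Ω] (D : RandomCPS n p Ω) (S : CPS n m p s) (μ : Measure Ω)
    (N : ℕ) (e : ℕ → Ω → Vec s) : Prop :=
  ∀ t ≤ N, D.attPred S e t =ᵐ[μ] μ[D.state S e t | D.priorInfo S e t] ∧
    D.attEst S e t =ᵐ[μ] μ[D.state S e t | D.info S e t]

end RandomCPS

/-! The attacker knows the control and its own input, so both cancel in the error of its filter:
`x_t - x̂_{t|t-1}` obeys a recursion driven by the noises alone (`CPS.run_fst_eq`). The innovations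
`ν_t` are therefore the same for all attacks. Every admissible `e_t` is a function of the
information before time `0` and of `ν_0, …, ν_t` (`Admissible.measurable_past`), and conversely
these innovations can be computed from `I_t` (`innov_mem`). The attacks thus compete on one
filtration that none of them influences.

On this filtration `ν_t` is centred and independent of the past, and the filtered error `η_t = x_t -
x̂_t` is centred and independent of the past together with `ν_t` (`IsSteady.step`): the Kalman gain
makes `η_t` and `ν_t` uncorrelated, and they are jointly Gaussian. This needs the filter to be
exactly in steady state at time `0`. The states before time `0` are mean square limits, so the
covariances of the started systems converge, and their limits are fixed points of linear recursions.
As `F = A(I - KC)` and `A + BL` are stable, the only fixed point is error covariance `P` with zero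
correlation between error and prediction (`eq_of_tendsto_covSeq`). Running the filter from `-τ` to
`0` and letting `τ → ∞` brings in all earlier measurements (`isSteady_zero`).

The algebra of `θ` shows that `ξ_{t+1} = 𝒜 ξ_t + ℬ e_t + G ν_{t+1}`, that `ν_t^e = C̃ ξ_t + Ψ e_t +
ν_t`, and that `x_t - x* = ℋ ξ_t + η_t`. The term `η_t` adds only a constant to `J_c`, so both
problems are linear-quadratic with white noise, where `ν_t` is already known when `e_t` is chosen.

These are solved by dynamic programming. For given `ξ_t` and `ν_t` the function of `e_t` to be
minimized is a convex quadratic; its normal equations are solvable and the pseudoinverse picks a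
solution (`quad_minimizer_le`). Write `ξ_t = φ + G ν_t` with `φ` known beforehand: the cross terms
in the expected optimal cost vanish, what depends on `φ` is `φᵀ V_t φ` with the Riccati matrix
`V_t`, and the rest does not depend on the attack (`optCost_add`). Costs are integrals in `[0, ∞]`
throughout, so that competitors need not be square integrable. -/

set_option linter.unusedSectionVars false

/-! ### Quadratic forms and the pointwise linear-quadratic problem -/

/-- The quadratic form `xᵀ M x`. -/
def quad {κ : Type*} [Fintype κ] (M : Matrix κ κ ℝ) (x : κ → ℝ) : ℝ := x ⬝ᵥ (M *ᵥ x)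

section Quad

variable {κ ι σ : Type*} [Fintype κ] [Fintype ι] [Fintype σ]

theorem mulVec_dotProduct_eq (D : Matrix κ σ ℝ) (e : σ → ℝ) (y : κ → ℝ) :
    (D *ᵥ e) ⬝ᵥ y = e ⬝ᵥ (Dᵀ *ᵥ y) := by
  rw [Matrix.mulVec_transpose, dotProduct_comm, Matrix.dotProduct_mulVec, dotProduct_comm]

theorem quad_mulVec (M : Matrix κ κ ℝ) (D : Matrix κ σ ℝ) (e : σ → ℝ) :
    quad M (D *ᵥ e) = quad (Dᵀ * M * D) e := by
  simp only [quad, mulVec_dotProduct_eq, Matrix.mulVec_mulVec, Matrix.mul_assoc]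

theorem quad_zero_matrix (x : κ → ℝ) : quad (0 : Matrix κ κ ℝ) x = 0 := by simp [quad]

theorem quad_add_matrix (M N : Matrix κ κ ℝ) (x : κ → ℝ) :
    quad (M + N) x = quad M x + quad N x := by
  simp [quad, Matrix.add_mulVec]

theorem quad_sub_matrix (M N : Matrix κ κ ℝ) (x : κ → ℝ) :
    quad (M - N) x = quad M x - quad N x := by
  simp [quad, Matrix.sub_mulVec]

theorem dotProduct_mulVec_comm {M : Matrix κ κ ℝ} (hM : Mᵀ = M) (x y : κ → ℝ) :
    x ⬝ᵥ (M *ᵥ y) = y ⬝ᵥ (M *ᵥ x) := by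
  conv_lhs => rw [← hM, ← mulVec_dotProduct_eq, dotProduct_comm]

theorem quad_add {M : Matrix κ κ ℝ} (hM : Mᵀ = M) (x y : κ → ℝ) :
    quad M (x + y) = quad M x + 2 * (y ⬝ᵥ (M *ᵥ x)) + quad M y := by
  simp only [quad, Matrix.mulVec_add, dotProduct_add, add_dotProduct]
  rw [dotProduct_mulVec_comm hM x y]
  ring

theorem transpose_eq_of_posSemidef {M : Matrix κ κ ℝ} (hM : M.PosSemidef) : Mᵀ = M := by
  have := hM.isHermitian
  rwa [Matrix.IsHermitian, Matrix.conjTranspose_eq_transpose_of_trivial] at this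

theorem quad_nonneg {M : Matrix κ κ ℝ} (hM : M.PosSemidef) (x : κ → ℝ) : 0 ≤ quad M x := by
  have := hM.dotProduct_mulVec_nonneg x
  simpa [quad] using this

theorem mulVec_eq_zero_of_quad_eq_zero {M : Matrix κ κ ℝ} (hM : M.PosSemidef) {x : κ → ℝ}
    (h : quad M x = 0) : M *ᵥ x = 0 := by
  refine (hM.dotProduct_mulVec_zero_iff x).1 ?_
  simpa [quad] using h

theorem posSemidef_of_quad_nonneg {M : Matrix κ κ ℝ} (hM : Mᵀ = M) (h : ∀ x, 0 ≤ quad M x) :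
    M.PosSemidef := by
  refine Matrix.PosSemidef.of_dotProduct_mulVec_nonneg ?_ fun x => ?_
  · rw [Matrix.IsHermitian, Matrix.conjTranspose_eq_transpose_of_trivial, hM]
  · simpa [quad] using h x

theorem continuous_quad (M : Matrix κ κ ℝ) : Continuous (quad M) := by
  unfold quad
  fun_prop

theorem IsMoorePenrose.transpose {M : Matrix κ σ ℝ} {X : Matrix σ κ ℝ} (h : IsMoorePenrose M X) :
    IsMoorePenrose Mᵀ Xᵀ where
  mul_mul_self := by
    rw [← Matrix.transpose_mul, ← Matrix.transpose_mul, ← Matrix.mul_assoc, h.mul_mul_self]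
  self_mul_mul := by
    rw [← Matrix.transpose_mul, ← Matrix.transpose_mul, ← Matrix.mul_assoc, h.self_mul_mul]
  left_symm := by rw [← Matrix.transpose_mul, h.right_symm, h.right_symm]
  right_symm := by rw [← Matrix.transpose_mul, h.left_symm, h.left_symm]

theorem pinv_transpose_of_symm {M : Matrix κ κ ℝ} (hM : Mᵀ = M) : (pinv M)ᵀ = pinv M := by
  have h := (isMoorePenrose_pinv M).transpose
  rw [hM] at h
  exact h.unique (isMoorePenrose_pinv M)

/-- The Hessian `DᵀRD + BᵀVB` of the one-step problem. -/
theorem hessian_transpose {R : Matrix κ κ ℝ} {V : Matrix ι ι ℝ} (hR : Rᵀ = R) (hV : Vᵀ = V)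
    (D : Matrix κ σ ℝ) (B : Matrix ι σ ℝ) :
    (Dᵀ * R * D + Bᵀ * V * B)ᵀ = Dᵀ * R * D + Bᵀ * V * B := by
  simp [Matrix.transpose_mul, hR, hV, Matrix.mul_assoc]

theorem quad_affine_add {R : Matrix κ κ ℝ} {V : Matrix ι ι ℝ} (hR : Rᵀ = R) (hV : Vᵀ = V)
    (D : Matrix κ σ ℝ) (B : Matrix ι σ ℝ) (a : κ → ℝ) (b : ι → ℝ) (e : σ → ℝ) :
    quad R (a + D *ᵥ e) + quad V (b + B *ᵥ e) =
      quad R a + quad V b + 2 * (e ⬝ᵥ ((Dᵀ * R) *ᵥ a + (Bᵀ * V) *ᵥ b))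
        + quad (Dᵀ * R * D + Bᵀ * V * B) e := by
  rw [quad_add hR, quad_add hV, quad_mulVec, quad_mulVec, quad_add_matrix,
    mulVec_dotProduct_eq, mulVec_dotProduct_eq, dotProduct_add, Matrix.mulVec_mulVec,
    Matrix.mulVec_mulVec]
  ring

/-- Solvability of the normal equations `H e = -g` although `H` may be singular. If `H z = 0`, both
nonnegative parts of `zᵀHz` vanish, so `R D z = 0` and `V B z = 0`, and `g` is orthogonal to `z`.
Thus `g` lies in the range of the symmetric matrix `H`, on which `H H†` acts as the identity. -/
theorem hessian_mul_pinv_mulVec_gradient {R : Matrix κ κ ℝ} {V : Matrix ι ι ℝ}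
    (hR : R.PosSemidef) (hV : V.PosSemidef) (D : Matrix κ σ ℝ) (B : Matrix ι σ ℝ)
    (a : κ → ℝ) (b : ι → ℝ) :
    (Dᵀ * R * D + Bᵀ * V * B) *ᵥ (pinv (Dᵀ * R * D + Bᵀ * V * B) *ᵥ
      ((Dᵀ * R) *ᵥ a + (Bᵀ * V) *ᵥ b)) = (Dᵀ * R) *ᵥ a + (Bᵀ * V) *ᵥ b := by
  have hRt := transpose_eq_of_posSemidef hR
  have hVt := transpose_eq_of_posSemidef hV
  set H := Dᵀ * R * D + Bᵀ * V * B with hH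
  have hHt : Hᵀ = H := hessian_transpose hRt hVt D B
  have hmp := isMoorePenrose_pinv H
  set g := (Dᵀ * R) *ᵥ a + (Bᵀ * V) *ᵥ b with hg
  refine dotProduct_eq _ _ fun u => ?_
  -- The identity is tested against an arbitrary `u`; `z` is the component of `u` in the kernel of
  -- `H`, as `H H†` is the orthogonal projection onto the range.
  set z := u - H *ᵥ (pinv H *ᵥ u) with hz
  have hHz : H *ᵥ z = 0 := by
    have h1 : H * (H * pinv H) = H := by
      have : (H * pinv H * H)ᵀ = Hᵀ := by rw [hmp.mul_mul_self]
      rwa [Matrix.transpose_mul, hmp.left_symm, hHt] at this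
    rw [hz, Matrix.mulVec_sub, Matrix.mulVec_mulVec _ H (pinv H), Matrix.mulVec_mulVec, h1, sub_self]
  have hq : quad R (D *ᵥ z) + quad V (B *ᵥ z) = 0 := by
    rw [quad_mulVec, quad_mulVec, ← quad_add_matrix, quad, hHz, dotProduct_zero]
  have h1 := quad_nonneg hR (D *ᵥ z)
  have h2 := quad_nonneg hV (B *ᵥ z)
  have h3 := mulVec_eq_zero_of_quad_eq_zero hR (by linarith : quad R (D *ᵥ z) = 0)
  have h4 := mulVec_eq_zero_of_quad_eq_zero hV (by linarith : quad V (B *ᵥ z) = 0)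
  have hgz : z ⬝ᵥ g = 0 := by
    rw [hg, dotProduct_add, ← Matrix.mulVec_mulVec, ← Matrix.mulVec_mulVec,
      ← mulVec_dotProduct_eq, ← mulVec_dotProduct_eq, dotProduct_mulVec_comm hRt,
      dotProduct_mulVec_comm hVt, h3, h4, dotProduct_zero, dotProduct_zero, add_zero]
  have h5 : u ⬝ᵥ (H *ᵥ (pinv H *ᵥ g)) = (H *ᵥ (pinv H *ᵥ u)) ⬝ᵥ g := by
    rw [Matrix.mulVec_mulVec, Matrix.mulVec_mulVec, mulVec_dotProduct_eq, hmp.left_symm]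
  rw [hz, sub_dotProduct] at hgz
  rw [dotProduct_comm _ u, h5, dotProduct_comm g u]
  linarith

/-- Pointwise minimization: the pseudoinverse solution of the normal equations is a minimizer. -/
theorem quad_minimizer_le {R : Matrix κ κ ℝ} {V : Matrix ι ι ℝ}
    (hR : R.PosSemidef) (hV : V.PosSemidef) (D : Matrix κ σ ℝ) (B : Matrix ι σ ℝ)
    (a : κ → ℝ) (b : ι → ℝ) (e e' : σ → ℝ)
    (he : e = -(pinv (Dᵀ * R * D + Bᵀ * V * B) *ᵥ ((Dᵀ * R) *ᵥ a + (Bᵀ * V) *ᵥ b))) :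
    quad R (a + D *ᵥ e) + quad V (b + B *ᵥ e) ≤ quad R (a + D *ᵥ e') + quad V (b + B *ᵥ e') := by
  have hRt := transpose_eq_of_posSemidef hR
  have hVt := transpose_eq_of_posSemidef hV
  rw [quad_affine_add hRt hVt, quad_affine_add hRt hVt]
  have hg := hessian_mul_pinv_mulVec_gradient hR hV D B a b
  have hHt := hessian_transpose hRt hVt D B
  have hnn : 0 ≤ quad (Dᵀ * R * D + Bᵀ * V * B) (e' - e) := by
    rw [quad_add_matrix, ← quad_mulVec, ← quad_mulVec]
    exact add_nonneg (quad_nonneg hR _) (quad_nonneg hV _)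
  set H := Dᵀ * R * D + Bᵀ * V * B
  set g := (Dᵀ * R) *ᵥ a + (Bᵀ * V) *ᵥ b
  have hHe : H *ᵥ e = -g := by rw [he, Matrix.mulVec_neg, hg]
  -- Completing the square around `e`: by `H e = -g` the linear terms cancel and the excess cost of
  -- `e'` is `quad H (e' - e)`.
  have hsplit : quad H e' = quad H e + 2 * ((e' - e) ⬝ᵥ (H *ᵥ e)) + quad H (e' - e) := by
    rw [← quad_add hHt, add_sub_cancel]
  rw [hHe, dotProduct_neg, sub_dotProduct] at hsplit
  linarith

/-- The value of the one-step problem: the Riccati update. -/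
theorem quad_minimum_eq {ρ : Type*} [Fintype ρ] {R : Matrix κ κ ℝ} {V : Matrix ι ι ℝ}
    (hR : Rᵀ = R) (hV : Vᵀ = V) (C : Matrix κ ρ ℝ) (D : Matrix κ σ ℝ) (A : Matrix ι ρ ℝ)
    (B : Matrix ι σ ℝ) (x : ρ → ℝ) (e : σ → ℝ)
    (he : e = -(pinv (Dᵀ * R * D + Bᵀ * V * B) *ᵥ ((Dᵀ * R * C + Bᵀ * V * A) *ᵥ x))) :
    quad R (C *ᵥ x + D *ᵥ e) + quad V (A *ᵥ x + B *ᵥ e) =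
      quad (Cᵀ * R * C + Aᵀ * V * A - (Dᵀ * R * C + Bᵀ * V * A)ᵀ
        * pinv (Dᵀ * R * D + Bᵀ * V * B) * (Dᵀ * R * C + Bᵀ * V * A)) x := by
  rw [quad_affine_add hR hV, Matrix.mulVec_mulVec, Matrix.mulVec_mulVec, ← Matrix.add_mulVec,
    quad_sub_matrix, quad_add_matrix (Cᵀ * R * C), ← quad_mulVec, ← quad_mulVec, ← quad_mulVec]
  have hHt := hessian_transpose hR hV D B
  set H := Dᵀ * R * D + Bᵀ * V * B
  set g := (Dᵀ * R * C + Bᵀ * V * A) *ᵥ x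
  have hpt := pinv_transpose_of_symm hHt
  have h1 : quad H e = quad (pinv H) g := by
    rw [he, ← Matrix.mulVec_neg, quad_mulVec, hpt, (isMoorePenrose_pinv H).self_mul_mul]
    simp [quad, Matrix.mulVec_neg]
  have h2 : e ⬝ᵥ g = - quad (pinv H) g := by
    rw [he, neg_dotProduct, dotProduct_comm, quad]
  rw [h1, h2]
  ring

theorem riccati_transpose {ρ : Type*} [Fintype ρ] {R : Matrix κ κ ℝ} {V : Matrix ι ι ℝ}
    (hR : Rᵀ = R) (hV : Vᵀ = V) (C : Matrix κ ρ ℝ) (D : Matrix κ σ ℝ) (A : Matrix ι ρ ℝ)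
    (B : Matrix ι σ ℝ) :
    (Cᵀ * R * C + Aᵀ * V * A - (Dᵀ * R * C + Bᵀ * V * A)ᵀ
        * pinv (Dᵀ * R * D + Bᵀ * V * B) * (Dᵀ * R * C + Bᵀ * V * A))ᵀ =
      Cᵀ * R * C + Aᵀ * V * A - (Dᵀ * R * C + Bᵀ * V * A)ᵀ
        * pinv (Dᵀ * R * D + Bᵀ * V * B) * (Dᵀ * R * C + Bᵀ * V * A) := by
  have hpt := pinv_transpose_of_symm (hessian_transpose hR hV D B)
  rw [Matrix.transpose_sub, Matrix.transpose_mul _ (Dᵀ * R * C + Bᵀ * V * A), Matrix.transpose_mul,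
    hpt, Matrix.transpose_transpose, hessian_transpose hR hV C A]
  simp only [Matrix.mul_assoc]

/-- By `quad_minimum_eq` the form is the value of the one-step cost at the pseudoinverse control, a
sum of two nonnegative terms. -/
theorem riccati_posSemidef {ρ : Type*} [Fintype ρ] {R : Matrix κ κ ℝ} {V : Matrix ι ι ℝ}
    (hR : R.PosSemidef) (hV : V.PosSemidef) (C : Matrix κ ρ ℝ) (D : Matrix κ σ ℝ)
    (A : Matrix ι ρ ℝ) (B : Matrix ι σ ℝ) :
    (Cᵀ * R * C + Aᵀ * V * A - (Dᵀ * R * C + Bᵀ * V * A)ᵀ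
        * pinv (Dᵀ * R * D + Bᵀ * V * B) * (Dᵀ * R * C + Bᵀ * V * A)).PosSemidef := by
  have hRt := transpose_eq_of_posSemidef hR
  have hVt := transpose_eq_of_posSemidef hV
  refine posSemidef_of_quad_nonneg (riccati_transpose hRt hVt C D A B) fun x => ?_
  rw [← quad_minimum_eq hRt hVt C D A B x _ rfl]
  exact add_nonneg (quad_nonneg hR _) (quad_nonneg hV _)

end Quad

/-! ### Independence of σ-algebras -/

section Independence

variable {Ω : Type*} {mΩ : MeasurableSpace Ω} {μ : Measure Ω}

theorem MeasurableSpace.sup_eq_generateFrom_inter (b c : MeasurableSpace Ω) :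
    b ⊔ c = MeasurableSpace.generateFrom
      {u | ∃ s t, MeasurableSet[b] s ∧ MeasurableSet[c] t ∧ u = s ∩ t} := by
  apply le_antisymm
  · refine sup_le (fun s hs => ?_) (fun t ht => ?_)
    · exact MeasurableSpace.measurableSet_generateFrom
        ⟨s, Set.univ, hs, MeasurableSet.univ, by simp⟩
    · exact MeasurableSpace.measurableSet_generateFrom
        ⟨Set.univ, t, MeasurableSet.univ, ht, by simp⟩
  · refine MeasurableSpace.generateFrom_le ?_
    rintro u ⟨s, t, hs, ht, rfl⟩
    exact ((le_sup_left : b ≤ b ⊔ c) s hs).inter ((le_sup_right : c ≤ b ⊔ c) t ht)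

/-- On the π-system of intersections `s ∩ t` generating `b ⊔ c` the measure factors in two stages:
`t` splits off from `r ∩ s`, then `s` from `r`. This moves a σ-algebra across an independence
relation, which is how independence is carried along the filtration. -/
theorem ProbabilityTheory.Indep.sup_right [IsProbabilityMeasure μ] {a b c : MeasurableSpace Ω}
    (ha : a ≤ mΩ) (hb : b ≤ mΩ) (hc : c ≤ mΩ) (hab : Indep a b μ) (habc : Indep (a ⊔ b) c μ) :
    Indep a (b ⊔ c) μ := by
  refine IndepSets.indep ha (sup_le hb hc) (@MeasurableSpace.isPiSystem_measurableSet Ω a) ?_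
    (@MeasurableSpace.generateFrom_measurableSet Ω a).symm
    (MeasurableSpace.sup_eq_generateFrom_inter b c) ?_
  · rintro _ ⟨s, t, hs, ht, rfl⟩ _ ⟨s', t', hs', ht', rfl⟩ -
    exact ⟨s ∩ s', t ∩ t', hs.inter hs', ht.inter ht', Set.inter_inter_inter_comm _ _ _ _⟩
  · rw [IndepSets_iff]
    rintro r _ hr ⟨s, t, hs, ht, rfl⟩
    rw [Indep_iff] at hab habc
    have hbc := habc s t ((le_sup_right : b ≤ a ⊔ b) s hs) ht
    have h := habc (r ∩ s) t (((le_sup_left : a ≤ a ⊔ b) r hr).inter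
      ((le_sup_right : b ≤ a ⊔ b) s hs)) ht
    rw [← Set.inter_assoc, h, hab r s hr hs, hbc, mul_assoc]

theorem ProbabilityTheory.Indep.sup_left [IsProbabilityMeasure μ] {a b c : MeasurableSpace Ω}
    (ha : a ≤ mΩ) (hb : b ≤ mΩ) (hc : c ≤ mΩ) (hbc : Indep b c μ) (habc : Indep a (b ⊔ c) μ) :
    Indep (a ⊔ b) c μ := by
  have h := hbc.symm.sup_right hc hb ha (by rw [sup_comm]; exact habc.symm)
  rw [sup_comm]
  exact h.symm

theorem ProbabilityTheory.Indep.mono {a b c d : MeasurableSpace Ω} (h : Indep a b μ)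
    (hca : c ≤ a) (hdb : d ≤ b) : Indep c d μ := indep_of_indep_of_le h hca hdb

theorem ProbabilityTheory.IndepFun.of_indep {β γ : Type*} [MeasurableSpace β] [MeasurableSpace γ]
    {a b : MeasurableSpace Ω} (h : Indep a b μ) {f : Ω → β} {g : Ω → γ} (hf : Measurable[a] f)
    (hg : Measurable[b] g) : IndepFun f g μ := by
  rw [IndepFun_iff_Indep]
  exact h.mono hf.comap_le hg.comap_le

end Independence

/-! ### Mean vectors and cross covariance matrices -/

section CovMat

variable {Ω : Type*} {mΩ : MeasurableSpace Ω} {μ : Measure Ω}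
variable {κ ι σ τ : Type*} [Fintype κ] [Fintype ι] [Fintype σ] [Fintype τ]

/-- The mean vector of a random vector. -/
noncomputable def meanVec (μ : Measure Ω) (X : Ω → κ → ℝ) : κ → ℝ := fun i => ∫ ω, X ω i ∂μ

/-- The cross covariance matrix of two random vectors. -/
noncomputable def covMat (μ : Measure Ω) (X : Ω → κ → ℝ) (Y : Ω → ι → ℝ) : Matrix κ ι ℝ :=
  Matrix.of fun i j => cov[fun ω => X ω i, fun ω => Y ω j; μ]

theorem MemLp.coord {p : ℝ≥0∞} {X : Ω → κ → ℝ} (hX : MemLp X p μ) (i : κ) :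
    MemLp (fun ω => X ω i) p μ :=
  hX.eval i

theorem MemLp.mulVec {p : ℝ≥0∞} {X : Ω → κ → ℝ} (hX : MemLp X p μ) (A : Matrix σ κ ℝ) :
    MemLp (fun ω => A *ᵥ X ω) p μ := by
  have := (LinearMap.toContinuousLinearMap A.mulVecLin).comp_memLp' hX
  exact this

theorem HasGaussianLaw.mulVec {X : Ω → κ → ℝ} (hX : HasGaussianLaw X μ) (A : Matrix σ κ ℝ) :
    HasGaussianLaw (fun ω => A *ᵥ X ω) μ :=
  hX.map_fun (LinearMap.toContinuousLinearMap A.mulVecLin)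

theorem covMat_transpose (X : Ω → κ → ℝ) (Y : Ω → ι → ℝ) :
    (covMat μ X Y)ᵀ = covMat μ Y X := by
  ext i j
  exact covariance_comm _ _

theorem meanVec_mulVec {X : Ω → κ → ℝ} (hX : Integrable X μ) (A : Matrix σ κ ℝ) :
    meanVec μ (fun ω => A *ᵥ X ω) = A *ᵥ meanVec μ X := by
  ext i
  simp only [meanVec, Matrix.mulVec, dotProduct]
  rw [integral_finsetSum _ fun j _ => (hX.eval j).const_mul _]
  simp only [integral_const_mul]

theorem meanVec_add {X Y : Ω → κ → ℝ} (hX : Integrable X μ) (hY : Integrable Y μ) :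
    meanVec μ (fun ω => X ω + Y ω) = meanVec μ X + meanVec μ Y := by
  ext i
  exact integral_add (hX.eval i) (hY.eval i)

theorem covMat_mulVec_left [IsFiniteMeasure μ] {X : Ω → κ → ℝ} {Y : Ω → ι → ℝ} (hX : MemLp X 2 μ)
    (hY : MemLp Y 2 μ) (A : Matrix σ κ ℝ) :
    covMat μ (fun ω => A *ᵥ X ω) Y = A * covMat μ X Y := by
  ext i j
  simp only [covMat, Matrix.mulVec, dotProduct, Matrix.of_apply, Matrix.mul_apply]
  rw [covariance_fun_sum_left (fun k => (MemLp.coord hX k).const_mul (A i k)) (MemLp.coord hY j)]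
  simp only [covariance_const_mul_left]

theorem covMat_mulVec_right [IsFiniteMeasure μ] {X : Ω → κ → ℝ} {Y : Ω → ι → ℝ} (hX : MemLp X 2 μ)
    (hY : MemLp Y 2 μ) (A : Matrix σ ι ℝ) :
    covMat μ X (fun ω => A *ᵥ Y ω) = covMat μ X Y * Aᵀ := by
  rw [← covMat_transpose, covMat_mulVec_left hY hX, Matrix.transpose_mul, covMat_transpose]

theorem covMat_add_left [IsFiniteMeasure μ] {X X' : Ω → κ → ℝ} {Y : Ω → ι → ℝ} (hX : MemLp X 2 μ)
    (hX' : MemLp X' 2 μ) (hY : MemLp Y 2 μ) :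
    covMat μ (fun ω => X ω + X' ω) Y = covMat μ X Y + covMat μ X' Y := by
  ext i j
  exact covariance_add_left (MemLp.coord hX i) (MemLp.coord hX' i) (MemLp.coord hY j)

theorem covMat_add_right [IsFiniteMeasure μ] {X : Ω → κ → ℝ} {Y Y' : Ω → ι → ℝ} (hX : MemLp X 2 μ)
    (hY : MemLp Y 2 μ) (hY' : MemLp Y' 2 μ) :
    covMat μ X (fun ω => Y ω + Y' ω) = covMat μ X Y + covMat μ X Y' := by
  ext i j
  exact covariance_add_right (MemLp.coord hX i) (MemLp.coord hY j) (MemLp.coord hY' j)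

theorem covMat_eq_zero_of_indepFun {X : Ω → κ → ℝ} {Y : Ω → ι → ℝ}
    (hX : MemLp X 2 μ) (hY : MemLp Y 2 μ) (h : IndepFun X Y μ) : covMat μ X Y = 0 := by
  ext i j
  exact (h.comp (measurable_pi_apply i) (measurable_pi_apply j)).covariance_eq_zero
    (MemLp.coord hX i) (MemLp.coord hY j)

/-- Joint Gaussianity is what turns the matrix identities of the Kalman filter into independence. -/
theorem indepFun_of_covMat_eq_zero {X : Ω → κ → ℝ} {Y : Ω → ι → ℝ}
    (hXY : HasGaussianLaw (fun ω => (X ω, Y ω)) μ) (h : covMat μ X Y = 0) : IndepFun X Y μ :=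
  HasGaussianLaw.indepFun_of_covariance_eval (X := fun i ω => X ω i) (Y := fun j ω => Y ω j) hXY
    fun i j => congrFun (congrFun h i) j

theorem hasGaussianLaw_of_multivariateGaussian [DecidableEq κ] [IsProbabilityMeasure μ]
    {X : Ω → κ → ℝ} {m : EuclideanSpace ℝ κ} {S : Matrix κ κ ℝ}
    (h : HasLaw (fun ω => WithLp.toLp 2 (X ω)) (multivariateGaussian m S) μ) :
    HasGaussianLaw X μ :=
  (h.hasGaussianLaw).map_equiv_fun (PiLp.continuousLinearEquiv 2 ℝ (fun _ : κ => ℝ))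

theorem meanVec_of_multivariateGaussian [DecidableEq κ] [IsProbabilityMeasure μ]
    {X : Ω → κ → ℝ} {m : EuclideanSpace ℝ κ} {S : Matrix κ κ ℝ}
    (h : HasLaw (fun ω => WithLp.toLp 2 (X ω)) (multivariateGaussian m S) μ) :
    meanVec μ X = m := by
  have h1 : ∫ ω, WithLp.toLp 2 (X ω) ∂μ = m := by
    have := h.integral_comp (f := fun x => x) (by fun_prop)
    simpa [Function.comp_def] using this
  have hi := (h.hasGaussianLaw).integrable
  ext i
  rw [← h1]
  have := (EuclideanSpace.proj (𝕜 := ℝ) i).integral_comp_comm hi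
  simpa [meanVec] using this

theorem covMat_of_multivariateGaussian [DecidableEq κ] [IsProbabilityMeasure μ]
    {X : Ω → κ → ℝ} {m : EuclideanSpace ℝ κ} {S : Matrix κ κ ℝ} (hS : S.PosSemidef)
    (h : HasLaw (fun ω => WithLp.toLp 2 (X ω)) (multivariateGaussian m S) μ) :
    covMat μ X X = S := by
  ext i j
  rw [← covariance_eval_multivariateGaussian (μ := m) hS i j, ← h.map_eq]
  rw [covariance_map (by fun_prop) (by fun_prop) h.aemeasurable]
  rfl

end CovMat

/-! ### Mean square limits -/

section MeanSquareLimits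

variable {Ω : Type*} {mΩ : MeasurableSpace Ω} {μ : Measure Ω}

/-- Continuity of the inner product of `L²`, which gives convergence of all first and second
moments. -/
theorem tendsto_integral_mul_of_tendsto_eLpNorm {f g : ℕ → Ω → ℝ} {f' g' : Ω → ℝ}
    (hf : ∀ k, MemLp (f k) 2 μ) (hg : ∀ k, MemLp (g k) 2 μ) (hf' : MemLp f' 2 μ)
    (hg' : MemLp g' 2 μ) (hlf : Tendsto (fun k => eLpNorm (f k - f') 2 μ) atTop (𝓝 0))
    (hlg : Tendsto (fun k => eLpNorm (g k - g') 2 μ) atTop (𝓝 0)) :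
    Tendsto (fun k => ∫ ω, f k ω * g k ω ∂μ) atTop (𝓝 (∫ ω, f' ω * g' ω ∂μ)) := by
  have h1 := (Lp.tendsto_Lp_iff_tendsto_eLpNorm'' f hf f' hf').2 hlf
  have h2 := (Lp.tendsto_Lp_iff_tendsto_eLpNorm'' g hg g' hg').2 hlg
  have key : ∀ {a b : Ω → ℝ} (ha : MemLp a 2 μ) (hb : MemLp b 2 μ),
      inner ℝ (hb.toLp b) (ha.toLp a) = ∫ ω, a ω * b ω ∂μ := by
    intro a b ha hb
    rw [MeasureTheory.L2.inner_def]
    refine integral_congr_ae ?_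
    filter_upwards [ha.coeFn_toLp, hb.coeFn_toLp] with ω h h'
    rw [h, h']
    simp
  have := h2.inner (𝕜 := ℝ) h1
  simpa only [key] using this

theorem tendsto_integral_of_tendsto_eLpNorm [IsProbabilityMeasure μ] {f : ℕ → Ω → ℝ} {f' : Ω → ℝ}
    (hf : ∀ k, MemLp (f k) 2 μ) (hf' : MemLp f' 2 μ)
    (hlf : Tendsto (fun k => eLpNorm (f k - f') 2 μ) atTop (𝓝 0)) :
    Tendsto (fun k => ∫ ω, f k ω ∂μ) atTop (𝓝 (∫ ω, f' ω ∂μ)) := by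
  have := tendsto_integral_mul_of_tendsto_eLpNorm (g := fun _ _ => (1 : ℝ)) (g' := fun _ => 1)
    hf (fun _ => memLp_const _) hf' (memLp_const _) hlf (by simp)
  simpa using this

theorem tendsto_covariance_of_tendsto_eLpNorm [IsProbabilityMeasure μ] {f g : ℕ → Ω → ℝ}
    {f' g' : Ω → ℝ}
    (hf : ∀ k, MemLp (f k) 2 μ) (hg : ∀ k, MemLp (g k) 2 μ) (hf' : MemLp f' 2 μ)
    (hg' : MemLp g' 2 μ) (hlf : Tendsto (fun k => eLpNorm (f k - f') 2 μ) atTop (𝓝 0))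
    (hlg : Tendsto (fun k => eLpNorm (g k - g') 2 μ) atTop (𝓝 0)) :
    Tendsto (fun k => cov[f k, g k; μ]) atTop (𝓝 (cov[f', g'; μ])) := by
  rw [covariance_eq_sub hf' hg']
  simp_rw [fun k => covariance_eq_sub (hf k) (hg k)]
  exact (tendsto_integral_mul_of_tendsto_eLpNorm hf hg hf' hg' hlf hlg).sub
    ((tendsto_integral_of_tendsto_eLpNorm hf hf' hlf).mul
      (tendsto_integral_of_tendsto_eLpNorm hg hg' hlg))

theorem memLp_of_tendsto_eLpNorm {E : Type*} [NormedAddCommGroup E] {f : ℕ → Ω → E} {f' : Ω → E}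
    (hf : ∀ k, MemLp (f k) 2 μ) (hf' : AEStronglyMeasurable f' μ)
    (hlf : Tendsto (fun k => eLpNorm (f k - f') 2 μ) atTop (𝓝 0)) : MemLp f' 2 μ := by
  obtain ⟨k, hk⟩ := (hlf.eventually (gt_mem_nhds (show (0 : ℝ≥0∞) < 1 by simp))).exists
  have h : MemLp (f k - f') 2 μ :=
    ⟨(hf k).aestronglyMeasurable.sub hf', hk.trans ENNReal.one_lt_top⟩
  have := (hf k).sub h
  simpa using this

theorem tendsto_eLpNorm_comp_clm {E F : Type*} [NormedAddCommGroup E] [NormedSpace ℝ E]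
    [NormedAddCommGroup F] [NormedSpace ℝ F] {f : ℕ → Ω → E} {f' : Ω → E} (L : E →L[ℝ] F)
    (hlf : Tendsto (fun k => eLpNorm (f k - f') 2 μ) atTop (𝓝 0)) :
    Tendsto (fun k => eLpNorm ((fun ω => L (f k ω)) - fun ω => L (f' ω)) 2 μ) atTop (𝓝 0) := by
  have h : ∀ k, eLpNorm ((fun ω => L (f k ω)) - fun ω => L (f' ω)) 2 μ
      ≤ ENNReal.ofReal ‖L‖ * eLpNorm (f k - f') 2 μ := by
    intro k
    refine eLpNorm_le_mul_eLpNorm_of_ae_le_mul (Eventually.of_forall fun ω => ?_) 2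
    simp only [Pi.sub_apply, ← map_sub]
    exact L.le_opNorm _
  have h0 : Tendsto (fun k => ENNReal.ofReal ‖L‖ * eLpNorm (f k - f') 2 μ) atTop (𝓝 0) := by
    have := ENNReal.Tendsto.const_mul (a := ENNReal.ofReal ‖L‖) hlf (Or.inr ENNReal.ofReal_ne_top)
    simpa using this
  exact tendsto_of_tendsto_of_tendsto_of_le_of_le tendsto_const_nhds h0 (fun _ => zero_le) h

/-- A mean square limit of Gaussian random vectors is Gaussian. -/
theorem hasGaussianLaw_of_tendsto_eLpNorm {E : Type*} [NormedAddCommGroup E] [NormedSpace ℝ E]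
    [MeasurableSpace E] [BorelSpace E] [CompleteSpace E] [SecondCountableTopology E]
    [IsProbabilityMeasure μ] {f : ℕ → Ω → E} {f' : Ω → E}
    (hf : ∀ k, HasGaussianLaw (f k) μ) (hf' : AEStronglyMeasurable f' μ)
    (hlf : Tendsto (fun k => eLpNorm (f k - f') 2 μ) atTop (𝓝 0)) : HasGaussianLaw f' μ := by
  have hm : MemLp f' 2 μ := memLp_of_tendsto_eLpNorm (fun k => (hf k).memLp_two) hf' hlf
  rw [hasGaussianLaw_iff_charFunDual_map_eq hm.aestronglyMeasurable.aemeasurable]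
  intro L
  have hLm : ∀ k, MemLp (fun ω => L (f k ω)) 2 μ := fun k => L.comp_memLp' (hf k).memLp_two
  have hLm' : MemLp (fun ω => L (f' ω)) 2 μ := L.comp_memLp' hm
  have hL := tendsto_eLpNorm_comp_clm L hlf
  -- An almost everywhere convergent subsequence suffices: the two limits of its characteristic
  -- functions, computed below, must agree.
  obtain ⟨ns, hns, hae⟩ := (tendstoInMeasure_of_tendsto_eLpNorm two_ne_zero
    (fun k => (hLm k).aestronglyMeasurable) hLm'.aestronglyMeasurable hL).exists_seq_tendsto_ae
  have hchar : ∀ {g : Ω → E}, AEMeasurable g μ →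
      charFunDual (μ.map g) L = ∫ ω, Complex.exp ((L (g ω) : ℂ) * Complex.I) ∂μ := by
    intro g hg
    rw [charFunDual_apply, integral_map hg (by fun_prop)]
  have h1 : Tendsto (fun k => charFunDual (μ.map (f (ns k))) L) atTop
      (𝓝 (charFunDual (μ.map f') L)) := by
    rw [hchar hm.aestronglyMeasurable.aemeasurable]
    simp_rw [fun k => hchar (hf (ns k)).aemeasurable]
    -- The integrands have modulus one.
    refine tendsto_integral_of_dominated_convergence (fun _ => (1 : ℝ)) (fun k => ?_)
      (integrable_const _) (fun k => Eventually.of_forall fun ω => ?_) ?_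
    · have := (hLm (ns k)).aestronglyMeasurable
      exact Complex.continuous_exp.comp_aestronglyMeasurable
        ((Complex.continuous_ofReal.comp_aestronglyMeasurable this).mul_const _)
    · rw [Complex.norm_exp_ofReal_mul_I]
    · filter_upwards [hae] with ω hω
      exact (Complex.continuous_exp.tendsto _).comp
        (((Complex.continuous_ofReal.tendsto _).comp hω).mul_const _)
  -- The same functions in their Gaussian form, where mean and variance converge by mean square
  -- convergence.
  have h2 : Tendsto (fun k => charFunDual (μ.map (f (ns k))) L) atTop
      (𝓝 (Complex.exp ((μ[L ∘ f'] : ℝ) * Complex.I - Var[L ∘ f'; μ] / 2))) := by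
    simp_rw [fun k => (hf (ns k)).charFunDual_map_eq L]
    have hmean := (tendsto_integral_of_tendsto_eLpNorm hLm hLm' hL).comp hns.tendsto_atTop
    have hvar := (tendsto_covariance_of_tendsto_eLpNorm hLm hLm hLm' hLm' hL hL).comp
      hns.tendsto_atTop
    rw [covariance_self hLm'.aestronglyMeasurable.aemeasurable] at hvar
    have hv : ∀ k, cov[fun ω => L (f k ω), fun ω => L (f k ω); μ] = Var[L ∘ f k; μ] :=
      fun k => covariance_self (hLm k).aestronglyMeasurable.aemeasurable
    simp only [Function.comp_def, hv] at hvar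
    refine (Complex.continuous_exp.tendsto _).comp (Tendsto.sub ?_ ?_)
    · exact ((Complex.continuous_ofReal.tendsto _).comp hmean).mul_const _
    · exact ((Complex.continuous_ofReal.tendsto _).comp hvar).div_const _
  exact tendsto_nhds_unique h1 h2

/-- A mean square limit of `m`-measurable random vectors has an `m`-measurable version. -/
theorem exists_measurable_version_of_tendsto_eLpNorm {E : Type*} [NormedAddCommGroup E]
    [MeasurableSpace E] [BorelSpace E] [CompleteSpace E] [SecondCountableTopology E]
    {f : ℕ → Ω → E} {f' : Ω → E} (hf' : AEStronglyMeasurable f' μ)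
    {m : MeasurableSpace Ω} (hm : m ≤ mΩ) (hf : ∀ k, Measurable[m] (f k))
    (hlf : Tendsto (fun k => eLpNorm (f k - f') 2 μ) atTop (𝓝 0)) :
    ∃ g : Ω → E, Measurable[m] g ∧ f' =ᵐ[μ] g := by
  obtain ⟨ns, hns, hae⟩ := (tendstoInMeasure_of_tendsto_eLpNorm two_ne_zero
    (fun k => ((hf k).mono hm le_rfl).aestronglyMeasurable) hf' hlf).exists_seq_tendsto_ae
  have : Nonempty E := ⟨0⟩
  -- `limUnder` is defined everywhere and keeps `m`-measurability; its value where the subsequence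
  -- diverges does not matter, because this set is null.
  refine ⟨fun ω => limUnder atTop fun k => f (ns k) ω, ?_, ?_⟩
  · exact (StronglyMeasurable.limUnder fun k => (hf (ns k)).stronglyMeasurable).measurable
  · filter_upwards [hae] with ω hω
    exact hω.limUnder_eq.symm

end MeanSquareLimits

/-! ### Quadratic costs of sums of independent vectors -/

section QuadIndep

variable {Ω : Type*} {mΩ : MeasurableSpace Ω} {μ : Measure Ω} {κ : Type*} [Fintype κ]

theorem measurable_quad (M : Matrix κ κ ℝ) : Measurable (quad M) := (continuous_quad M).measurable

theorem integrable_quad {Y : Ω → κ → ℝ} (hY : MemLp Y 2 μ) (M : Matrix κ κ ℝ) :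
    Integrable (fun ω => quad M (Y ω)) μ := by
  unfold quad dotProduct
  refine integrable_finsetSum _ fun i _ => ?_
  exact (hY.eval i).integrable_mul ((MemLp.mulVec hY M).eval i)

theorem lintegral_quad_lt_top {Y : Ω → κ → ℝ} (hY : MemLp Y 2 μ) (M : Matrix κ κ ℝ) :
    ∫⁻ ω, ENNReal.ofReal (quad M (Y ω)) ∂μ < ∞ :=
  (integrable_quad hY M).lintegral_lt_top

/-- The cross term is linear in the centred vector `Y`, so its integral is zero. -/
theorem lintegral_quad_const_add [IsProbabilityMeasure μ] {M : Matrix κ κ ℝ} (hM : M.PosSemidef)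
    {Y : Ω → κ → ℝ} (hY : MemLp Y 2 μ) (hmean : meanVec μ Y = 0) (x : κ → ℝ) :
    ∫⁻ ω, ENNReal.ofReal (quad M (x + Y ω)) ∂μ =
      ENNReal.ofReal (quad M x) + ∫⁻ ω, ENNReal.ofReal (quad M (Y ω)) ∂μ := by
  have hMt := transpose_eq_of_posSemidef hM
  have hi : Integrable (fun ω => quad M (x + Y ω)) μ :=
    integrable_quad ((memLp_const x).add hY) M
  have hlin : ∫ ω, Y ω ⬝ᵥ (M *ᵥ x) ∂μ = 0 := by
    simp only [dotProduct]
    rw [integral_finsetSum _ fun j _ => ((hY.eval j).integrable one_le_two).mul_const _]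
    refine Finset.sum_eq_zero fun j _ => ?_
    rw [integral_mul_const]
    have : ∫ ω, Y ω j ∂μ = 0 := congrFun hmean j
    rw [this, zero_mul]
  have hlini : Integrable (fun ω => Y ω ⬝ᵥ (M *ᵥ x)) μ := by
    simp only [dotProduct]
    exact integrable_finsetSum _ fun j _ => ((hY.eval j).integrable one_le_two).mul_const _
  rw [← ofReal_integral_eq_lintegral_ofReal hi (Eventually.of_forall fun _ => quad_nonneg hM _),
    ← ofReal_integral_eq_lintegral_ofReal (integrable_quad hY M)
      (Eventually.of_forall fun _ => quad_nonneg hM _),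
    ← ENNReal.ofReal_add (quad_nonneg hM _) (integral_nonneg fun _ => quad_nonneg hM _)]
  congr 1
  simp_rw [quad_add hMt]
  have h1 : Integrable (fun ω => quad M x + 2 * (Y ω ⬝ᵥ (M *ᵥ x))) μ :=
    (integrable_const _).add (hlini.const_mul _)
  rw [integral_add h1 (integrable_quad hY M), integral_add (integrable_const _) (hlini.const_mul _), integral_const_mul, hlin]
  simp

/-- The expected quadratic cost of a random vector (which need not be square integrable) plus an
independent centred square integrable one. -/
theorem lintegral_quad_add_of_indepFun [IsProbabilityMeasure μ] {M : Matrix κ κ ℝ}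
    (hM : M.PosSemidef) {X Y : Ω → κ → ℝ} (hX : Measurable X) (hYm : Measurable Y)
    (hY : MemLp Y 2 μ) (hmean : meanVec μ Y = 0) (hXY : IndepFun X Y μ) :
    ∫⁻ ω, ENNReal.ofReal (quad M (X ω + Y ω)) ∂μ =
      ∫⁻ ω, ENNReal.ofReal (quad M (X ω)) ∂μ + ∫⁻ ω, ENNReal.ofReal (quad M (Y ω)) ∂μ := by
  have hq := measurable_quad M
  have hlaw := (indepFun_iff_map_prod_eq_prod_map_map hX.aemeasurable hYm.aemeasurable).1 hXY
  have hmeas : Measurable fun z : (κ → ℝ) × (κ → ℝ) => ENNReal.ofReal (quad M (z.1 + z.2)) :=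
    (hq.comp (measurable_fst.add measurable_snd)).ennreal_ofReal
  have hprob : IsProbabilityMeasure (μ.map Y) := Measure.isProbabilityMeasure_map hYm.aemeasurable
  have hprob' : IsProbabilityMeasure (μ.map X) :=
    Measure.isProbabilityMeasure_map hX.aemeasurable
  have h1 : ∫⁻ ω, ENNReal.ofReal (quad M (X ω + Y ω)) ∂μ =
      ∫⁻ z, ENNReal.ofReal (quad M (z.1 + z.2)) ∂(μ.map fun ω => (X ω, Y ω)) := by
    rw [lintegral_map hmeas (hX.prodMk hYm)]
  -- With the product law, the value of `X` is frozen before expanding the square; thus the cross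
  -- term is integrated only over `Y` and no moment of `X` is needed.
  rw [h1, hlaw, lintegral_prod _ hmeas.aemeasurable]
  have h2 : ∀ x, ∫⁻ y, ENNReal.ofReal (quad M (x + y)) ∂(μ.map Y) =
      ENNReal.ofReal (quad M x) + ∫⁻ ω, ENNReal.ofReal (quad M (Y ω)) ∂μ := by
    intro x
    have hqx : Measurable fun y => ENNReal.ofReal (quad M (x + y)) :=
      (hq.comp (measurable_const_add x)).ennreal_ofReal
    rw [lintegral_map hqx hYm,
      lintegral_quad_const_add hM hY hmean]
  simp only [h2]
  rw [lintegral_add_right _ measurable_const, lintegral_const, measure_univ, mul_one,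
    lintegral_map hq.ennreal_ofReal hX]

end QuadIndep

/-! ### Algebra of the steady-state Kalman filter -/

namespace CPS

variable {n m p s : ℕ} {S : CPS n m p s}

theorem Snu_posDef (hS : S.Standing) : S.Snu.PosDef := by
  have h := hS.P_posSemidef.mul_mul_conjTranspose_same S.C
  rw [Matrix.conjTranspose_eq_transpose_of_trivial] at h
  exact Matrix.PosDef.posSemidef_add h hS.Sv_posDef

theorem K_mul_Snu (hS : S.Standing) : S.K * S.Snu = S.P * S.Cᵀ := by
  have hu : IsUnit S.Snu.det := (Snu_posDef hS).det_pos.ne'.isUnit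
  rw [K, Matrix.mul_assoc, Matrix.nonsing_inv_mul _ hu, Matrix.mul_one]

/-- The filtered error is uncorrelated with the innovation. -/
theorem filter_orthogonality (hS : S.Standing) :
    (1 - S.K * S.C) * S.P * S.Cᵀ = S.K * S.Sv := by
  have h := K_mul_Snu hS
  rw [Snu, Matrix.mul_add] at h
  rw [Matrix.sub_mul, Matrix.sub_mul, Matrix.one_mul, ← h]
  simp only [Matrix.mul_assoc]
  abel

/-- The left side is the covariance of the filtered error. By orthogonality `(1 - KC) P Cᵀ Kᵀ = K
Σ_v Kᵀ`, which cancels the noise term. -/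
theorem filter_covariance (hS : S.Standing) :
    (1 - S.K * S.C) * S.P * (1 - S.K * S.C)ᵀ + S.K * S.Sv * S.Kᵀ = (1 - S.K * S.C) * S.P := by
  rw [Matrix.transpose_sub, Matrix.transpose_mul, Matrix.transpose_one, Matrix.mul_sub,
    Matrix.mul_one, ← Matrix.mul_assoc, filter_orthogonality hS]
  abel

theorem riccati_filter (hS : S.Standing) :
    S.P = S.A * ((1 - S.K * S.C) * S.P * (1 - S.K * S.C)ᵀ + S.K * S.Sv * S.Kᵀ) * S.Aᵀ + S.Sw := by
  rw [filter_covariance hS]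
  conv_lhs => rw [hS.riccati]
  simp only [K, Matrix.mul_sub, Matrix.sub_mul, Matrix.one_mul, Matrix.mul_assoc]
  abel

/-- The closed-loop matrix `A (I - K C)` of the prediction error. -/
noncomputable def F (S : CPS n m p s) : Matrix (Fin n) (Fin n) ℝ := S.A * (1 - S.K * S.C)

/-- With the gain `K` held fixed the Riccati equation becomes a Lyapunov equation for `F`. It yields
both the stability of `F` and the uniqueness of the stationary error covariance. -/
theorem riccati_prediction (hS : S.Standing) :
    S.P = S.F * S.P * S.Fᵀ + (S.A * S.K * S.Sv * S.Kᵀ * S.Aᵀ + S.Sw) := by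
  conv_lhs => rw [riccati_filter hS]
  simp only [F, Matrix.transpose_mul, Matrix.mul_add, Matrix.add_mul, Matrix.mul_assoc]
  abel

/-- This makes the forcing term in the recursion for the covariance of error and prediction vanish
at the stationary covariance `P`. -/
theorem prediction_orthogonality (hS : S.Standing) : S.F * S.P * S.Cᵀ = S.A * S.K * S.Sv := by
  rw [F, Matrix.mul_assoc, Matrix.mul_assoc, ← Matrix.mul_assoc _ S.P, filter_orthogonality hS,
    Matrix.mul_assoc]

end CPS

/-! ### Discrete Lyapunov equations -/

section Lyapunov

variable {κ : Type*} [Fintype κ] [DecidableEq κ]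

open scoped MatrixOrder Matrix.Norms.L2Operator in
theorem exists_transpose_mul_self_of_posDef {W : Matrix κ κ ℝ} (hW : W.PosDef) :
    ∃ U : Matrix κ κ ℝ, IsUnit U.det ∧ W = Uᵀ * U := by
  obtain ⟨U, hU⟩ := CStarAlgebra.nonneg_iff_eq_star_mul_self.mp hW.posSemidef.nonneg
  have hU' : W = Uᵀ * U := by
    rw [hU, Matrix.star_eq_conjTranspose, Matrix.conjTranspose_eq_transpose_of_trivial]
  refine ⟨U, ?_, hU'⟩
  have := hW.det_pos.ne'
  rw [hU', Matrix.det_mul] at this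
  exact (right_ne_zero_of_mul this).isUnit

theorem lyapunov_telescope {F P W : Matrix κ κ ℝ} (h : P = F * P * Fᵀ + W) (k : ℕ) :
    P = F ^ k * P * (F ^ k)ᵀ + ∑ j ∈ Finset.range k, F ^ j * W * (F ^ j)ᵀ := by
  induction k with
  | zero => simp
  | succ k ih =>
    conv_lhs => rw [ih]
    rw [Finset.sum_range_succ, pow_succ, Matrix.transpose_mul]
    conv_lhs => rw [h]
    simp only [Matrix.mul_add, Matrix.add_mul, Matrix.mul_assoc]
    abel

/-- If the Lyapunov equation `P = F P Fᵀ + W` with `W ≻ 0` has a solution `P ⪰ 0`, then `F` is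
stable. -/
theorem tendsto_pow_of_lyapunov {F P W : Matrix κ κ ℝ} (hP : P.PosSemidef) (hW : W.PosDef)
    (h : P = F * P * Fᵀ + W) : Tendsto (fun k : ℕ => F ^ k) atTop (𝓝 0) := by
  have hWt := transpose_eq_of_posSemidef hW.posSemidef
  -- By the telescoped equation the partial sums are at most `xᵀ P x`, hence the terms tend to zero.
  have hsum : ∀ x : κ → ℝ, Summable fun j : ℕ => quad W ((F ^ j)ᵀ *ᵥ x) := by
    intro x
    refine summable_of_sum_range_le (c := quad P x) (fun j => quad_nonneg hW.posSemidef _) fun k => ?_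
    have h1 := congrArg (fun M => quad M x) (lyapunov_telescope h k)
    simp only [quad_add_matrix] at h1
    have h2 : quad (F ^ k * P * (F ^ k)ᵀ) x = quad P ((F ^ k)ᵀ *ᵥ x) := by
      rw [quad_mulVec, Matrix.transpose_transpose]
    have h3 : quad (∑ j ∈ Finset.range k, F ^ j * W * (F ^ j)ᵀ) x =
        ∑ j ∈ Finset.range k, quad W ((F ^ j)ᵀ *ᵥ x) := by
      simp only [quad_mulVec, Matrix.transpose_transpose]
      simp only [quad, Matrix.sum_mulVec, dotProduct_sum]
    have h4 := quad_nonneg hP ((F ^ k)ᵀ *ᵥ x)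
    linarith
  -- With `W = UᵀU` the terms are `|U (Fᵏ)ᵀ x|²`, and the invertible `U` can be removed.
  obtain ⟨U, hU, hWU⟩ := exists_transpose_mul_self_of_posDef hW
  have hvec : ∀ x : κ → ℝ, Tendsto (fun k : ℕ => (F ^ k)ᵀ *ᵥ x) atTop (𝓝 0) := by
    intro x
    have h0 := (hsum x).tendsto_atTop_zero
    have hUk : Tendsto (fun k : ℕ => U *ᵥ ((F ^ k)ᵀ *ᵥ x)) atTop (𝓝 0) := by
      rw [tendsto_pi_nhds]
      intro i
      have hle : ∀ k : ℕ, (U *ᵥ ((F ^ k)ᵀ *ᵥ x)) i ^ 2 ≤ quad W ((F ^ k)ᵀ *ᵥ x) := by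
        intro k
        have : quad W ((F ^ k)ᵀ *ᵥ x) = ∑ i, (U *ᵥ ((F ^ k)ᵀ *ᵥ x)) i ^ 2 := by
          rw [hWU, quad, ← Matrix.mulVec_mulVec, ← mulVec_dotProduct_eq]
          simp [dotProduct, sq]
        rw [this]
        exact Finset.single_le_sum (f := fun i => (U *ᵥ ((F ^ k)ᵀ *ᵥ x)) i ^ 2)
          (fun _ _ => sq_nonneg _) (Finset.mem_univ i)
      have hsq : Tendsto (fun k : ℕ => (U *ᵥ ((F ^ k)ᵀ *ᵥ x)) i ^ 2) atTop (𝓝 0) :=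
        tendsto_of_tendsto_of_tendsto_of_le_of_le tendsto_const_nhds h0 (fun _ => sq_nonneg _) hle
      have habs := (Real.continuous_sqrt.tendsto _).comp hsq
      rw [Real.sqrt_zero] at habs
      refine (tendsto_zero_iff_abs_tendsto_zero _).2 ?_
      simpa [Function.comp_def, Real.sqrt_sq_eq_abs] using habs
    have := ((by fun_prop : Continuous fun y : κ → ℝ => U⁻¹ *ᵥ y).tendsto 0).comp hUk
    simpa [Function.comp_def, Matrix.mulVec_mulVec, ← Matrix.mul_assoc,
      Matrix.nonsing_inv_mul _ hU] using this
  refine tendsto_pi_nhds.2 fun i => tendsto_pi_nhds.2 fun j => ?_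
  -- `(Fᵏ)ᵀ` applied to the `i`-th basis vector is the `i`-th row of `Fᵏ`.
  have := (tendsto_pi_nhds.1 (hvec (Pi.single i 1))) j
  simpa [-Matrix.transpose_pow] using this

/-- Iterating the equation gives `X = Fᵏ X (Mᵏ)ᵀ` for every `k`, and the right side tends to zero.
-/
theorem eq_zero_of_eq_mul_mul {F M X : Matrix κ κ ℝ} (hF : Tendsto (fun k : ℕ => F ^ k) atTop (𝓝 0))
    (hM : Tendsto (fun k : ℕ => M ^ k) atTop (𝓝 0)) (h : X = F * X * Mᵀ) : X = 0 := by
  have hk : ∀ k : ℕ, X = F ^ k * X * (M ^ k)ᵀ := by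
    intro k
    induction k with
    | zero => simp
    | succ k ih =>
      conv_lhs => rw [ih, h]
      rw [pow_succ, pow_succ, Matrix.transpose_mul]
      simp only [Matrix.mul_assoc]
  have hlim : Tendsto (fun k : ℕ => F ^ k * X * (M ^ k)ᵀ) atTop (𝓝 (0 * X * (0 : Matrix κ κ ℝ)ᵀ)) :=
    (hF.mul_const X).mul ((Continuous.matrix_transpose continuous_id).tendsto _ |>.comp hM)
  have hc : Tendsto (fun _ : ℕ => X) atTop (𝓝 X) := tendsto_const_nhds
  refine tendsto_nhds_unique hc ?_
  have : (fun _ : ℕ => X) = fun k : ℕ => F ^ k * X * (M ^ k)ᵀ := funext hk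
  rw [this]
  simpa using hlim

end Lyapunov

/-- `P` is the Lyapunov certificate: the constant term `A K Σ_v Kᵀ Aᵀ + Σ_w` of its equation is
positive definite because `Σ_w` is. -/
theorem CPS.tendsto_F_pow {n m p s : ℕ} {S : CPS n m p s} (hS : S.Standing) :
    Tendsto (fun k : ℕ => S.F ^ k) atTop (𝓝 0) := by
  refine tendsto_pow_of_lyapunov hS.P_posSemidef ?_ (riccati_prediction hS)
  have h := hS.Sv_posDef.posSemidef.mul_mul_conjTranspose_same (S.A * S.K)
  rw [Matrix.conjTranspose_eq_transpose_of_trivial, Matrix.transpose_mul, ← Matrix.mul_assoc] at h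
  exact Matrix.PosDef.posSemidef_add h hS.Sw_posDef

/-! ### The innovation process -/

/-- A centred Gaussian random vector with covariance matrix `M`. -/
structure IsCentredGaussian {Ω κ : Type*} {mΩ : MeasurableSpace Ω} [Fintype κ] (μ : Measure Ω)
    (M : Matrix κ κ ℝ) (X : Ω → κ → ℝ) : Prop where
  measurable : Measurable X
  gaussian : HasGaussianLaw X μ
  mean : meanVec μ X = 0
  cov : covMat μ X X = M

namespace CPS

variable {n m p s : ℕ}

/-- The prediction error after `t` steps of the Kalman filter. -/
noncomputable def err (S : CPS n m p s) (x : Vec n) (w : ℕ → Vec n) (v : ℕ → Vec p) : ℕ → Vec n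
  | 0 => x
  | t + 1 => S.A *ᵥ (S.err x w v t - S.K *ᵥ (S.C *ᵥ S.err x w v t + v t)) + w t

/-- The innovation of the Kalman filter. -/
noncomputable def innov (S : CPS n m p s) (x : Vec n) (w : ℕ → Vec n) (v : ℕ → Vec p) (t : ℕ) :
    Vec p :=
  S.C *ᵥ S.err x w v t + v t

/-- The filtered error of the Kalman filter. -/
noncomputable def ferr (S : CPS n m p s) (x : Vec n) (w : ℕ → Vec n) (v : ℕ → Vec p) (t : ℕ) :
    Vec n :=
  S.err x w v t - S.K *ᵥ S.innov x w v t

theorem err_succ (S : CPS n m p s) (x : Vec n) (w : ℕ → Vec n) (v : ℕ → Vec p) (t : ℕ) :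
    S.err x w v (t + 1) = S.A *ᵥ S.ferr x w v t + w t := rfl

variable {Ω : Type*} {mΩ : MeasurableSpace Ω} {μ : Measure Ω}

/-- The prediction error `ε`, given the past information `G` and future noises `𝒩`, when the Kalman
filter is in steady state. -/
structure IsSteady (S : CPS n m p s) (μ : Measure Ω) (ε : Ω → Vec n)
    (G 𝒩 : MeasurableSpace Ω) : Prop where
  err : IsCentredGaussian μ S.P ε
  le : G ≤ mΩ
  indep_err : Indep (MeasurableSpace.comap ε inferInstance) G μ
  indep_noise : Indep (G ⊔ MeasurableSpace.comap ε inferInstance) 𝒩 μ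

/-- Properties of the innovation `ν` and of the filtered error `η`, given the past `G`. -/
structure IsInnovation (S : CPS n m p s) (μ : Measure Ω) (ν : Ω → Vec p) (η : Ω → Vec n)
    (G : MeasurableSpace Ω) : Prop where
  measurable_innov : Measurable[mΩ] ν
  measurable_ferr : Measurable[mΩ] η
  memLp_innov : MemLp ν 2 μ
  memLp_ferr : MemLp η 2 μ
  mean_innov : meanVec μ ν = 0
  mean_ferr : meanVec μ η = 0
  indep_innov : Indep (MeasurableSpace.comap ν inferInstance) G μ
  indep_ferr : Indep (MeasurableSpace.comap η inferInstance)
    (G ⊔ MeasurableSpace.comap ν inferInstance) μ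

/-- The error `ε` and the noise `v` are independent Gaussians, so `(η, ν)` is jointly Gaussian, and
`filter_orthogonality` makes it uncorrelated, hence independent. As both are functions of `(ε, v)`,
which is independent of `G`, the filtered error is independent of `G` and `ν` together. Adding the
fresh noise `w` preserves this, and `riccati_filter` says that the new error has covariance `P`
again. -/
theorem IsSteady.step [IsProbabilityMeasure μ] {S : CPS n m p s} (hS : S.Standing) {ε : Ω → Vec n}
    {G 𝒩 𝒩' : MeasurableSpace Ω} (h : S.IsSteady μ ε G 𝒩) {w : Ω → Vec n} {v : Ω → Vec p}
    (hw : IsCentredGaussian μ S.Sw w) (hv : IsCentredGaussian μ S.Sv v) (h𝒩' : 𝒩' ≤ mΩ)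
    (h𝒩 : MeasurableSpace.comap v inferInstance ⊔
      (MeasurableSpace.comap w inferInstance ⊔ 𝒩') ≤ 𝒩)
    (hvi : Indep (MeasurableSpace.comap v inferInstance)
      (MeasurableSpace.comap w inferInstance ⊔ 𝒩') μ)
    (hwi : Indep (MeasurableSpace.comap w inferInstance) 𝒩' μ) :
    S.IsInnovation μ (fun ω => S.C *ᵥ ε ω + v ω)
        (fun ω => ε ω - S.K *ᵥ (S.C *ᵥ ε ω + v ω)) G ∧
      S.IsSteady μ (fun ω => S.A *ᵥ (ε ω - S.K *ᵥ (S.C *ᵥ ε ω + v ω)) + w ω)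
        (G ⊔ MeasurableSpace.comap (fun ω => S.C *ᵥ ε ω + v ω) inferInstance) 𝒩' := by
  set ν : Ω → Vec p := fun ω => S.C *ᵥ ε ω + v ω with hν
  set η : Ω → Vec n := fun ω => ε ω - S.K *ᵥ ν ω with hη
  set ε' : Ω → Vec n := fun ω => S.A *ᵥ η ω + w ω with hε'
  set σε : MeasurableSpace Ω := MeasurableSpace.comap ε inferInstance
  set σw : MeasurableSpace Ω := MeasurableSpace.comap w inferInstance
  set σv : MeasurableSpace Ω := MeasurableSpace.comap v inferInstance
  set σν : MeasurableSpace Ω := MeasurableSpace.comap ν inferInstance with hσν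
  set ση : MeasurableSpace Ω := MeasurableSpace.comap η inferInstance with hση
  set σε' : MeasurableSpace Ω := MeasurableSpace.comap ε' inferInstance with hσε'
  have hεm : Measurable[σε] ε := comap_measurable ε
  have hwm : Measurable[σw] w := comap_measurable w
  have hvm : Measurable[σv] v := comap_measurable v
  have cC : Measurable fun x : Vec n => S.C *ᵥ x := (by fun_prop : Continuous _).measurable
  have cK : Measurable fun x : Vec p => S.K *ᵥ x := (by fun_prop : Continuous _).measurable
  have cA : Measurable fun x : Vec n => S.A *ᵥ x := (by fun_prop : Continuous _).measurable
  have lε : σε ≤ mΩ := h.err.measurable.comap_le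
  have lw : σw ≤ mΩ := hw.measurable.comap_le
  have lv : σv ≤ mΩ := hv.measurable.comap_le
  have hεm' : Measurable[σε ⊔ σv] ε := hεm.mono le_sup_left le_rfl
  have hvm' : Measurable[σε ⊔ σv] v := hvm.mono le_sup_right le_rfl
  have hνm : Measurable[σε ⊔ σv] ν := (cC.comp hεm').add hvm'
  have hηm : Measurable[σε ⊔ σv] η := hεm'.sub (cK.comp hνm)
  have lν' : σν ≤ σε ⊔ σv := hνm.comap_le
  have lη' : ση ≤ σε ⊔ σv := hηm.comap_le
  have lν : σν ≤ mΩ := lν'.trans (sup_le lε lv)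
  have lη : ση ≤ mΩ := lη'.trans (sup_le lε lv)
  have lε' : σε' ≤ ση ⊔ σw := by
    have h1 : Measurable[ση ⊔ σw] η := (comap_measurable η).mono le_sup_left le_rfl
    have h2 : Measurable[ση ⊔ σw] w := hwm.mono le_sup_right le_rfl
    exact ((cA.comp h1).add h2).comap_le
  have hνm' : Measurable[mΩ] ν := hνm.mono (sup_le lε lv) le_rfl
  have hηm' : Measurable[mΩ] η := hηm.mono (sup_le lε lv) le_rfl
  -- independence of the past, the error and the noises
  have i1 : Indep (G ⊔ σε) (σv ⊔ (σw ⊔ 𝒩')) μ := h.indep_noise.mono le_rfl h𝒩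
  have i2 : Indep (G ⊔ σε) σv μ := i1.mono le_rfl le_sup_left
  have i3 : Indep G (σε ⊔ σv) μ := h.indep_err.symm.sup_right h.le lε lv i2
  have i4 : Indep ((G ⊔ σε) ⊔ σv) (σw ⊔ 𝒩') μ :=
    Indep.sup_left (sup_le h.le lε) lv (sup_le lw h𝒩') hvi i1
  have i5 : Indep (((G ⊔ σε) ⊔ σv) ⊔ σw) 𝒩' μ :=
    Indep.sup_left (sup_le (sup_le h.le lε) lv) lw h𝒩' hwi i4
  have iεv : IndepFun ε v μ := by
    rw [IndepFun_iff_Indep]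
    exact i2.mono le_sup_right le_rfl
  -- moments
  have mε := h.err.gaussian.memLp_two
  have mv := hv.gaussian.memLp_two
  have mw := hw.gaussian.memLp_two
  have gεv : HasGaussianLaw (fun ω => (ε ω, v ω)) μ := iεv.hasGaussianLaw h.err.gaussian hv.gaussian
  let C' := LinearMap.toContinuousLinearMap S.C.mulVecLin
  let K' := LinearMap.toContinuousLinearMap S.K.mulVecLin
  let Lν : (Vec n × Vec p) →L[ℝ] Vec p :=
    C'.comp (ContinuousLinearMap.fst ℝ _ _) + ContinuousLinearMap.snd ℝ _ _
  let Lη : (Vec n × Vec p) →L[ℝ] Vec n := ContinuousLinearMap.fst ℝ _ _ - K'.comp Lν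
  have gην : HasGaussianLaw (fun ω => (η ω, ν ω)) μ := gεv.map_fun (Lη.prod Lν)
  have mη := gην.fst.memLp_two
  have mν := gην.snd.memLp_two
  -- The filtered error in terms of the independent vectors `ε` and `v`, for computing its
  -- covariances.
  have hη_eq : η = fun ω => (1 - S.K * S.C) *ᵥ ε ω + (-S.K) *ᵥ v ω := by
    funext ω
    simp only [hη, hν, Matrix.mulVec_add, Matrix.sub_mulVec, Matrix.one_mulVec, Matrix.neg_mulVec,
      Matrix.mulVec_mulVec]
    abel
  have m1 := MemLp.mulVec mε (1 - S.K * S.C)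
  have m2 := MemLp.mulVec mv (-S.K)
  have m12 : MemLp (fun ω => (1 - S.K * S.C) *ᵥ ε ω + (-S.K) *ᵥ v ω) 2 μ := m1.add m2
  have meanν : meanVec μ ν = 0 := by
    rw [hν, meanVec_add ((MemLp.mulVec mε S.C).integrable one_le_two) (mv.integrable one_le_two), meanVec_mulVec (mε.integrable one_le_two), h.err.mean,
      hv.mean]
    simp
  have meanη : meanVec μ η = 0 := by
    rw [hη_eq, meanVec_add (m1.integrable one_le_two) (m2.integrable one_le_two), meanVec_mulVec (mε.integrable one_le_two),
      meanVec_mulVec (mv.integrable one_le_two), h.err.mean, hv.mean]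
    simp
  have cεv : covMat μ ε v = 0 := covMat_eq_zero_of_indepFun mε mv iεv
  have cvε : covMat μ v ε = 0 := covMat_eq_zero_of_indepFun mv mε iεv.symm
  have cην : covMat μ η ν = 0 := by
    rw [hν, hη_eq, covMat_add_left m1 m2 mν, covMat_mulVec_left mε mν, covMat_mulVec_left mv mν,
      covMat_add_right mε (MemLp.mulVec mε S.C) mv, covMat_add_right mv (MemLp.mulVec mε S.C) mv,
      covMat_mulVec_right mε mε, covMat_mulVec_right mv mε, cεv, cvε, h.err.cov, hv.cov, add_zero,
      Matrix.zero_mul, zero_add, ← Matrix.mul_assoc, filter_orthogonality hS, Matrix.neg_mul,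
      add_neg_cancel]
  have cηη : covMat μ η η = (1 - S.K * S.C) * S.P * (1 - S.K * S.C)ᵀ + S.K * S.Sv * S.Kᵀ := by
    rw [hη_eq, covMat_add_left m1 m2 m12, covMat_add_right m1 m1 m2,
      covMat_add_right m2 m1 m2, covMat_mulVec_left mε m1, covMat_mulVec_left mε m2,
      covMat_mulVec_left mv m1, covMat_mulVec_left mv m2, covMat_mulVec_right mε mε,
      covMat_mulVec_right mε mv, covMat_mulVec_right mv mε, covMat_mulVec_right mv mv, cεv, cvε,
      h.err.cov, hv.cov]
    simp [Matrix.mul_assoc]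
  have iην : IndepFun η ν μ := indepFun_of_covMat_eq_zero gην cην
  rw [IndepFun_iff_Indep] at iην
  have i6 : Indep ση (G ⊔ σν) μ := by
    rw [sup_comm]
    exact iην.sup_right lη lν h.le (i3.symm.mono (sup_le lη' lν') le_rfl)
  have hle1 : G ⊔ σν ⊔ ση ≤ (G ⊔ σε) ⊔ σv := by
    rw [sup_assoc, sup_assoc]
    exact sup_le_sup le_rfl (sup_le lν' lη')
  -- The new error is a function of `η` and `w`, so this gives its independence of the enlarged
  -- past.
  have i7 : Indep (G ⊔ σν) (ση ⊔ σw) μ :=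
    i6.symm.sup_right (sup_le h.le lν) lη lw (i4.mono hle1 le_sup_left)
  have iηw : IndepFun η w μ := by
    rw [IndepFun_iff_Indep]
    exact i4.mono (le_sup_right.trans hle1) le_sup_left
  have mη' := MemLp.mulVec mη S.A
  have mε' : MemLp (fun ω => S.A *ᵥ η ω + w ω) 2 μ := mη'.add mw
  have hε'm : Measurable[mΩ] ε' := (cA.comp hηm').add hw.measurable
  refine ⟨⟨hνm', hηm', mν, mη, meanν, meanη, i3.symm.mono lν' le_rfl, i6⟩, ⟨hε'm, ?_, ?_, ?_⟩,
    sup_le h.le lν, i7.symm.mono lε' le_rfl, i5.mono ?_ le_rfl⟩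
  · have iη'w : IndepFun (fun ω => S.A *ᵥ η ω) w μ := iηw.comp cA measurable_id
    exact (iη'w.hasGaussianLaw (HasGaussianLaw.mulVec gην.fst S.A) hw.gaussian).fun_add
  · rw [hε', meanVec_add (mη'.integrable one_le_two) (mw.integrable one_le_two),
      meanVec_mulVec (mη.integrable one_le_two), meanη, hw.mean]
    simp
  · have z1 : covMat μ η w = 0 := covMat_eq_zero_of_indepFun mη mw iηw
    have z2 : covMat μ w η = 0 := covMat_eq_zero_of_indepFun mw mη iηw.symm
    rw [hε', covMat_add_left mη' mw mε', covMat_add_right mη' mη' mw,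
      covMat_add_right mw mη' mw, covMat_mulVec_left mη mη', covMat_mulVec_right mη mη,
      covMat_mulVec_left mη mw, covMat_mulVec_right mw mη, z1, z2, cηη, hw.cov]
    conv_rhs => rw [riccati_filter hS]
    simp [Matrix.mul_assoc]
  · refine sup_le ((le_sup_left.trans hle1).trans le_sup_left) (lε'.trans ?_)
    exact sup_le_sup_right (le_sup_right.trans hle1) _

/-- Gaussian white noises `w`, `v`, where `𝒩 t` is the information in the noises from time `t` on. -/
structure IsNoise (S : CPS n m p s) (μ : Measure Ω) (w : ℕ → Ω → Vec n) (v : ℕ → Ω → Vec p)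
    (𝒩 : ℕ → MeasurableSpace Ω) : Prop where
  gaussian_w : ∀ t, IsCentredGaussian μ S.Sw (w t)
  gaussian_v : ∀ t, IsCentredGaussian μ S.Sv (v t)
  le : ∀ t, 𝒩 t ≤ mΩ
  sup_le : ∀ t, MeasurableSpace.comap (v t) inferInstance ⊔
      (MeasurableSpace.comap (w t) inferInstance ⊔ 𝒩 (t + 1)) ≤ 𝒩 t
  indep_v : ∀ t, Indep (MeasurableSpace.comap (v t) inferInstance)
      (MeasurableSpace.comap (w t) inferInstance ⊔ 𝒩 (t + 1)) μ
  indep_w : ∀ t, Indep (MeasurableSpace.comap (w t) inferInstance) (𝒩 (t + 1)) μ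

/-- The information generated by `G` and the innovations before time `t`. -/
@[reducible] noncomputable def innovInfo (S : CPS n m p s) (G : MeasurableSpace Ω) (ε : Ω → Vec n)
    (w : ℕ → Ω → Vec n) (v : ℕ → Ω → Vec p) : ℕ → MeasurableSpace Ω
  | 0 => G
  | t + 1 => S.innovInfo G ε w v t ⊔
      MeasurableSpace.comap (fun ω => S.innov (ε ω) (fun k => w k ω) (fun k => v k ω) t)
        inferInstance

theorem IsSteady.innovations [IsProbabilityMeasure μ] {S : CPS n m p s} (hS : S.Standing)
    {ε : Ω → Vec n} {G : MeasurableSpace Ω} {𝒩 : ℕ → MeasurableSpace Ω} {w : ℕ → Ω → Vec n}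
    {v : ℕ → Ω → Vec p} (h : S.IsSteady μ ε G (𝒩 0)) (hn : S.IsNoise μ w v 𝒩) (t : ℕ) :
    S.IsSteady μ (fun ω => S.err (ε ω) (fun k => w k ω) (fun k => v k ω) t)
        (S.innovInfo G ε w v t) (𝒩 t) ∧
      S.IsInnovation μ (fun ω => S.innov (ε ω) (fun k => w k ω) (fun k => v k ω) t)
        (fun ω => S.ferr (ε ω) (fun k => w k ω) (fun k => v k ω) t) (S.innovInfo G ε w v t) := by
  have key : ∀ t, S.IsSteady μ (fun ω => S.err (ε ω) (fun k => w k ω) (fun k => v k ω) t)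
      (S.innovInfo G ε w v t) (𝒩 t) := by
    intro t
    induction t with
    | zero => exact h
    | succ t ih =>
      exact (ih.step hS (hn.gaussian_w t) (hn.gaussian_v t) (hn.le _) (hn.sup_le t) (hn.indep_v t)
        (hn.indep_w t)).2
  exact ⟨key t, ((key t).step hS (hn.gaussian_w t) (hn.gaussian_v t) (hn.le _) (hn.sup_le t)
    (hn.indep_v t) (hn.indep_w t)).1⟩

end CPS

/-- Independence ignores null sets. It is needed because the states before time `0`, as mean square
limits, are functions of the past noises only up to null sets. -/
theorem ProbabilityTheory.Indep.comap_of_ae_eq {Ω β : Type*} [MeasurableSpace β]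
    {mΩ : MeasurableSpace Ω} {μ : Measure Ω} {a b : MeasurableSpace Ω} (h : Indep a b μ)
    {f g : Ω → β} (hg : Measurable[a] g) (hfg : f =ᵐ[μ] g) :
    Indep (MeasurableSpace.comap f inferInstance) b μ := by
  -- The σ-algebra `b` is generated by the identity into `(Ω, b)`, so that the almost everywhere
  -- invariance for pairs of functions applies.
  have h1 : @IndepFun Ω β Ω mΩ _ b g id μ := by
    rw [IndepFun_iff_Indep, MeasurableSpace.comap_id]
    exact h.mono hg.comap_le le_rfl
  have h2 : @IndepFun Ω β Ω mΩ _ b f id μ := h1.congr hfg.symm (ae_eq_refl _)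
  rwa [IndepFun_iff_Indep, MeasurableSpace.comap_id] at h2

namespace RandomCPS

variable {n m p s : ℕ} {Ω : Type*} {mΩ : MeasurableSpace Ω} {μ : Measure Ω}
  {S : CPS n m p s} {D : RandomCPS n p Ω}

/-! ### The information in the noises -/

/-- The information in the process noises at the times in `I`. -/
@[reducible] def wInfo (D : RandomCPS n p Ω) (I : Set ℤ) : MeasurableSpace Ω :=
  ⨆ t ∈ I, MeasurableSpace.comap (D.w t) inferInstance

/-- The information in the measurement noises at the times in `I`. -/
@[reducible] def vInfo (D : RandomCPS n p Ω) (I : Set ℤ) : MeasurableSpace Ω :=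
  ⨆ t ∈ I, MeasurableSpace.comap (D.v t) inferInstance

/-- The information in the noises from time `t` on. -/
@[reducible] def futureInfo (D : RandomCPS n p Ω) (t : ℤ) : MeasurableSpace Ω :=
  D.wInfo (Set.Ici t) ⊔ D.vInfo (Set.Ici t)

/-- The information in the initial state and the noises before time `t`. -/
@[reducible] def pastInfo (D : RandomCPS n p Ω) (t : ℤ) : MeasurableSpace Ω :=
  (D.wInfo (Set.Iio t) ⊔ D.vInfo (Set.Iio t)) ⊔ MeasurableSpace.comap D.x0 inferInstance

theorem comap_w_le_wInfo {I : Set ℤ} {t : ℤ} (ht : t ∈ I) :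
    MeasurableSpace.comap (D.w t) inferInstance ≤ D.wInfo I :=
  le_iSup₂_of_le t ht le_rfl

theorem comap_v_le_vInfo {I : Set ℤ} {t : ℤ} (ht : t ∈ I) :
    MeasurableSpace.comap (D.v t) inferInstance ≤ D.vInfo I :=
  le_iSup₂_of_le t ht le_rfl

theorem wInfo_mono {I J : Set ℤ} (h : I ⊆ J) : D.wInfo I ≤ D.wInfo J :=
  iSup₂_le fun _ ht => comap_w_le_wInfo (h ht)

theorem vInfo_mono {I J : Set ℤ} (h : I ⊆ J) : D.vInfo I ≤ D.vInfo J :=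
  iSup₂_le fun _ ht => comap_v_le_vInfo (h ht)

theorem wInfo_le (hD : D.IsModel S μ) (I : Set ℤ) : D.wInfo I ≤ mΩ :=
  iSup₂_le fun t _ => (hD.measurable_w t).comap_le

theorem vInfo_le (hD : D.IsModel S μ) (I : Set ℤ) : D.vInfo I ≤ mΩ :=
  iSup₂_le fun t _ => (hD.measurable_v t).comap_le

theorem futureInfo_le (hD : D.IsModel S μ) (t : ℤ) : D.futureInfo t ≤ mΩ :=
  sup_le (wInfo_le hD _) (vInfo_le hD _)

theorem pastInfo_le (hD : D.IsModel S μ) (t : ℤ) : D.pastInfo t ≤ mΩ :=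
  sup_le (sup_le (wInfo_le hD _) (vInfo_le hD _)) hD.measurable_x0.comap_le

theorem pastInfo_mono {t t' : ℤ} (h : t ≤ t') : D.pastInfo t ≤ D.pastInfo t' :=
  sup_le_sup_right (sup_le_sup (wInfo_mono (Set.Iio_subset_Iio h))
    (vInfo_mono (Set.Iio_subset_Iio h))) _

/-- Independence within each noise sequence is combined with independence between the two. The time
sets for `w` and `v` are chosen separately, so that a single `v_t` can be split off from `w_t` and
the future. -/
theorem indep_noiseInfo [IsProbabilityMeasure μ] (hD : D.IsModel S μ) {I I' J J' : Set ℤ}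
    (hI : Disjoint I I') (hJ : Disjoint J J') :
    Indep (D.wInfo I ⊔ D.vInfo J) (D.wInfo I' ⊔ D.vInfo J') μ := by
  have lw := wInfo_le hD
  have lv := vInfo_le hD
  have hw : Indep (D.wInfo I) (D.wInfo I') μ :=
    indep_iSup_of_disjoint (fun t => (hD.measurable_w t).comap_le) hD.indep_w.iIndep hI
  have hv : Indep (D.vInfo J) (D.vInfo J') μ :=
    indep_iSup_of_disjoint (fun t => (hD.measurable_v t).comap_le) hD.indep_v.iIndep hJ
  have hwv : Indep (D.wInfo Set.univ) (D.vInfo Set.univ) μ := by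
    have := hD.indep_w_v
    rw [IndepFun_iff_Indep] at this
    refine this.mono (iSup₂_le fun t _ => ?_) (iSup₂_le fun t _ => ?_)
    · exact Measurable.comap_le ((measurable_pi_apply t).comp
        (comap_measurable (fun ω t => D.w t ω)))
    · exact Measurable.comap_le ((measurable_pi_apply t).comp
        (comap_measurable (fun ω t => D.v t ω)))
  have mw : ∀ X, D.wInfo X ≤ D.wInfo Set.univ := fun X => wInfo_mono (Set.subset_univ X)
  have mv : ∀ X, D.vInfo X ≤ D.vInfo Set.univ := fun X => vInfo_mono (Set.subset_univ X)
  have h1 : Indep (D.wInfo I) (D.wInfo I' ⊔ (D.vInfo J ⊔ D.vInfo J')) μ :=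
    hw.sup_right (lw _) (lw _) (sup_le (lv _) (lv _))
      (hwv.mono (sup_le (mw _) (mw _)) (sup_le (mv _) (mv _)))
  have h2 : Indep (D.vInfo J) (D.vInfo J' ⊔ D.wInfo I') μ :=
    hv.sup_right (lv _) (lv _) (lw _) (hwv.symm.mono (sup_le (mv _) (mv _)) (mw _))
  refine Indep.sup_left (lw _) (lv _) (sup_le (lw _) (lv _)) (by rwa [sup_comm]) (h1.mono le_rfl ?_)
  exact sup_le (le_sup_left.trans le_sup_right)
    (sup_le le_sup_left (le_sup_right.trans le_sup_right))

theorem indep_pastInfo_futureInfo [IsProbabilityMeasure μ] (hD : D.IsModel S μ) (t : ℤ) :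
    Indep (D.pastInfo t) (D.futureInfo t) μ := by
  have hdis : Disjoint (Set.Iio t) (Set.Ici t) := Set.Iio_disjoint_Ici le_rfl
  have h1 := indep_noiseInfo hD hdis hdis
  have h2 : Indep (D.wInfo Set.univ ⊔ D.vInfo Set.univ)
      (MeasurableSpace.comap D.x0 inferInstance) μ := by
    have h := hD.indep_x0
    rw [IndepFun_iff_Indep] at h
    refine h.symm.mono (sup_le (iSup₂_le fun t _ => ?_) (iSup₂_le fun t _ => ?_)) le_rfl
    · exact Measurable.comap_le ((measurable_pi_apply t).comp (measurable_fst.comp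
        (comap_measurable (fun ω => ((fun t => D.w t ω, fun t => D.v t ω) :
          (ℤ → Vec n) × (ℤ → Vec p))))))
    · exact Measurable.comap_le ((measurable_pi_apply t).comp (measurable_snd.comp
        (comap_measurable (fun ω => ((fun t => D.w t ω, fun t => D.v t ω) :
          (ℤ → Vec n) × (ℤ → Vec p))))))
  refine (h1.symm.sup_right (futureInfo_le hD t) (sup_le (wInfo_le hD _) (vInfo_le hD _))
    hD.measurable_x0.comap_le (h2.mono ?_ le_rfl)).symm
  exact sup_le (sup_le_sup (wInfo_mono (Set.subset_univ _)) (vInfo_mono (Set.subset_univ _)))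
    (sup_le_sup (wInfo_mono (Set.subset_univ _)) (vInfo_mono (Set.subset_univ _)))

theorem isNoise [IsProbabilityMeasure μ] (hS : S.Standing) (hD : D.IsModel S μ) (τ : ℤ) :
    S.IsNoise μ (fun k => D.w (τ + k)) (fun k => D.v (τ + k)) (fun k => D.futureInfo (τ + k)) where
  gaussian_w k := ⟨hD.measurable_w _, hasGaussianLaw_of_multivariateGaussian (hD.law_w _),
    meanVec_of_multivariateGaussian (hD.law_w _),
    covMat_of_multivariateGaussian hS.Sw_posDef.posSemidef (hD.law_w _)⟩
  gaussian_v k := ⟨hD.measurable_v _, hasGaussianLaw_of_multivariateGaussian (hD.law_v _),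
    meanVec_of_multivariateGaussian (hD.law_v _),
    covMat_of_multivariateGaussian hS.Sv_posDef.posSemidef (hD.law_v _)⟩
  le k := futureInfo_le hD _
  sup_le k := by
    have hsub : Set.Ici (τ + ((k + 1 : ℕ) : ℤ)) ⊆ Set.Ici (τ + k) :=
      Set.Ici_subset_Ici.2 (by push_cast; omega)
    refine sup_le ((comap_v_le_vInfo Set.self_mem_Ici).trans le_sup_right)
      (sup_le ((comap_w_le_wInfo Set.self_mem_Ici).trans le_sup_left) ?_)
    exact sup_le_sup (wInfo_mono hsub) (vInfo_mono hsub)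
  indep_v k := by
    have hsub : Set.Ici (τ + ((k + 1 : ℕ) : ℤ)) ⊆ Set.Ici (τ + k) :=
      Set.Ici_subset_Ici.2 (by push_cast; omega)
    have hdis : Disjoint {τ + (k : ℤ)} (Set.Ici (τ + ((k + 1 : ℕ) : ℤ))) := by
      rw [Set.disjoint_singleton_left, Set.mem_Ici]
      push_cast
      omega
    -- No process noise on the left, which leaves room for the process noise of the same time on the
    -- right.
    refine (indep_noiseInfo hD (Set.empty_disjoint (Set.Ici (τ + (k : ℤ)))) hdis).mono
      ((comap_v_le_vInfo (Set.mem_singleton _)).trans le_sup_right) ?_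
    exact sup_le ((comap_w_le_wInfo Set.self_mem_Ici).trans le_sup_left)
      (sup_le_sup_right (wInfo_mono hsub) _)
  indep_w k := by
    have hdis : Disjoint {τ + (k : ℤ)} (Set.Ici (τ + ((k + 1 : ℕ) : ℤ))) := by
      rw [Set.disjoint_singleton_left, Set.mem_Ici]
      push_cast
      omega
    exact (indep_noiseInfo hD hdis (Set.empty_disjoint _)).mono
      ((comap_w_le_wInfo (Set.mem_singleton _)).trans le_sup_left) le_rfl

end RandomCPS

/-! ### The unattacked system before time `0` -/

theorem measurable_mulVec {κ ι : Type*} [Fintype κ] [Fintype ι] (M : Matrix ι κ ℝ) :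
    Measurable fun x : κ → ℝ => M *ᵥ x :=
  (by fun_prop : Continuous _).measurable

namespace CPS

variable {n m p s : ℕ}

theorem step_zero_snd (S : CPS n m p s) (w : Vec n) (v : Vec p) (q : Vec n × Vec n) :
    (S.step 0 w v q).2 =
      (S.A + S.B * S.L) *ᵥ (q.2 + S.K *ᵥ (S.C *ᵥ (q.1 - q.2) + v)) := by
  have h : S.C *ᵥ q.1 + S.Ψ *ᵥ (0 : Vec s) + v - S.C *ᵥ q.2 = S.C *ᵥ (q.1 - q.2) + v := by
    rw [Matrix.mulVec_zero, Matrix.mulVec_sub]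
    abel
  simp only [step, h, Matrix.add_mulVec, Matrix.mulVec_mulVec]

/-- The control enters state and prediction alike and cancels, so the error evolves on its own. -/
theorem step_zero_sub (S : CPS n m p s) (w : Vec n) (v : Vec p) (q : Vec n × Vec n) :
    (S.step 0 w v q).1 - (S.step 0 w v q).2 =
      S.A *ᵥ ((q.1 - q.2) - S.K *ᵥ (S.C *ᵥ (q.1 - q.2) + v)) + w := by
  simp only [step, Matrix.mulVec_zero, Matrix.mulVec_add, Matrix.mulVec_sub]
  abel

theorem continuous_step_zero (S : CPS n m p s) (w : Vec n) (v : Vec p) :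
    Continuous (S.step 0 w v) := by
  unfold step
  fun_prop

theorem measurable_step_zero {Ω : Type*} {_ : MeasurableSpace Ω} (S : CPS n m p s)
    {w : Ω → Vec n} {v : Ω → Vec p} {q : Ω → Vec n × Vec n} (hw : Measurable w)
    (hv : Measurable v) (hq : Measurable q) :
    Measurable fun ω => S.step 0 (w ω) (v ω) (q ω) := by
  have hx : Measurable fun ω => S.C *ᵥ (q ω).1 + S.Ψ *ᵥ (0 : Vec s) + v ω - S.C *ᵥ (q ω).2 :=
    ((((measurable_mulVec S.C).comp hq.fst).add_const _).add hv).sub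
      ((measurable_mulVec S.C).comp hq.snd)
  have hxh := hq.snd.add ((measurable_mulVec S.K).comp hx)
  have hu := (measurable_mulVec S.B).comp ((measurable_mulVec S.L).comp hxh)
  exact (((((measurable_mulVec S.A).comp hq.fst).add hu).add_const _).add hw).prodMk
    (((measurable_mulVec S.A).comp hxh).add hu)

/-- The covariances of the prediction error with itself and with the prediction, for the unattacked
system `t` steps after its start. -/
noncomputable def covSeq (S : CPS n m p s) :
    ℕ → Matrix (Fin n) (Fin n) ℝ × Matrix (Fin n) (Fin n) ℝ
  | 0 => (S.Sx, 0)
  | t + 1 => (S.F * (S.covSeq t).1 * S.Fᵀ + (S.A * S.K * S.Sv * S.Kᵀ * S.Aᵀ + S.Sw),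
      (S.F * (S.covSeq t).2 + (S.F * (S.covSeq t).1 * S.Cᵀ - S.A * S.K * S.Sv) * S.Kᵀ)
        * (S.A + S.B * S.L)ᵀ)

/-- Limits are fixed points of the two recursions. `X - P` solves the homogeneous Lyapunov equation
of the stable `F`, so it vanishes; at `X = P` the forcing of the second recursion is zero by
`prediction_orthogonality`, leaving `Y = F Y (A + BL)ᵀ`, which forces `Y = 0`. Convergence is
assumed here, since the mean square limits of the model supply it. -/
theorem eq_of_tendsto_covSeq {S : CPS n m p s} (hS : S.Standing)
    {X Y : Matrix (Fin n) (Fin n) ℝ}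
    (hX : Tendsto (fun t => (S.covSeq t).1) atTop (𝓝 X))
    (hY : Tendsto (fun t => (S.covSeq t).2) atTop (𝓝 Y)) : X = S.P ∧ Y = 0 := by
  have hF := tendsto_F_pow hS
  have hX' := hX.comp (tendsto_add_atTop_nat 1)
  have hY' := hY.comp (tendsto_add_atTop_nat 1)
  have hXP : X = S.P := by
    have h1 : X = S.F * X * S.Fᵀ + (S.A * S.K * S.Sv * S.Kᵀ * S.Aᵀ + S.Sw) :=
      tendsto_nhds_unique hX' (((hX.const_mul S.F).mul_const S.Fᵀ).add_const _)
    have h2 := riccati_prediction hS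
    have h3 : X - S.P = S.F * (X - S.P) * S.Fᵀ := by
      conv_lhs => rw [h1, h2]
      rw [Matrix.mul_sub, Matrix.sub_mul]
      abel
    exact sub_eq_zero.1 (eq_zero_of_eq_mul_mul hF hF h3)
  refine ⟨hXP, ?_⟩
  have hlim : Tendsto (fun t => (S.F * (S.covSeq t).1 * S.Cᵀ - S.A * S.K * S.Sv) * S.Kᵀ) atTop
      (𝓝 ((S.F * X * S.Cᵀ - S.A * S.K * S.Sv) * S.Kᵀ)) := by
    have hc : Continuous fun M : Matrix (Fin n) (Fin n) ℝ =>
        (S.F * M * S.Cᵀ - S.A * S.K * S.Sv) * S.Kᵀ := by fun_prop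
    exact (hc.tendsto X).comp hX
  have h1 : Y = (S.F * Y + (S.F * X * S.Cᵀ - S.A * S.K * S.Sv) * S.Kᵀ) * (S.A + S.B * S.L)ᵀ :=
    tendsto_nhds_unique hY' (((hY.const_mul S.F).add hlim).mul_const _)
  rw [hXP, prediction_orthogonality hS, sub_self, Matrix.zero_mul, add_zero] at h1
  exact eq_zero_of_eq_mul_mul hF hS.stable h1

end CPS

/-! ### Gaussianity and moments of the unattacked system after a finite start -/

namespace RandomCPS

variable {n m p s : ℕ} {Ω : Type*} {mΩ : MeasurableSpace Ω} {μ : Measure Ω}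
  {S : CPS n m p s} {D : RandomCPS n p Ω}

/-- State and prediction after `k` steps of the unattacked system that is started at time `a`. -/
noncomputable def warm (D : RandomCPS n p Ω) (S : CPS n m p s) (a : ℤ) (k : ℕ) (ω : Ω) :
    Vec n × Vec n :=
  S.run (D.x0 ω, S.xbar) 0 (fun k => D.w (k + a) ω) (fun k => D.v (k + a) ω) k

theorem warm_succ (a : ℤ) (k : ℕ) (ω : Ω) :
    D.warm S a (k + 1) ω = S.step 0 (D.w (k + a) ω) (D.v (k + a) ω) (D.warm S a k ω) := rfl

theorem measurable_warm (a : ℤ) (k : ℕ) :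
    Measurable[D.pastInfo (k + a)] (D.warm S a k) := by
  induction k with
  | zero =>
    have h : Measurable[D.pastInfo ((0 : ℕ) + a)] D.x0 :=
      (comap_measurable D.x0).mono le_sup_right le_rfl
    exact h.prodMk measurable_const
  | succ k ih =>
    have hlt : (k : ℤ) + a ∈ Set.Iio (((k + 1 : ℕ) : ℤ) + a) := by
      rw [Set.mem_Iio]
      push_cast
      omega
    have hw : Measurable[D.pastInfo ((k + 1 : ℕ) + a)] (D.w (k + a)) :=
      (comap_measurable (D.w (k + a))).mono
        (((comap_w_le_wInfo hlt).trans le_sup_left).trans le_sup_left) le_rfl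
    have hv : Measurable[D.pastInfo ((k + 1 : ℕ) + a)] (D.v (k + a)) :=
      (comap_measurable (D.v (k + a))).mono
        (((comap_v_le_vInfo hlt).trans le_sup_right).trans le_sup_left) le_rfl
    exact S.measurable_step_zero hw hv (ih.mono (pastInfo_mono (le_of_lt hlt)) le_rfl)

/-- The prediction starts at the constant `xbar`, the mean of the initial state: the error is then
centred with covariance `Sx` and uncorrelated with the prediction. One step is linear in error,
prediction and the two fresh noises, and these noises are independent of the former and of each
other, so only the terms of `covSeq` survive. -/
theorem warm_moments [IsProbabilityMeasure μ] (hS : S.Standing) (hD : D.IsModel S μ) (a : ℤ)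
    (k : ℕ) :
    HasGaussianLaw (fun ω => ((D.warm S a k ω).1 - (D.warm S a k ω).2, (D.warm S a k ω).2)) μ ∧
      meanVec μ (fun ω => (D.warm S a k ω).1 - (D.warm S a k ω).2) = 0 ∧
      covMat μ (fun ω => (D.warm S a k ω).1 - (D.warm S a k ω).2)
        (fun ω => (D.warm S a k ω).1 - (D.warm S a k ω).2) = (S.covSeq k).1 ∧
      covMat μ (fun ω => (D.warm S a k ω).1 - (D.warm S a k ω).2)
        (fun ω => (D.warm S a k ω).2) = (S.covSeq k).2 := by
  induction k with
  | zero =>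
    have g0 : HasGaussianLaw D.x0 μ := hasGaussianLaw_of_multivariateGaussian hD.law_x0
    have hm := meanVec_of_multivariateGaussian hD.law_x0
    have hc := covMat_of_multivariateGaussian hS.Sx_posDef.posSemidef hD.law_x0
    have gz : HasGaussianLaw (fun _ : Ω => S.xbar) μ :=
      ⟨by rw [Measure.map_const, measure_univ, one_smul]; infer_instance⟩
    have gxz : HasGaussianLaw (fun ω => (D.x0 ω, S.xbar)) μ :=
      (indepFun_const_right D.x0 S.xbar).hasGaussianLaw g0 gz
    have cz : ∀ X : Ω → Vec n, covMat μ X (fun _ => S.xbar) = 0 := by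
      intro X
      ext i j
      exact covariance_const_right _
    refine ⟨?_, ?_, ?_, cz _⟩
    · exact gxz.map_fun ((ContinuousLinearMap.fst ℝ (Vec n) (Vec n)
        - ContinuousLinearMap.snd ℝ (Vec n) (Vec n)).prod (ContinuousLinearMap.snd ℝ _ _))
    · ext i
      have h1 : ∫ ω, D.x0 ω i ∂μ = S.xbar i := congrFun hm i
      change ∫ ω, D.x0 ω i - S.xbar i ∂μ = 0
      rw [integral_sub (g0.integrable.eval i) (integrable_const _), h1]
      simp
    · rw [CPS.covSeq, ← hc]
      ext i j
      change cov[fun ω => D.x0 ω i - S.xbar i, fun ω => D.x0 ω j - S.xbar j; μ] = _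
      rw [covariance_sub_const_left (g0.integrable.eval i),
        covariance_sub_const_right (g0.integrable.eval j)]
      rfl
  | succ k ih =>
    obtain ⟨ig, im, ic, icz⟩ := ih
    have hn := isNoise hS hD ((k : ℤ) + a)
    have hw := hn.gaussian_w 0
    have hv := hn.gaussian_v 0
    have hvi := hn.indep_v 0
    simp only [Nat.cast_zero, add_zero] at hw hv hvi
    set ε : Ω → Vec n := fun ω => (D.warm S a k ω).1 - (D.warm S a k ω).2 with hε
    set z : Ω → Vec n := fun ω => (D.warm S a k ω).2 with hz
    set w := D.w (k + a)
    set v := D.v (k + a)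
    have hpast : Indep (D.pastInfo (k + a)) (D.futureInfo (k + a)) μ :=
      indep_pastInfo_futureInfo hD _
    have hq := measurable_warm (S := S) (D := D) a k
    have hεm : Measurable[D.pastInfo (k + a)] ε := hq.fst.sub hq.snd
    have hzm : Measurable[D.pastInfo (k + a)] z := hq.snd
    have hwm : Measurable[D.futureInfo (k + a)] w := (comap_measurable w).mono
      ((comap_w_le_wInfo Set.self_mem_Ici).trans le_sup_left) le_rfl
    have hvm : Measurable[D.futureInfo (k + a)] v := (comap_measurable v).mono
      ((comap_v_le_vInfo Set.self_mem_Ici).trans le_sup_right) le_rfl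
    have ivw : IndepFun v w μ := by
      rw [IndepFun_iff_Indep]
      exact hvi.mono le_rfl le_sup_left
    have iεz : IndepFun (fun ω => (ε ω, z ω)) (fun ω => (v ω, w ω)) μ :=
      IndepFun.of_indep hpast (hεm.prodMk hzm) (hvm.prodMk hwm)
    have gvw := ivw.hasGaussianLaw hv.gaussian hw.gaussian
    have gall := iεz.hasGaussianLaw ig gvw
    have mε := ig.fst.memLp_two
    have mz := ig.snd.memLp_two
    have mv := hv.gaussian.memLp_two
    have mw := hw.gaussian.memLp_two
    have hε' : (fun ω => (D.warm S a (k + 1) ω).1 - (D.warm S a (k + 1) ω).2) =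
        fun ω => (S.F *ᵥ ε ω + (-(S.A * S.K)) *ᵥ v ω) + w ω := by
      funext ω
      rw [warm_succ, CPS.step_zero_sub]
      simp only [CPS.F, Matrix.mulVec_add, Matrix.mulVec_sub, Matrix.mul_sub, Matrix.mul_one,
        Matrix.sub_mulVec, Matrix.neg_mulVec, Matrix.mulVec_mulVec, hε, v, w]
      abel
    have hz' : (fun ω => (D.warm S a (k + 1) ω).2) =
        fun ω => (S.A + S.B * S.L) *ᵥ ((z ω + (S.K * S.C) *ᵥ ε ω) + S.K *ᵥ v ω) := by
      funext ω
      rw [warm_succ, CPS.step_zero_snd]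
      simp only [Matrix.mulVec_add, Matrix.mulVec_mulVec, hε, hz, v, add_assoc]
    have hpair : (fun ω => ((D.warm S a (k + 1) ω).1 - (D.warm S a (k + 1) ω).2,
        (D.warm S a (k + 1) ω).2)) = fun ω => ((S.F *ᵥ ε ω + (-(S.A * S.K)) *ᵥ v ω) + w ω,
          (S.A + S.B * S.L) *ᵥ ((z ω + (S.K * S.C) *ᵥ ε ω) + S.K *ᵥ v ω)) :=
      funext fun ω => Prod.ext (congrFun hε' ω) (congrFun hz' ω)
    rw [hpair, hε', hz']
    have zεv : covMat μ ε v = 0 := covMat_eq_zero_of_indepFun mε mv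
      (IndepFun.of_indep hpast hεm hvm)
    have zεw : covMat μ ε w = 0 := covMat_eq_zero_of_indepFun mε mw
      (IndepFun.of_indep hpast hεm hwm)
    have zvw : covMat μ v w = 0 := covMat_eq_zero_of_indepFun mv mw ivw
    have zzv : covMat μ z v = 0 := covMat_eq_zero_of_indepFun mz mv
      (IndepFun.of_indep hpast hzm hvm)
    have zzw : covMat μ z w = 0 := covMat_eq_zero_of_indepFun mz mw
      (IndepFun.of_indep hpast hzm hwm)
    have zvε : covMat μ v ε = 0 := by rw [← covMat_transpose, zεv, Matrix.transpose_zero]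
    have zwε : covMat μ w ε = 0 := by rw [← covMat_transpose, zεw, Matrix.transpose_zero]
    have zwv : covMat μ w v = 0 := by rw [← covMat_transpose, zvw, Matrix.transpose_zero]
    have zvz : covMat μ v z = 0 := by rw [← covMat_transpose, zzv, Matrix.transpose_zero]
    have zwz : covMat μ w z = 0 := by rw [← covMat_transpose, zzw, Matrix.transpose_zero]
    have m1 := MemLp.mulVec mε S.F
    have m2 := MemLp.mulVec mv (-(S.A * S.K))
    have m12 : MemLp (fun ω => S.F *ᵥ ε ω + (-(S.A * S.K)) *ᵥ v ω) 2 μ := m1.add m2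
    have m3 : MemLp (fun ω => (S.F *ᵥ ε ω + (-(S.A * S.K)) *ᵥ v ω) + w ω) 2 μ := m12.add mw
    have n1 := MemLp.mulVec mε (S.K * S.C)
    have n2 : MemLp (fun ω => z ω + (S.K * S.C) *ᵥ ε ω) 2 μ := mz.add n1
    have n3 := MemLp.mulVec mv S.K
    have n4 : MemLp (fun ω => (z ω + (S.K * S.C) *ᵥ ε ω) + S.K *ᵥ v ω) 2 μ := n2.add n3
    refine ⟨?_, ?_, ?_, ?_⟩
    · let T := fun {a b : ℕ} (M : Matrix (Fin a) (Fin b) ℝ) =>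
        LinearMap.toContinuousLinearMap M.mulVecLin
      let pε : ((Vec n × Vec n) × (Vec p × Vec n)) →L[ℝ] Vec n :=
        (ContinuousLinearMap.fst ℝ _ _).comp (ContinuousLinearMap.fst ℝ _ _)
      let pz : ((Vec n × Vec n) × (Vec p × Vec n)) →L[ℝ] Vec n :=
        (ContinuousLinearMap.snd ℝ _ _).comp (ContinuousLinearMap.fst ℝ _ _)
      let pv : ((Vec n × Vec n) × (Vec p × Vec n)) →L[ℝ] Vec p :=
        (ContinuousLinearMap.fst ℝ _ _).comp (ContinuousLinearMap.snd ℝ _ _)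
      let pw : ((Vec n × Vec n) × (Vec p × Vec n)) →L[ℝ] Vec n :=
        (ContinuousLinearMap.snd ℝ _ _).comp (ContinuousLinearMap.snd ℝ _ _)
      exact gall.map_fun ((((T S.F).comp pε + (T (-(S.A * S.K))).comp pv) + pw).prod
        ((T (S.A + S.B * S.L)).comp ((pz + (T (S.K * S.C)).comp pε) + (T S.K).comp pv)))
    · rw [meanVec_add (m12.integrable one_le_two) (mw.integrable one_le_two),
        meanVec_add (m1.integrable one_le_two) (m2.integrable one_le_two),
        meanVec_mulVec (mε.integrable one_le_two), meanVec_mulVec (mv.integrable one_le_two), im,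
        hv.mean, hw.mean]
      simp
    · rw [covMat_add_left m12 mw m3, covMat_add_left m1 m2 m3, covMat_mulVec_left mε m3,
        covMat_mulVec_left mv m3, covMat_add_right mε m12 mw, covMat_add_right mv m12 mw,
        covMat_add_right mw m12 mw, covMat_add_right mε m1 m2, covMat_add_right mv m1 m2,
        covMat_add_right mw m1 m2, covMat_mulVec_right mε mε, covMat_mulVec_right mε mv,
        covMat_mulVec_right mv mε, covMat_mulVec_right mv mv, covMat_mulVec_right mw mε,
        covMat_mulVec_right mw mv, zεv, zεw, zvw, zvε, zwε, zwv, ic, hv.cov, hw.cov, CPS.covSeq]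
      simp [Matrix.mul_assoc, add_assoc]
    · rw [covMat_mulVec_right m3 n4, covMat_add_left m12 mw n4, covMat_add_left m1 m2 n4,
        covMat_mulVec_left mε n4, covMat_mulVec_left mv n4, covMat_add_right mε n2 n3,
        covMat_add_right mv n2 n3, covMat_add_right mw n2 n3, covMat_add_right mε mz n1,
        covMat_add_right mv mz n1, covMat_add_right mw mz n1, covMat_mulVec_right mε mε,
        covMat_mulVec_right mε mv, covMat_mulVec_right mv mε, covMat_mulVec_right mv mv,
        covMat_mulVec_right mw mε, covMat_mulVec_right mw mv, zεv, zvε, zwε, zwv, zvz, zwz, ic,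
        icz, hv.cov, CPS.covSeq]
      congr 1
      simp [Matrix.mul_assoc, Matrix.mul_add, Matrix.add_mul, sub_eq_add_neg, add_assoc]

end RandomCPS

/-! ### The states before time `0` as mean square limits -/

theorem tendsto_covMat_of_tendsto_eLpNorm {Ω κ ι : Type*} {mΩ : MeasurableSpace Ω} [Fintype κ]
    [Fintype ι] {μ : Measure Ω} [IsProbabilityMeasure μ] {X : ℕ → Ω → κ → ℝ} {Y : ℕ → Ω → ι → ℝ}
    {X' : Ω → κ → ℝ} {Y' : Ω → ι → ℝ} (hX : ∀ k, MemLp (X k) 2 μ) (hY : ∀ k, MemLp (Y k) 2 μ)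
    (hX' : MemLp X' 2 μ) (hY' : MemLp Y' 2 μ)
    (hlX : Tendsto (fun k => eLpNorm (X k - X') 2 μ) atTop (𝓝 0))
    (hlY : Tendsto (fun k => eLpNorm (Y k - Y') 2 μ) atTop (𝓝 0)) :
    Tendsto (fun k => covMat μ (X k) (Y k)) atTop (𝓝 (covMat μ X' Y')) :=
  tendsto_pi_nhds.2 fun i => tendsto_pi_nhds.2 fun j =>
    tendsto_covariance_of_tendsto_eLpNorm (fun k => MemLp.coord (hX k) i)
      (fun k => MemLp.coord (hY k) j) (MemLp.coord hX' i) (MemLp.coord hY' j)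
      (tendsto_eLpNorm_comp_clm (ContinuousLinearMap.proj (R := ℝ) (φ := fun _ : κ => ℝ) i) hlX)
      (tendsto_eLpNorm_comp_clm (ContinuousLinearMap.proj (R := ℝ) (φ := fun _ : ι => ℝ) j) hlY)

theorem tendsto_meanVec_of_tendsto_eLpNorm {Ω κ : Type*} {mΩ : MeasurableSpace Ω} [Fintype κ]
    {μ : Measure Ω} [IsProbabilityMeasure μ] {X : ℕ → Ω → κ → ℝ} {X' : Ω → κ → ℝ}
    (hX : ∀ k, MemLp (X k) 2 μ) (hX' : MemLp X' 2 μ)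
    (hlX : Tendsto (fun k => eLpNorm (X k - X') 2 μ) atTop (𝓝 0)) :
    Tendsto (fun k => meanVec μ (X k)) atTop (𝓝 (meanVec μ X')) :=
  tendsto_pi_nhds.2 fun i =>
    tendsto_integral_of_tendsto_eLpNorm (fun k => MemLp.coord (hX k) i) (MemLp.coord hX' i)
      (tendsto_eLpNorm_comp_clm (ContinuousLinearMap.proj (R := ℝ) (φ := fun _ : κ => ℝ) i) hlX)

namespace RandomCPS

variable {n m p s : ℕ} {Ω : Type*} {mΩ : MeasurableSpace Ω} {μ : Measure Ω}
  {S : CPS n m p s} {D : RandomCPS n p Ω}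

/-- State and prediction at time `-τ`. -/
def pastState (D : RandomCPS n p Ω) (τ : ℕ) (ω : Ω) : Vec n × Vec n := (D.x (-τ) ω, D.z (-τ) ω)

theorem measurable_pastState (hD : D.IsModel S μ) (τ : ℕ) : Measurable (D.pastState τ) :=
  (hD.measurable_x _ (by omega)).prodMk (hD.measurable_z _ (by omega))

theorem tendsto_warm (hD : D.IsModel S μ) (τ : ℕ) :
    Tendsto (fun k : ℕ => eLpNorm (D.warm S (-τ - k) k - D.pastState τ) 2 μ) atTop (𝓝 0) := by
  -- A system started at time `-(k + τ)` reaches time `-τ` after `k` steps.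
  have h := (hD.limit (-τ) (by omega)).comp (tendsto_add_atTop_nat τ)
  refine h.congr fun k => ?_
  simp only [Function.comp_apply]
  congr 1
  funext ω
  have h1 : (-(τ : ℤ) + ((k + τ : ℕ) : ℤ)).toNat = k := by omega
  have h2 : ∀ j : ℕ, (j : ℤ) - ((k + τ : ℕ) : ℤ) = j + (-τ - k) := by intro j; push_cast; ring
  simp only [Pi.sub_apply, started, warm, pastState, h1, h2]

/-- The recursion of the unattacked system before time `0`. -/
theorem pastState_step [IsProbabilityMeasure μ] (hD : D.IsModel S μ) (τ : ℕ) :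
    D.pastState τ =ᵐ[μ] fun ω => S.step 0 (D.w (-(τ + 1 : ℕ)) ω) (D.v (-(τ + 1 : ℕ)) ω)
      (D.pastState (τ + 1) ω) := by
  have hmeas : ∀ a k, AEStronglyMeasurable (D.warm S a k) μ := fun a k =>
    ((measurable_warm a k).mono (pastInfo_le hD _) le_rfl).aestronglyMeasurable
  -- Shifted by one, this sequence has the same starting times as the one for `τ + 1`, so its
  -- members are one step of the plant apart.
  have h0 := (tendsto_warm hD τ).comp (tendsto_add_atTop_nat 1)
  have h1 := tendsto_warm hD (τ + 1)
  obtain ⟨ns, hns, hae⟩ := (tendstoInMeasure_of_tendsto_eLpNorm two_ne_zero (fun k => hmeas _ _)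
    (measurable_pastState hD _).aestronglyMeasurable h1).exists_seq_tendsto_ae
  -- The second subsequence is taken inside the first, so both limits exist pointwise along it; for
  -- fixed noises the step is continuous and passes to the limit.
  obtain ⟨ns', hns', hae'⟩ := (tendstoInMeasure_of_tendsto_eLpNorm two_ne_zero
    (fun k => hmeas _ _) (measurable_pastState hD _).aestronglyMeasurable
    (h0.comp hns.tendsto_atTop)).exists_seq_tendsto_ae
  filter_upwards [hae, hae'] with ω ha hb
  refine tendsto_nhds_unique hb ?_
  have hc := ((S.continuous_step_zero (D.w (-(τ + 1 : ℕ)) ω) (D.v (-(τ + 1 : ℕ)) ω)).tendsto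
    _).comp (ha.comp hns'.tendsto_atTop)
  refine hc.congr fun k => ?_
  simp only [Function.comp_apply]
  have e1 : (-(τ : ℤ) - ((ns (ns' k) + 1 : ℕ) : ℤ)) = -((τ + 1 : ℕ) : ℤ) - (ns (ns' k) : ℤ) := by
    push_cast; ring
  have e2 : ((ns (ns' k) : ℤ) + (-((τ + 1 : ℕ) : ℤ) - (ns (ns' k) : ℤ))) = -((τ + 1 : ℕ) : ℤ) := by
    ring
  rw [e1, warm_succ, e2]

/-- Gaussianity, means and covariances pass to the mean square limit. `eq_of_tendsto_covSeq`
identifies the covariances, and the vanishing one gives independence. -/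
theorem pastState_moments [IsProbabilityMeasure μ] (hS : S.Standing) (hD : D.IsModel S μ) (τ : ℕ) :
    IsCentredGaussian μ S.P (fun ω => (D.pastState τ ω).1 - (D.pastState τ ω).2) ∧
      IndepFun (fun ω => (D.pastState τ ω).1 - (D.pastState τ ω).2)
        (fun ω => (D.pastState τ ω).2) μ ∧
      MemLp (fun ω => (D.pastState τ ω).2) 2 μ := by
  have mom := fun k : ℕ => warm_moments hS hD (-(τ : ℤ) - (k : ℤ)) k
  have hmeas := measurable_pastState (S := S) hD τ
  have hlim : Tendsto (fun k : ℕ => eLpNorm ((fun ω => ((D.warm S (-τ - k) k ω).1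
      - (D.warm S (-τ - k) k ω).2, (D.warm S (-τ - k) k ω).2))
      - fun ω => ((D.pastState τ ω).1 - (D.pastState τ ω).2, (D.pastState τ ω).2)) 2 μ)
      atTop (𝓝 0) := by
    have h := tendsto_eLpNorm_comp_clm ((ContinuousLinearMap.fst ℝ (Vec n) (Vec n)
      - ContinuousLinearMap.snd ℝ (Vec n) (Vec n)).prod (ContinuousLinearMap.snd ℝ (Vec n) (Vec n)))
      (tendsto_warm hD τ)
    exact h
  have hg : HasGaussianLaw
      (fun ω => ((D.pastState τ ω).1 - (D.pastState τ ω).2, (D.pastState τ ω).2)) μ :=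
    hasGaussianLaw_of_tendsto_eLpNorm (fun k => (mom k).1)
      ((hmeas.fst.sub hmeas.snd).prodMk hmeas.snd).aestronglyMeasurable hlim
  have hE : Tendsto (fun k : ℕ => eLpNorm ((fun ω => (D.warm S (-τ - k) k ω).1
      - (D.warm S (-τ - k) k ω).2) - fun ω => (D.pastState τ ω).1 - (D.pastState τ ω).2) 2 μ)
      atTop (𝓝 0) := by
    have h := tendsto_eLpNorm_comp_clm (ContinuousLinearMap.fst ℝ (Vec n) (Vec n)) hlim
    exact h
  have hZ : Tendsto (fun k : ℕ => eLpNorm ((fun ω => (D.warm S (-τ - k) k ω).2)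
      - fun ω => (D.pastState τ ω).2) 2 μ) atTop (𝓝 0) := by
    have h := tendsto_eLpNorm_comp_clm (ContinuousLinearMap.snd ℝ (Vec n) (Vec n)) hlim
    exact h
  have mE := hg.fst.memLp_two
  have mZ := hg.snd.memLp_two
  have kE := fun k => (mom k).1.fst.memLp_two
  have kZ := fun k => (mom k).1.snd.memLp_two
  have hcov1 := tendsto_covMat_of_tendsto_eLpNorm kE kE mE mE hE hE
  have hcov2 := tendsto_covMat_of_tendsto_eLpNorm kE kZ mE mZ hE hZ
  have hmean := tendsto_meanVec_of_tendsto_eLpNorm kE mE hE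
  obtain ⟨hP, h0⟩ := CPS.eq_of_tendsto_covSeq hS (hcov1.congr fun k => (mom k).2.2.1)
    (hcov2.congr fun k => (mom k).2.2.2)
  refine ⟨⟨hmeas.fst.sub hmeas.snd, hg.fst, ?_, hP⟩, indepFun_of_covMat_eq_zero hg h0, mZ⟩
  exact tendsto_nhds_unique hmean (tendsto_const_nhds.congr fun k => (mom k).2.1.symm)

theorem exists_pastState_version [IsProbabilityMeasure μ] (hD : D.IsModel S μ) (τ : ℕ) :
    ∃ g : Ω → Vec n × Vec n, Measurable[D.pastInfo (-τ)] g ∧ D.pastState τ =ᵐ[μ] g := by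
  refine exists_measurable_version_of_tendsto_eLpNorm
    (measurable_pastState hD τ).aestronglyMeasurable (pastInfo_le hD _) (fun k => ?_)
    (tendsto_warm hD τ)
  have h := measurable_warm (S := S) (D := D) (-τ - k) k
  have e : (k : ℤ) + (-τ - k) = -τ := by ring
  rwa [e] at h

/-- The past contains only the prediction at time `-τ` here. The measurements follow by running the
filter up to time `0` from ever earlier starts. -/
theorem isSteady_past [IsProbabilityMeasure μ] (hS : S.Standing) (hD : D.IsModel S μ) (τ : ℕ) :
    S.IsSteady μ (fun ω => (D.pastState τ ω).1 - (D.pastState τ ω).2)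
      (MeasurableSpace.comap (fun ω => (D.pastState τ ω).2) inferInstance)
      (D.futureInfo (-τ)) := by
  obtain ⟨h1, h2, -⟩ := pastState_moments hS hD τ
  obtain ⟨g, hg, hqg⟩ := exists_pastState_version hD τ
  refine ⟨h1, (measurable_pastState hD τ).snd.comap_le, ?_, ?_⟩
  · rwa [IndepFun_iff_Indep] at h2
  · refine ((indep_pastInfo_futureInfo hD (-τ)).comap_of_ae_eq hg hqg).mono ?_ le_rfl
    have hm : Measurable[MeasurableSpace.comap (D.pastState τ) inferInstance] (D.pastState τ) :=
      comap_measurable (D.pastState τ)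
    exact sup_le hm.snd.comap_le (hm.fst.sub hm.snd).comap_le

end RandomCPS

/-! ### The Kalman filter from a remote start to time `0` -/

theorem CPS.innovInfo_mono {n m p s : ℕ} {S : CPS n m p s} {Ω : Type*} {G : MeasurableSpace Ω}
    {ε : Ω → Vec n} {w : ℕ → Ω → Vec n} {v : ℕ → Ω → Vec p} :
    Monotone (S.innovInfo G ε w v) :=
  monotone_nat_of_le_succ fun _ => le_sup_left

theorem CPS.measurable_innov_innovInfo {n m p s : ℕ} {S : CPS n m p s} {Ω : Type*}
    {G : MeasurableSpace Ω} {ε : Ω → Vec n} {w : ℕ → Ω → Vec n} {v : ℕ → Ω → Vec p} {k t : ℕ}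
    (h : k < t) : Measurable[S.innovInfo G ε w v t]
      (fun ω => S.innov (ε ω) (fun k => w k ω) (fun k => v k ω) k) :=
  (comap_measurable (fun ω => S.innov (ε ω) (fun k => w k ω) (fun k => v k ω) k)).mono
    ((le_sup_right (a := S.innovInfo G ε w v k)).trans
      (innovInfo_mono (S := S) (Nat.succ_le_of_lt h))) le_rfl

namespace RandomCPS

variable {n m p s : ℕ} {Ω : Type*} {mΩ : MeasurableSpace Ω} {μ : Measure Ω}
  {S : CPS n m p s} {D : RandomCPS n p Ω}

/-- The measurements before time `0` and the prediction of the state at time `0`. -/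
@[reducible] noncomputable def initInfo (D : RandomCPS n p Ω) (S : CPS n m p s) :
    MeasurableSpace Ω :=
  (⨆ k : ℤ, ⨆ _ : k < 0, MeasurableSpace.comap (fun ω => S.C *ᵥ D.x k ω + D.v k ω) inferInstance)
    ⊔ MeasurableSpace.comap (D.z 0) inferInstance

/-- Without attack the errors follow the recursion `err`, and the predictions follow `z⁺ = (A +
BL)(z + K ν)`. So each prediction is, almost surely, a function of the one at time `-τ` and of the
innovations since then. -/
theorem past_innovations [IsProbabilityMeasure μ] (hD : D.IsModel S μ) (τ k : ℕ) (hk : k ≤ τ) :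
    ((fun ω => S.err ((D.pastState τ ω).1 - (D.pastState τ ω).2) (fun k => D.w (-τ + k) ω)
        (fun k => D.v (-τ + k) ω) k) =ᵐ[μ]
      fun ω => (D.pastState (τ - k) ω).1 - (D.pastState (τ - k) ω).2) ∧
    ∃ g : Ω → Vec n, Measurable[S.innovInfo
        (MeasurableSpace.comap (fun ω => (D.pastState τ ω).2) inferInstance)
        (fun ω => (D.pastState τ ω).1 - (D.pastState τ ω).2) (fun k => D.w (-τ + k))
        (fun k => D.v (-τ + k)) k] g ∧ (fun ω => (D.pastState (τ - k) ω).2) =ᵐ[μ] g := by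
  induction k with
  | zero => exact ⟨ae_eq_refl _, fun ω => (D.pastState τ ω).2, comap_measurable _, ae_eq_refl _⟩
  | succ k ih =>
    obtain ⟨h1, g, hg, h2⟩ := ih (by omega)
    have hstep := pastState_step (S := S) hD (τ - (k + 1))
    have e1 : τ - (k + 1) + 1 = τ - k := by omega
    -- After `k` steps from `-τ` the time is `-(τ - k)`, and the natural subtraction is exact
    -- because `k ≤ τ`.
    have e2 : -((τ - k : ℕ) : ℤ) = -(τ : ℤ) + k := by omega
    rw [e1, e2] at hstep
    constructor
    · filter_upwards [h1, hstep] with ω h1 hstep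
      rw [hstep, CPS.step_zero_sub, ← h1]
      rfl
    · refine ⟨fun ω => (S.A + S.B * S.L) *ᵥ (g ω + S.K *ᵥ S.innov
        ((D.pastState τ ω).1 - (D.pastState τ ω).2) (fun k => D.w (-τ + k) ω)
        (fun k => D.v (-τ + k) ω) k), ?_, ?_⟩
      · refine (measurable_mulVec _).comp (Measurable.add (hg.mono le_sup_left le_rfl)
          ((measurable_mulVec _).comp ?_))
        exact (comap_measurable (fun ω => S.innov
          ((D.pastState τ ω).1 - (D.pastState τ ω).2) (fun k => D.w (-τ + k) ω)
          (fun k => D.v (-τ + k) ω) k)).mono le_sup_right le_rfl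
      · filter_upwards [h1, h2, hstep] with ω h1 h2 hstep
        rw [hstep, CPS.step_zero_snd, ← h1, h2]
        rfl

/-- The prediction at time `0` and the measurements at the times `-τ, …, -1`. -/
noncomputable def recent (D : RandomCPS n p Ω) (S : CPS n m p s) (τ : ℕ) (ω : Ω) :
    Vec n × (Fin τ → Vec p) :=
  (D.z 0 ω, fun j => S.C *ᵥ D.x (-((j : ℕ) + 1 : ℕ)) ω + D.v (-((j : ℕ) + 1 : ℕ)) ω)

theorem recent_version [IsProbabilityMeasure μ] (hD : D.IsModel S μ) (τ : ℕ) :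
    ∃ g : Ω → Vec n × (Fin τ → Vec p), Measurable[S.innovInfo
        (MeasurableSpace.comap (fun ω => (D.pastState τ ω).2) inferInstance)
        (fun ω => (D.pastState τ ω).1 - (D.pastState τ ω).2) (fun k => D.w (-τ + k))
        (fun k => D.v (-τ + k)) τ] g ∧ D.recent S τ =ᵐ[μ] g := by
  have H := past_innovations (S := S) hD τ
  obtain ⟨-, g0, hg0, h0⟩ := H τ le_rfl
  have hy : ∀ j : Fin τ, ∃ g : Ω → Vec p, Measurable[S.innovInfo
        (MeasurableSpace.comap (fun ω => (D.pastState τ ω).2) inferInstance)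
        (fun ω => (D.pastState τ ω).1 - (D.pastState τ ω).2) (fun k => D.w (-τ + k))
        (fun k => D.v (-τ + k)) τ] g ∧ (fun ω => (D.recent S τ ω).2 j) =ᵐ[μ] g := by
    intro j
    -- The measurement at time `-(j + 1)` is `C` times the prediction plus the innovation, at step
    -- `τ - (j + 1)` of the filter.
    obtain ⟨h1, g, hg, h2⟩ := H (τ - (j + 1)) (by omega)
    have e1 : τ - (τ - ((j : ℕ) + 1)) = j + 1 := by omega
    have e2 : -(τ : ℤ) + ((τ - ((j : ℕ) + 1) : ℕ) : ℤ) = -((j + 1 : ℕ) : ℤ) := by omega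
    rw [e1] at h1 h2
    refine ⟨fun ω => S.C *ᵥ g ω + S.innov ((D.pastState τ ω).1 - (D.pastState τ ω).2)
      (fun k => D.w (-τ + k) ω) (fun k => D.v (-τ + k) ω) (τ - (j + 1)), ?_, ?_⟩
    · refine Measurable.add ((measurable_mulVec _).comp
        (hg.mono (CPS.innovInfo_mono (by omega)) le_rfl)) ?_
      exact CPS.measurable_innov_innovInfo (by omega)
    · filter_upwards [h1, h2] with ω h1 h2
      rw [CPS.innov, h1, ← h2, e2]
      simp only [recent, pastState]
      rw [← add_assoc, ← Matrix.mulVec_add, add_sub_cancel]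
  choose g hg hgy using hy
  refine ⟨fun ω => (g0 ω, fun j => g j ω), hg0.prodMk (@measurable_pi_iff _ _ _ (_) _ _ |>.2 hg), ?_⟩
  have hall : ∀ᵐ ω ∂μ, ∀ j, (D.recent S τ ω).2 j = g j ω := ae_all_iff.2 hgy
  filter_upwards [h0, hall] with ω h0 hall
  refine Prod.ext ?_ (funext hall)
  rw [← h0, Nat.sub_self]
  rfl

theorem measurable_recent (hD : D.IsModel S μ) (τ : ℕ) : Measurable (D.recent S τ) := by
  refine (hD.measurable_z 0 le_rfl).prodMk (measurable_pi_iff.2 fun j => ?_)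
  exact ((measurable_mulVec S.C).comp (hD.measurable_x _ (by omega))).add (hD.measurable_v _)

theorem comap_recent_mono : Monotone fun τ => MeasurableSpace.comap (D.recent S τ) inferInstance := by
  intro τ τ' h
  have hm : Measurable[MeasurableSpace.comap (D.recent S τ') inferInstance] (D.recent S τ') :=
    comap_measurable _
  refine Measurable.comap_le (hm.fst.prodMk (@measurable_pi_iff _ _ _ (_) _ _ |>.2 fun j => ?_))
  exact (measurable_pi_apply (Fin.castLE h j)).comp hm.snd

theorem initInfo_le_iSup_recent :
    D.initInfo S ≤ ⨆ τ, MeasurableSpace.comap (D.recent S τ) inferInstance := by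
  refine sup_le (iSup₂_le fun k hk => ?_) ?_
  · obtain ⟨j, rfl⟩ : ∃ j : ℕ, k = -((j + 1 : ℕ) : ℤ) := ⟨(-k).toNat - 1, by omega⟩
    refine le_iSup_of_le (j + 1) ?_
    have hm : Measurable[MeasurableSpace.comap (D.recent S (j + 1)) inferInstance]
        (D.recent S (j + 1)) := comap_measurable _
    exact ((measurable_pi_apply (Fin.last j)).comp hm.snd).comap_le
  · refine le_iSup_of_le 0 ?_
    have hm : Measurable[MeasurableSpace.comap (D.recent S 0) inferInstance]
        (D.recent S 0) := comap_measurable _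
    exact hm.fst.comap_le

theorem initInfo_le (hD : D.IsModel S μ) : D.initInfo S ≤ mΩ :=
  initInfo_le_iSup_recent.trans (iSup_le fun τ => (measurable_recent hD τ).comap_le)

/-- At time `0` the Kalman filter is in steady state. -/
theorem isSteady_zero [IsProbabilityMeasure μ] (hS : S.Standing) (hD : D.IsModel S μ) :
    S.IsSteady μ (fun ω => D.x 0 ω - D.z 0 ω) (D.initInfo S) (D.futureInfo 0) := by
  have herr : IsCentredGaussian μ S.P (fun ω => D.x 0 ω - D.z 0 ω) := by
    have := (pastState_moments hS hD 0).1
    simpa [pastState] using this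
  -- For a fixed start `-τ` the past is the finite record `recent S τ`; these records increase with
  -- `τ` and generate `initInfo`, so the independence extends to their supremum.
  have key : ∀ τ : ℕ, Indep (MeasurableSpace.comap (D.recent S τ) inferInstance)
        (MeasurableSpace.comap (fun ω => D.x 0 ω - D.z 0 ω) inferInstance) μ ∧
      Indep (MeasurableSpace.comap (D.recent S τ) inferInstance ⊔
        MeasurableSpace.comap (fun ω => D.x 0 ω - D.z 0 ω) inferInstance) (D.futureInfo 0) μ := by
    intro τ
    have hn := isNoise hS hD (-(τ : ℤ))
    have h0 := isSteady_past hS hD τ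
    have h0' : S.IsSteady μ (fun ω => (D.pastState τ ω).1 - (D.pastState τ ω).2)
      (MeasurableSpace.comap (fun ω => (D.pastState τ ω).2) inferInstance)
      (D.futureInfo (-(τ : ℤ) + (0 : ℕ))) := by simpa using h0
    have hτ := (h0'.innovations (𝒩 := fun k : ℕ => D.futureInfo (-(τ : ℤ) + k)) hS hn τ).1
    have he := (past_innovations (S := S) hD τ τ le_rfl).1
    obtain ⟨g, hg, hrec⟩ := recent_version (S := S) hD τ
    have he' : (fun ω => D.x 0 ω - D.z 0 ω) =ᵐ[μ] fun ω =>
        S.err ((D.pastState τ ω).1 - (D.pastState τ ω).2) (fun k => D.w (-τ + k) ω)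
        (fun k => D.v (-τ + k) ω) τ := by
      filter_upwards [he] with ω h
      rw [h, Nat.sub_self]
      simp [pastState]
    have hem := comap_measurable (m := inferInstance) (fun ω =>
        S.err ((D.pastState τ ω).1 - (D.pastState τ ω).2) (fun k => D.w (-τ + k) ω)
        (fun k => D.v (-τ + k) ω) τ)
    constructor
    · exact ((hτ.indep_err.comap_of_ae_eq hem he').symm.comap_of_ae_eq hg hrec)
    -- Record and error are replaced as a pair, because the independence concerns the σ-algebra that
    -- they generate jointly.
    · have hpair : (fun ω => (D.recent S τ ω, D.x 0 ω - D.z 0 ω)) =ᵐ[μ] fun ω => (g ω,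
          S.err ((D.pastState τ ω).1 - (D.pastState τ ω).2) (fun k => D.w (-τ + k) ω)
          (fun k => D.v (-τ + k) ω) τ) := by
        filter_upwards [hrec, he'] with ω h h'
        rw [h, h']
      have h1 := hτ.indep_noise.comap_of_ae_eq
        ((hg.mono le_sup_left le_rfl).prodMk (hem.mono le_sup_right le_rfl)) hpair
      rw [neg_add_cancel] at h1
      refine h1.mono ?_ le_rfl
      have hm := comap_measurable (m := inferInstance) (fun ω => (D.recent S τ ω, D.x 0 ω - D.z 0 ω))
      exact sup_le hm.fst.comap_le hm.snd.comap_le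
  have hle := fun τ => (measurable_recent (S := S) hD τ).comap_le
  refine ⟨herr, initInfo_le hD, ?_, ?_⟩
  · exact (indep_iSup_of_monotone (fun τ => (key τ).1) hle herr.measurable.comap_le
      comap_recent_mono).symm.mono le_rfl initInfo_le_iSup_recent
  · refine (indep_iSup_of_monotone (fun τ => (key τ).2)
      (fun τ => sup_le (hle τ) herr.measurable.comap_le) (futureInfo_le hD 0)
      (fun _ _ h => sup_le_sup_right (comap_recent_mono h) _)).mono ?_ le_rfl
    refine sup_le (initInfo_le_iSup_recent.trans (iSup_mono fun _ => le_sup_left)) ?_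
    exact le_iSup_of_le 0 le_sup_right

end RandomCPS

/-! ### Trajectories under attack -/

namespace CPS

variable {n m p s : ℕ} (S : CPS n m p s) (q : Vec n × Vec n) (e : ℕ → Vec s) (w : ℕ → Vec n)
  (v : ℕ → Vec p)

theorem run_succ (t : ℕ) : S.run q e w v (t + 1) =
    (S.A *ᵥ (S.run q e w v t).1 + S.B *ᵥ (S.L *ᵥ S.sysEst q e w v t) + S.Γ *ᵥ e t + w t,
      S.A *ᵥ S.sysEst q e w v t + S.B *ᵥ (S.L *ᵥ S.sysEst q e w v t)) := by
  have h : S.C *ᵥ (S.run q e w v t).1 + S.Ψ *ᵥ e t + v t - S.C *ᵥ (S.run q e w v t).2 =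
      S.sysInnov q e w v t := by
    simp only [sysInnov, ytilde]
    abel
  simp only [run, step, h, sysEst]

/-- The prediction error of the attacker's filter does not depend on the attack. -/
theorem run_fst_eq (t : ℕ) :
    (S.run q e w v t).1 = S.attPred q e w v t + S.err (q.1 - q.2) w v t := by
  induction t with
  | zero => simp [run, attPred, err]
  | succ t ih =>
    have h : S.ytilde q e w v t - S.C *ᵥ S.attPred q e w v t = S.innov (q.1 - q.2) w v t := by
      simp only [ytilde, ih, innov, Matrix.mulVec_add]
      abel
    rw [run_succ, attPred, err_succ, h, ih, ferr]
    simp only [Matrix.mulVec_add, Matrix.mulVec_sub]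
    abel

theorem attInnov_eq (t : ℕ) : S.attInnov q e w v t = S.innov (q.1 - q.2) w v t := by
  simp only [attInnov, ytilde, run_fst_eq, innov, Matrix.mulVec_add]
  abel

theorem ytilde_eq (t : ℕ) :
    S.ytilde q e w v t = S.C *ᵥ S.attPred q e w v t + S.innov (q.1 - q.2) w v t := by
  rw [← attInnov_eq S q e w v, attInnov]
  abel

theorem sysInnov_eq (t : ℕ) : S.sysInnov q e w v t = S.innov (q.1 - q.2) w v t +
    S.C *ᵥ (S.attPred q e w v t - (S.run q e w v t).2) + S.Ψ *ᵥ e t := by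
  rw [sysInnov, ytilde_eq, Matrix.mulVec_sub]
  abel

theorem attPred_succ (t : ℕ) : S.attPred q e w v (t + 1) =
    S.A *ᵥ S.attEst q e w v t + S.B *ᵥ (S.L *ᵥ S.sysEst q e w v t) + S.Γ *ᵥ e t := rfl

theorem state_eq (t : ℕ) :
    (S.run q e w v t).1 = S.attEst q e w v t + S.ferr (q.1 - q.2) w v t := by
  rw [run_fst_eq, attEst, ferr, attInnov_eq]
  abel

/-- The component `ω` of `θ = (ω, π, ρ)`. -/
noncomputable def theta₁ (t : ℕ) : Vec n := fun i => S.theta e t (Sum.inl i)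

/-- The component `π` of `θ = (ω, π, ρ)`. -/
noncomputable def theta₂ (t : ℕ) : Vec n := fun i => S.theta e t (Sum.inr (Sum.inl i))

/-- The component `ρ` of `θ = (ω, π, ρ)`. -/
noncomputable def theta₃ (t : ℕ) : Vec n := fun i => S.theta e t (Sum.inr (Sum.inr i))

theorem theta_eq (t : ℕ) :
    S.theta e t = Sum.elim (S.theta₁ e t) (Sum.elim (S.theta₂ e t) (S.theta₃ e t)) := by
  funext i
  rcases i with i | i | i <;> rfl

theorem theta_succ_eq (t : ℕ) : S.theta e (t + 1) =
    Sum.elim (S.Omega *ᵥ S.theta e t + (S.K * S.Ψ) *ᵥ e t)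
      (Sum.elim ((S.A * S.B * S.L) *ᵥ S.theta₁ e t + S.A *ᵥ S.theta₂ e t)
        (S.A *ᵥ S.theta₃ e t + S.Γ *ᵥ e t)) := by
  rw [theta, Ahat, Bhat, Omega, Matrix.fromRows_mulVec, Matrix.fromRows_mulVec,
    Matrix.fromRows_mulVec, Matrix.fromRows_mulVec, ← Sum.elim_add_add, ← Sum.elim_add_add]
  conv_lhs => rw [theta_eq]
  simp only [Matrix.fromCols_mulVec_sumElim, Matrix.zero_mulVec, add_zero, zero_add]
  conv_rhs => rw [theta_eq]
  simp only [Matrix.fromCols_mulVec_sumElim]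

theorem theta₁_succ (t : ℕ) :
    S.theta₁ e (t + 1) = S.Omega *ᵥ S.theta e t + (S.K * S.Ψ) *ᵥ e t := by
  funext i
  rw [theta₁, theta_succ_eq, Sum.elim_inl]

theorem theta₂_succ (t : ℕ) : S.theta₂ e (t + 1) =
    (S.A * S.B * S.L) *ᵥ S.theta₁ e t + S.A *ᵥ S.theta₂ e t := by
  funext i
  rw [theta₂, theta_succ_eq, Sum.elim_inr, Sum.elim_inl]

theorem theta₃_succ (t : ℕ) : S.theta₃ e (t + 1) = S.A *ᵥ S.theta₃ e t + S.Γ *ᵥ e t := by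
  funext i
  rw [theta₃, theta_succ_eq, Sum.elim_inr, Sum.elim_inr]

theorem Omega_mulVec_theta (t : ℕ) : S.Omega *ᵥ S.theta e t =
    ((1 - S.K * S.C) * S.A + S.B * S.L) *ᵥ S.theta₁ e t + ((S.K * S.C) *ᵥ S.theta₂ e t
      + (S.K * S.C) *ᵥ S.theta₃ e t) := by
  rw [theta_eq, Omega, Matrix.fromCols_mulVec_sumElim, Matrix.fromCols_mulVec_sumElim]

theorem Chat_mulVec_theta (t : ℕ) : S.Chat *ᵥ S.theta e t =
    S.C *ᵥ (S.theta₂ e t + S.theta₃ e t - S.A *ᵥ S.theta₁ e t) := by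
  rw [theta_eq, Chat, Matrix.fromCols_mulVec_sumElim, Matrix.fromCols_mulVec_sumElim,
    Matrix.mulVec_sub, Matrix.mulVec_add, Matrix.mulVec_mulVec, Matrix.neg_mulVec]
  abel

/-- The difference of the attacker's and the system's predictions is a linear function of `θ`. -/
theorem attPred_sub_run_snd (t : ℕ) : S.attPred q e w v t - (S.run q e w v t).2 =
    S.theta₂ e t + S.theta₃ e t - S.A *ᵥ S.theta₁ e t := by
  induction t with
  | zero =>
    have h1 : S.theta₁ e 0 = 0 := rfl
    have h2 : S.theta₂ e 0 = 0 := rfl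
    have h3 : S.theta₃ e 0 = 0 := rfl
    rw [h1, h2, h3, Matrix.mulVec_zero]
    simp [attPred, run]
  | succ t ih =>
    have hd := ih
    rw [attPred_succ, run_succ, theta₁_succ, theta₂_succ, theta₃_succ, attEst, sysEst, attInnov_eq,
      sysInnov_eq, Omega_mulVec_theta]
    set ν := S.innov (q.1 - q.2) w v t
    -- After this substitution the common prediction and the common innovation cancel, and only
    -- terms in `θ` and `e` remain.
    have hz : S.attPred q e w v t = (S.run q e w v t).2 +
        (S.theta₂ e t + S.theta₃ e t - S.A *ᵥ S.theta₁ e t) := by rw [← hd]; abel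
    rw [hz]
    simp only [Matrix.mulVec_add, Matrix.mulVec_sub, Matrix.add_mulVec, Matrix.sub_mulVec,
      Matrix.mulVec_mulVec, Matrix.sub_mul, Matrix.one_mul,
      Matrix.mul_assoc, add_sub_cancel_left]
    abel

/-- The effect of the attack on the system's estimate. -/
theorem attack_effect (t : ℕ) :
    (S.run q e w v t).2 = (S.run q 0 w v t).2 + (S.A + S.B * S.L) *ᵥ S.theta₁ e t ∧
    (S.run q e w v t).1 = (S.run q 0 w v t).1 + (S.theta₂ e t + S.theta₃ e t
      + (S.B * S.L) *ᵥ S.theta₁ e t) ∧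
    S.sysEst q e w v t = S.sysEst q 0 w v t + (S.Omega *ᵥ S.theta e t + (S.K * S.Ψ) *ᵥ e t) := by
  -- The effect on the estimate follows from the effects on state and prediction at the same time.
  -- It is used inside the induction, because the control is computed from the estimate.
  have est : ∀ t, (S.run q e w v t).2 = (S.run q 0 w v t).2 + (S.A + S.B * S.L) *ᵥ S.theta₁ e t →
      (S.run q e w v t).1 = (S.run q 0 w v t).1 + (S.theta₂ e t + S.theta₃ e t
        + (S.B * S.L) *ᵥ S.theta₁ e t) →
      S.sysEst q e w v t =
        S.sysEst q 0 w v t + (S.Omega *ᵥ S.theta e t + (S.K * S.Ψ) *ᵥ e t) := by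
    intro t h1 h2
    simp only [sysEst, sysInnov, ytilde, h1, h2, Omega_mulVec_theta, Pi.zero_apply,
      Matrix.mulVec_zero, Matrix.mulVec_add, Matrix.mulVec_sub, Matrix.add_mulVec,
      Matrix.sub_mulVec, Matrix.mulVec_mulVec, Matrix.sub_mul, Matrix.one_mul,
      Matrix.mul_assoc]
    abel
  have main : (S.run q e w v t).2 = (S.run q 0 w v t).2 + (S.A + S.B * S.L) *ᵥ S.theta₁ e t ∧
      (S.run q e w v t).1 = (S.run q 0 w v t).1 + (S.theta₂ e t + S.theta₃ e t
        + (S.B * S.L) *ᵥ S.theta₁ e t) := by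
    induction t with
    | zero =>
      have h1 : S.theta₁ e 0 = 0 := rfl
      have h2 : S.theta₂ e 0 = 0 := rfl
      have h3 : S.theta₃ e 0 = 0 := rfl
      rw [h1, h2, h3]
      simp [run]
    | succ t ih =>
      have h := est t ih.1 ih.2
      rw [run_succ, run_succ, h, ih.2, theta₁_succ, theta₂_succ, theta₃_succ]
      constructor
      · simp only [Matrix.mulVec_add, Matrix.add_mulVec, Matrix.add_mul, Matrix.mulVec_mulVec,
          Matrix.mul_assoc]
        abel
      · simp only [Matrix.mulVec_add, Matrix.mulVec_mulVec, Matrix.mul_assoc,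
          Pi.zero_apply, Matrix.mulVec_zero]
        abel
  exact ⟨main.1, main.2, est t main.1 main.2⟩

theorem run_zero_sub (t : ℕ) :
    (S.run q 0 w v t).1 - (S.run q 0 w v t).2 = S.err (q.1 - q.2) w v t := by
  induction t with
  | zero => rfl
  | succ t ih => rw [run, Pi.zero_apply, step_zero_sub, ih, err]

theorem sysEst_zero_eq (t : ℕ) :
    S.sysEst q 0 w v t = (S.run q 0 w v t).2 + S.K *ᵥ S.innov (q.1 - q.2) w v t := by
  have h := run_zero_sub S q w v t
  rw [sysEst, sysInnov, ytilde, innov, ← h, Pi.zero_apply, Matrix.mulVec_zero]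
  simp only [Matrix.mulVec_sub, Matrix.mulVec_add, add_zero]
  abel

theorem sysEst_zero_succ (t : ℕ) : S.sysEst q 0 w v (t + 1) =
    (S.A + S.B * S.L) *ᵥ S.sysEst q 0 w v t + S.K *ᵥ S.innov (q.1 - q.2) w v (t + 1) := by
  rw [sysEst_zero_eq, run_succ]
  simp only [Matrix.add_mulVec, Matrix.mulVec_mulVec]

/-- The input matrix of the innovations in the `ξ` system. -/
noncomputable def calG : Matrix (XiIdx n) (Fin p) ℝ :=
  Matrix.fromRows S.K (Matrix.fromRows 0 (Matrix.fromRows S.K 0))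

theorem xi_zero (xstar : Vec n) : S.xi xstar q e w v 0 =
    Sum.elim (q.2 + S.K *ᵥ S.innov (q.1 - q.2) w v 0)
      (Sum.elim 0 (Sum.elim (q.2 + S.K *ᵥ S.innov (q.1 - q.2) w v 0) xstar)) := by
  rw [xi, attEst, attInnov_eq, sysEst_zero_eq]
  rfl

/-- By `attack_effect` the control is `L (x̂⁰ + Ωθ + KΨe)`, which explains the first block row and
the presence of `x̂⁰` in `ξ`. The innovation moves `x̂` and `x̂⁰` by the same `K ν`, and leaves `θ`
and `x*` alone. -/
theorem xi_succ (xstar : Vec n) (t : ℕ) : S.xi xstar q e w v (t + 1) =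
    S.calA *ᵥ S.xi xstar q e w v t + S.calB *ᵥ e t
      + S.calG *ᵥ S.innov (q.1 - q.2) w v (t + 1) := by
  simp only [xi, calA, calB, calG, Matrix.fromRows_mulVec, Matrix.fromCols_mulVec_sumElim,
    ← Sum.elim_add_add]
  refine congrArg₂ Sum.elim ?_ (congrArg₂ Sum.elim ?_ (congrArg₂ Sum.elim ?_ ?_))
  · rw [attEst, attInnov_eq, attPred_succ, (attack_effect S q e w v t).2.2]
    simp only [Matrix.mulVec_add, Matrix.add_mulVec, Matrix.mulVec_mulVec, Matrix.zero_mulVec,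
      Matrix.mul_assoc, add_zero]
    abel
  · rw [theta]
    simp
  · rw [sysEst_zero_succ]
    simp
  · simp

/-- The bias `Ĉθ` is `C` times the difference of the attacker's and the system's predictions. -/
theorem sysInnov_eq_xi (xstar : Vec n) (t : ℕ) : S.sysInnov q e w v t =
    S.Ctilde *ᵥ S.xi xstar q e w v t + S.Ψ *ᵥ e t + S.innov (q.1 - q.2) w v t := by
  have h : S.Ctilde *ᵥ S.xi xstar q e w v t = S.Chat *ᵥ S.theta e t := by
    simp [Ctilde, xi]
  rw [h, Chat_mulVec_theta, ← attPred_sub_run_snd S q e w v, sysInnov_eq]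
  abel

theorem state_sub_eq_xi (xstar : Vec n) (t : ℕ) : (S.run q e w v t).1 - xstar =
    S.calH *ᵥ S.xi xstar q e w v t + S.ferr (q.1 - q.2) w v t := by
  have h : S.calH *ᵥ S.xi xstar q e w v t = S.attEst q e w v t - xstar := by
    simp only [calH, xi, Matrix.fromCols_mulVec_sumElim, Matrix.one_mulVec, Matrix.zero_mulVec,
      Matrix.neg_mulVec, zero_add, sub_eq_add_neg]
  rw [h, state_eq]
  abel

end CPS

/-! ### A linear-quadratic problem whose cost depends on the innovations -/

/-- The system `ξ⁺ = A ξ + B e + G ν⁺` with stage costs `‖C ξ + D e + E ν‖²` weighted by `R t`, for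
`t = 0, …, N`. -/
structure LQProblem (ι σ κ ρ : Type*) where
  A : Matrix ι ι ℝ
  B : Matrix ι σ ℝ
  G : Matrix ι ρ ℝ
  C : Matrix κ ι ℝ
  D : Matrix κ σ ℝ
  E : Matrix κ ρ ℝ
  R : ℕ → Matrix κ κ ℝ

namespace LQProblem

variable {ι σ κ ρ : Type*} [Fintype ι] [Fintype σ] [Fintype κ]

/-- The solution `V` of the Riccati recursion with end value `0`. -/
structure IsValue (Q : LQProblem ι σ κ ρ) (N : ℕ) (V : ℕ → Matrix ι ι ℝ) : Prop where
  posSemidef : ∀ t ≤ N, (Q.R t).PosSemidef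
  last : V (N + 1) = 0
  riccati : ∀ t ≤ N, V t = Q.Cᵀ * Q.R t * Q.C + Q.Aᵀ * V (t + 1) * Q.A
    - (Q.Dᵀ * Q.R t * Q.C + Q.Bᵀ * V (t + 1) * Q.A)ᵀ
      * pinv (Q.Dᵀ * Q.R t * Q.D + Q.Bᵀ * V (t + 1) * Q.B)
      * (Q.Dᵀ * Q.R t * Q.C + Q.Bᵀ * V (t + 1) * Q.A)

theorem IsValue.value_posSemidef {Q : LQProblem ι σ κ ρ} {N : ℕ} {V : ℕ → Matrix ι ι ℝ}
    (h : Q.IsValue N V) {t : ℕ} (ht : t ≤ N + 1) : (V t).PosSemidef := by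
  induction ht using Nat.decreasingInduction with
  | self => rw [h.last]; exact Matrix.PosSemidef.zero
  | of_succ k hk ih =>
    rw [h.riccati k (by omega)]
    exact riccati_posSemidef (h.posSemidef k (by omega)) ih _ _ _ _

/-- The gain of the optimal control on the state. -/
noncomputable def stateGain (Q : LQProblem ι σ κ ρ) (V : ℕ → Matrix ι ι ℝ) (t : ℕ) :
    Matrix σ ι ℝ :=
  -(pinv (Q.Dᵀ * Q.R t * Q.D + Q.Bᵀ * V (t + 1) * Q.B)
    * (Q.Dᵀ * Q.R t * Q.C + Q.Bᵀ * V (t + 1) * Q.A))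

/-- The gain of the optimal control on the innovation. -/
noncomputable def innovGain (Q : LQProblem ι σ κ ρ) (V : ℕ → Matrix ι ι ℝ) (t : ℕ) :
    Matrix σ ρ ℝ :=
  -(pinv (Q.Dᵀ * Q.R t * Q.D + Q.Bᵀ * V (t + 1) * Q.B) * (Q.Dᵀ * Q.R t * Q.E))

variable [Fintype ρ]

/-- The optimal control. -/
noncomputable def feedback (Q : LQProblem ι σ κ ρ) (V : ℕ → Matrix ι ι ℝ) (t : ℕ) (x : ι → ℝ)
    (y : ρ → ℝ) : σ → ℝ :=
  Q.stateGain V t *ᵥ x + Q.innovGain V t *ᵥ y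

/-- The cost at time `t`. -/
def stageCost (Q : LQProblem ι σ κ ρ) (t : ℕ) (x : ι → ℝ) (y : ρ → ℝ) (e : σ → ℝ) : ℝ :=
  quad (Q.R t) (Q.C *ᵥ x + Q.D *ᵥ e + Q.E *ᵥ y)

/-- The cost at time `t` plus the cost to go, up to a constant. -/
def actionCost (Q : LQProblem ι σ κ ρ) (V : ℕ → Matrix ι ι ℝ) (t : ℕ) (x : ι → ℝ) (y : ρ → ℝ)
    (e : σ → ℝ) : ℝ :=
  Q.stageCost t x y e + quad (V (t + 1)) (Q.A *ᵥ x + Q.B *ᵥ e)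

variable {Q : LQProblem ι σ κ ρ} {N : ℕ} {V : ℕ → Matrix ι ι ℝ}

/-- The one-step problem with offsets `C x + E y` and `A x`. The innovation at time `t` is known
when `e` is chosen, so it counts as part of the offset. -/
theorem actionCost_feedback_le (h : Q.IsValue N V) {t : ℕ} (ht : t ≤ N) (x : ι → ℝ) (y : ρ → ℝ)
    (e : σ → ℝ) : Q.actionCost V t x y (Q.feedback V t x y) ≤ Q.actionCost V t x y e := by
  have := quad_minimizer_le (h.posSemidef t ht) (h.value_posSemidef (Nat.succ_le_succ ht)) Q.D Q.B
    (Q.C *ᵥ x + Q.E *ᵥ y) (Q.A *ᵥ x) (Q.feedback V t x y) e ?_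
  · simpa only [actionCost, stageCost, add_right_comm _ (Q.E *ᵥ y)] using this
  · simp only [feedback, stateGain, innovGain, Matrix.mulVec_add, Matrix.neg_mulVec,
      Matrix.add_mulVec, Matrix.mulVec_mulVec, Matrix.mul_add, Matrix.mul_assoc]
    abel

theorem actionCost_feedback_zero (h : Q.IsValue N V) {t : ℕ} (ht : t ≤ N) (x : ι → ℝ) :
    Q.actionCost V t x 0 (Q.feedback V t x 0) = quad (V t) x := by
  have := quad_minimum_eq (transpose_eq_of_posSemidef (h.posSemidef t ht))
    (transpose_eq_of_posSemidef (h.value_posSemidef (Nat.succ_le_succ ht))) Q.C Q.D Q.A Q.B x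
    (Q.feedback V t x 0) ?_
  · rw [h.riccati t ht, ← this, actionCost, stageCost, Matrix.mulVec_zero, add_zero]
  · rw [feedback, stateGain, Matrix.mulVec_zero, add_zero, Matrix.neg_mulVec, Matrix.mulVec_mulVec]

/-- The output as a function of state and innovation, under the optimal control. -/
theorem output_feedback (t : ℕ) (x : ι → ℝ) (y : ρ → ℝ) :
    Q.C *ᵥ x + Q.D *ᵥ Q.feedback V t x y + Q.E *ᵥ y =
      (Q.C + Q.D * Q.stateGain V t) *ᵥ x + (Q.E + Q.D * Q.innovGain V t) *ᵥ y := by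
  simp only [feedback, Matrix.mulVec_add, Matrix.add_mulVec, Matrix.mulVec_mulVec]
  abel

theorem next_feedback (t : ℕ) (x : ι → ℝ) (y : ρ → ℝ) :
    Q.A *ᵥ x + Q.B *ᵥ Q.feedback V t x y =
      (Q.A + Q.B * Q.stateGain V t) *ᵥ x + (Q.B * Q.innovGain V t) *ᵥ y := by
  simp only [feedback, Matrix.mulVec_add, Matrix.add_mulVec, Matrix.mulVec_mulVec]
  abel

theorem actionCost_feedback (t : ℕ) (x : ι → ℝ) (y : ρ → ℝ) :
    Q.actionCost V t x y (Q.feedback V t x y) =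
      quad (Q.R t) ((Q.C + Q.D * Q.stateGain V t) *ᵥ x + (Q.E + Q.D * Q.innovGain V t) *ᵥ y) +
        quad (V (t + 1)) ((Q.A + Q.B * Q.stateGain V t) *ᵥ x + (Q.B * Q.innovGain V t) *ᵥ y) := by
  rw [actionCost, stageCost, output_feedback, next_feedback]

theorem stageCost_nonneg (h : Q.IsValue N V) {t : ℕ} (ht : t ≤ N) (x : ι → ℝ) (y : ρ → ℝ)
    (e : σ → ℝ) : 0 ≤ Q.stageCost t x y e :=
  quad_nonneg (h.posSemidef t ht) _

variable {Ω : Type*} {mΩ : MeasurableSpace Ω} {μ : Measure Ω}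

/-- The expected optimal cost to go, up to a constant, given state and innovation at time `t`. -/
noncomputable def optCost (Q : LQProblem ι σ κ ρ) (V : ℕ → Matrix ι ι ℝ) (μ : Measure Ω) (t : ℕ)
    (ξ : Ω → ι → ℝ) (ν : Ω → ρ → ℝ) : ℝ≥0∞ :=
  ∫⁻ ω, ENNReal.ofReal (Q.actionCost V t (ξ ω) (ν ω) (Q.feedback V t (ξ ω) (ν ω))) ∂μ

theorem optCost_lt_top {t : ℕ} {ξ : Ω → ι → ℝ} {ν : Ω → ρ → ℝ}
    (hξ : MemLp ξ 2 μ) (hν : MemLp ν 2 μ) : Q.optCost V μ t ξ ν < ∞ := by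
  simp only [optCost, actionCost_feedback]
  have m1 := MemLp.mulVec hξ (Q.C + Q.D * Q.stateGain V t)
  have m2 := MemLp.mulVec hν (Q.E + Q.D * Q.innovGain V t)
  have m3 := MemLp.mulVec hξ (Q.A + Q.B * Q.stateGain V t)
  have m4 := MemLp.mulVec hν (Q.B * Q.innovGain V t)
  have h1 : MemLp (fun ω => (Q.C + Q.D * Q.stateGain V t) *ᵥ ξ ω +
      (Q.E + Q.D * Q.innovGain V t) *ᵥ ν ω) 2 μ := m1.add m2
  have h2 : MemLp (fun ω => (Q.A + Q.B * Q.stateGain V t) *ᵥ ξ ω +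
      (Q.B * Q.innovGain V t) *ᵥ ν ω) 2 μ := m3.add m4
  exact ((integrable_quad h1 (Q.R t)).add (integrable_quad h2 (V (t + 1)))).lintegral_lt_top

/-- The innovation enters through the state and directly; together these are one centred vector `(F
G + F') ν`, independent of `φ`. -/
theorem lintegral_quad_affine {α : Type*} [Fintype α] [IsProbabilityMeasure μ] {M : Matrix α α ℝ}
    (hM : M.PosSemidef) {φ : Ω → ι → ℝ} {ν : Ω → ρ → ℝ} (hφ : Measurable φ) (hνm : Measurable ν)
    (hν : MemLp ν 2 μ) (hmean : meanVec μ ν = 0) (hi : IndepFun φ ν μ) (F : Matrix α ι ℝ)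
    (G : Matrix ι ρ ℝ) (F' : Matrix α ρ ℝ) :
    ∫⁻ ω, ENNReal.ofReal (quad M (F *ᵥ (φ ω + G *ᵥ ν ω) + F' *ᵥ ν ω)) ∂μ =
      ∫⁻ ω, ENNReal.ofReal (quad M (F *ᵥ φ ω)) ∂μ +
      ∫⁻ ω, ENNReal.ofReal (quad M (F *ᵥ (G *ᵥ ν ω) + F' *ᵥ ν ω)) ∂μ := by
  have hY : ∀ ω, F *ᵥ (G *ᵥ ν ω) + F' *ᵥ ν ω = (F * G + F') *ᵥ ν ω := fun ω => by
    rw [Matrix.add_mulVec, Matrix.mulVec_mulVec]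
  have hXY : ∀ ω, F *ᵥ (φ ω + G *ᵥ ν ω) + F' *ᵥ ν ω =
      F *ᵥ φ ω + (F * G + F') *ᵥ ν ω := fun ω => by
    rw [← hY, Matrix.mulVec_add, add_assoc]
  simp only [hXY, hY]
  refine lintegral_quad_add_of_indepFun hM ((measurable_mulVec _).comp hφ)
    ((measurable_mulVec _).comp hνm) (MemLp.mulVec hν _) ?_
    (hi.comp (measurable_mulVec _) (measurable_mulVec _))
  rw [meanVec_mulVec (hν.integrable one_le_two), hmean, Matrix.mulVec_zero]

/-- The optimal cost to go from a state `φ + G ν`, where `ν` is independent of `φ`. -/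
theorem optCost_add [IsProbabilityMeasure μ] (h : Q.IsValue N V) {t : ℕ} (ht : t ≤ N)
    {φ : Ω → ι → ℝ} {ν : Ω → ρ → ℝ} (hφ : Measurable φ) (hνm : Measurable ν) (hν : MemLp ν 2 μ)
    (hmean : meanVec μ ν = 0) (hi : IndepFun φ ν μ) :
    Q.optCost V μ t (fun ω => φ ω + Q.G *ᵥ ν ω) ν =
      ∫⁻ ω, ENNReal.ofReal (quad (V t) (φ ω)) ∂μ + Q.optCost V μ t (fun ω => Q.G *ᵥ ν ω) ν := by
  have hR := h.posSemidef t ht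
  have hV := h.value_posSemidef (Nat.succ_le_succ ht)
  -- Under the feedback, output and next state are linear in state and innovation, so each of the
  -- two quadratic terms splits separately.
  have split : ∀ (ξ : Ω → ι → ℝ) (ν' : Ω → ρ → ℝ), Measurable ξ → Measurable ν' →
      Q.optCost V μ t ξ ν' =
        ∫⁻ ω, ENNReal.ofReal (quad (Q.R t) ((Q.C + Q.D * Q.stateGain V t) *ᵥ ξ ω +
          (Q.E + Q.D * Q.innovGain V t) *ᵥ ν' ω)) ∂μ +
        ∫⁻ ω, ENNReal.ofReal (quad (V (t + 1)) ((Q.A + Q.B * Q.stateGain V t) *ᵥ ξ ω +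
          (Q.B * Q.innovGain V t) *ᵥ ν' ω)) ∂μ := by
    intro ξ ν' hξ hν'
    simp only [optCost, actionCost_feedback]
    rw [← lintegral_add_left]
    · exact lintegral_congr fun ω => ENNReal.ofReal_add (quad_nonneg hR _) (quad_nonneg hV _)
    · exact ((measurable_quad _).comp (((measurable_mulVec _).comp hξ).add
        ((measurable_mulVec _).comp hν'))).ennreal_ofReal
  -- What depends on `φ` is the optimal cost for zero innovation, where the one-step minimum is the
  -- Riccati form.
  have hzero : ∫⁻ ω, ENNReal.ofReal (quad (V t) (φ ω)) ∂μ = Q.optCost V μ t φ 0 := by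
    simp only [optCost, Pi.zero_apply, actionCost_feedback_zero h ht]
  have hG : Measurable fun ω => Q.G *ᵥ ν ω := (measurable_mulVec _).comp hνm
  have hφG : Measurable fun ω => φ ω + Q.G *ᵥ ν ω := hφ.add hG
  rw [hzero, split _ _ hφG hνm, split φ 0 hφ measurable_const, split _ _ hG hνm,
    lintegral_quad_affine hR hφ hνm hν hmean hi, lintegral_quad_affine hV hφ hνm hν hmean hi]
  simp only [Pi.zero_apply, Matrix.mulVec_zero, add_zero]
  exact add_add_add_comm _ _ _ _

/-- State `ξ` and control `e` of the problem that is driven by the innovations `ν`, where `𝒢 t` is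
the information before time `t`. -/
structure IsControlled (Q : LQProblem ι σ κ ρ) (N : ℕ) (𝒢 : ℕ → MeasurableSpace Ω)
    (ν : ℕ → Ω → ρ → ℝ) (ξ : ℕ → Ω → ι → ℝ) (e : ℕ → Ω → σ → ℝ) : Prop where
  succ : ∀ t ω, ξ (t + 1) ω = Q.A *ᵥ ξ t ω + Q.B *ᵥ e t ω + Q.G *ᵥ ν (t + 1) ω
  measurable_state : ∀ t ≤ N, Measurable[𝒢 (t + 1)] (ξ t)
  measurable_control : ∀ t ≤ N, Measurable[𝒢 (t + 1)] (e t)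

/-- A sequence of centred square integrable vectors, each independent of the past. -/
structure IsWhite (μ : Measure Ω) (𝒢 : ℕ → MeasurableSpace Ω) (ν : ℕ → Ω → ρ → ℝ) : Prop where
  le : ∀ t, 𝒢 t ≤ mΩ
  measurable : ∀ t, Measurable[mΩ] (ν t)
  memLp : ∀ t, MemLp (ν t) 2 μ
  mean : ∀ t, meanVec μ (ν t) = 0
  indep : ∀ t, Indep (MeasurableSpace.comap (ν t) inferInstance) (𝒢 t) μ

/-- The expected cost at time `t`. -/
noncomputable def meanCost (Q : LQProblem ι σ κ ρ) (μ : Measure Ω) (ν : ℕ → Ω → ρ → ℝ)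
    (ξ : ℕ → Ω → ι → ℝ) (e : ℕ → Ω → σ → ℝ) (t : ℕ) : ℝ≥0∞ :=
  ∫⁻ ω, ENNReal.ofReal (Q.stageCost t (ξ t ω) (ν t ω) (e t ω)) ∂μ

variable {𝒢 : ℕ → MeasurableSpace Ω} {ν : ℕ → Ω → ρ → ℝ} {ξ : ℕ → Ω → ι → ℝ} {e : ℕ → Ω → σ → ℝ}

theorem lintegral_actionCost (h : Q.IsValue N V) (hν : IsWhite μ 𝒢 ν)
    (hc : Q.IsControlled N 𝒢 ν ξ e) {t : ℕ} (ht : t ≤ N) :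
    ∫⁻ ω, ENNReal.ofReal (Q.actionCost V t (ξ t ω) (ν t ω) (e t ω)) ∂μ =
      Q.meanCost μ ν ξ e t +
        ∫⁻ ω, ENNReal.ofReal (quad (V (t + 1)) (Q.A *ᵥ ξ t ω + Q.B *ᵥ e t ω)) ∂μ := by
  have mξ : Measurable (ξ t) := (hc.measurable_state t ht).mono (hν.le _) le_rfl
  have me : Measurable (e t) := (hc.measurable_control t ht).mono (hν.le _) le_rfl
  rw [meanCost, ← lintegral_add_right]
  · exact lintegral_congr fun ω => ENNReal.ofReal_add (stageCost_nonneg h ht _ _ _)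
      (quad_nonneg (h.value_posSemidef (Nat.succ_le_succ ht)) _)
  · exact ((measurable_quad _).comp (((measurable_mulVec _).comp mξ).add
      ((measurable_mulVec _).comp me))).ennreal_ofReal

/-- The link between successive times: `A ξ_t + B e_t` is known before `ν_{t+1}`, and the second
term on the right does not depend on the control. -/
theorem optCost_succ [IsProbabilityMeasure μ] (h : Q.IsValue N V) (hν : IsWhite μ 𝒢 ν)
    (hc : Q.IsControlled N 𝒢 ν ξ e) {t : ℕ} (ht : t + 1 ≤ N) :
    Q.optCost V μ (t + 1) (ξ (t + 1)) (ν (t + 1)) =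
      ∫⁻ ω, ENNReal.ofReal (quad (V (t + 1)) (Q.A *ᵥ ξ t ω + Q.B *ᵥ e t ω)) ∂μ +
        Q.optCost V μ (t + 1) (fun ω => Q.G *ᵥ ν (t + 1) ω) (ν (t + 1)) := by
  have hm : Measurable[𝒢 (t + 1)] fun ω => Q.A *ᵥ ξ t ω + Q.B *ᵥ e t ω :=
    ((measurable_mulVec _).comp (hc.measurable_state t (by omega))).add
      ((measurable_mulVec _).comp (hc.measurable_control t (by omega)))
  rw [show ξ (t + 1) = fun ω => (Q.A *ᵥ ξ t ω + Q.B *ᵥ e t ω) + Q.G *ᵥ ν (t + 1) ω from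
    funext (hc.succ t)]
  exact optCost_add h ht (hm.mono (hν.le _) le_rfl) (hν.measurable _) (hν.memLp _) (hν.mean _)
    (IndepFun.of_indep (hν.indep (t + 1)).symm hm (comap_measurable _))

/-- The minimal expected cost from the initial state `ξ₀`. -/
noncomputable def optValue (Q : LQProblem ι σ κ ρ) (V : ℕ → Matrix ι ι ℝ) (μ : Measure Ω) (N : ℕ)
    (ν : ℕ → Ω → ρ → ℝ) (ξ₀ : Ω → ι → ℝ) : ℝ≥0∞ :=
  Q.optCost V μ 0 ξ₀ (ν 0) +
    ∑ t ∈ Finset.range N, Q.optCost V μ (t + 1) (fun ω => Q.G *ᵥ ν (t + 1) ω) (ν (t + 1))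

theorem optValue_lt_top (hν : IsWhite μ 𝒢 ν) {ξ₀ : Ω → ι → ℝ} (hξ₀ : MemLp ξ₀ 2 μ) :
    Q.optValue V μ N ν ξ₀ < ∞ :=
  ENNReal.add_lt_top.2 ⟨optCost_lt_top hξ₀ (hν.memLp 0), ENNReal.sum_lt_top.2 fun _ _ =>
    optCost_lt_top (MemLp.mulVec (hν.memLp _) _) (hν.memLp _)⟩

/-- Forward telescoping: at each time the optimal cost to go is at most the actual stage cost plus
the form `V (t + 1)` at the next predicted state. Only additions occur, so infinite costs do no
harm. -/
theorem optValue_le [IsProbabilityMeasure μ] (h : Q.IsValue N V) (hν : IsWhite μ 𝒢 ν)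
    (hc : Q.IsControlled N 𝒢 ν ξ e) :
    Q.optValue V μ N ν (ξ 0) ≤ ∑ t ∈ Finset.range (N + 1), Q.meanCost μ ν ξ e t := by
  have act : ∀ t ≤ N, Q.optCost V μ t (ξ t) (ν t) ≤ Q.meanCost μ ν ξ e t +
      ∫⁻ ω, ENNReal.ofReal (quad (V (t + 1)) (Q.A *ᵥ ξ t ω + Q.B *ᵥ e t ω)) ∂μ := fun t ht => by
    rw [← lintegral_actionCost h hν hc ht]
    exact lintegral_mono fun ω => ENNReal.ofReal_le_ofReal (actionCost_feedback_le h ht _ _ _)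
  -- The horizon of `optValue` grows with `k`, so each step adds the same noise constant on both
  -- sides.
  have main : ∀ k ≤ N, Q.optValue V μ k ν (ξ 0) ≤
      ∑ t ∈ Finset.range k, Q.meanCost μ ν ξ e t + Q.optCost V μ k (ξ k) (ν k) := by
    intro k hk
    induction k with
    | zero => simp [optValue]
    | succ k ih =>
      have := ih (by omega)
      rw [optValue, Finset.sum_range_succ, ← add_assoc, Finset.sum_range_succ,
        optCost_succ h hν hc hk, ← add_assoc]
      refine add_le_add_left (this.trans ?_) _
      rw [add_assoc]
      exact add_le_add_right (act k (by omega)) _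
  refine (main N le_rfl).trans ?_
  rw [Finset.sum_range_succ]
  refine add_le_add_right ((act N le_rfl).trans (le_of_eq ?_)) _
  simp [h.last, quad_zero_matrix]

theorem optValue_eq [IsProbabilityMeasure μ] (h : Q.IsValue N V) (hν : IsWhite μ 𝒢 ν)
    (hc : Q.IsControlled N 𝒢 ν ξ e)
    (he : ∀ t ≤ N, ∀ ω, e t ω = Q.feedback V t (ξ t ω) (ν t ω)) :
    Q.optValue V μ N ν (ξ 0) = ∑ t ∈ Finset.range (N + 1), Q.meanCost μ ν ξ e t := by
  have act : ∀ t ≤ N, Q.optCost V μ t (ξ t) (ν t) = Q.meanCost μ ν ξ e t +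
      ∫⁻ ω, ENNReal.ofReal (quad (V (t + 1)) (Q.A *ᵥ ξ t ω + Q.B *ᵥ e t ω)) ∂μ := fun t ht => by
    rw [← lintegral_actionCost h hν hc ht]
    exact lintegral_congr fun ω => by rw [he t ht]
  have main : ∀ k ≤ N, Q.optValue V μ k ν (ξ 0) =
      ∑ t ∈ Finset.range k, Q.meanCost μ ν ξ e t + Q.optCost V μ k (ξ k) (ν k) := by
    intro k hk
    induction k with
    | zero => simp [optValue]
    | succ k ih =>
      have := ih (by omega)
      rw [optValue] at this
      rw [optValue, Finset.sum_range_succ, ← add_assoc, this, Finset.sum_range_succ,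
        optCost_succ h hν hc hk, act k (by omega)]
      simp only [add_assoc]
  rw [main N le_rfl, Finset.sum_range_succ, act N le_rfl]
  simp [h.last, quad_zero_matrix]

end LQProblem

/-! ### Measurability and integrability of the trajectories -/

/-- A property of random vectors that holds for the constant ones and is stable under affine
combinations. -/
structure IsAffineClass {Ω : Type*} (Φ : (k : Type) → [Fintype k] → (Ω → k → ℝ) → Prop) :
    Prop where
  const : ∀ (k : Type) [Fintype k] (c : k → ℝ), Φ k fun _ => c
  add : ∀ {k : Type} [Fintype k] {X Y : Ω → k → ℝ}, Φ k X → Φ k Y → Φ k fun ω => X ω + Y ω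
  mulVec : ∀ {k l : Type} [Fintype k] [Fintype l] (M : Matrix l k ℝ) {X : Ω → k → ℝ}, Φ k X →
    Φ l fun ω => M *ᵥ X ω

theorem isAffineClass_measurable {Ω : Type*} (m : MeasurableSpace Ω) :
    IsAffineClass fun (k : Type) [Fintype k] (X : Ω → k → ℝ) => Measurable[m] X where
  const _ _ _ := measurable_const
  add hX hY := hX.add hY
  mulVec M _ hX := (measurable_mulVec M).comp hX

theorem isAffineClass_memLp {Ω : Type*} {mΩ : MeasurableSpace Ω} (μ : Measure Ω)
    [IsFiniteMeasure μ] :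
    IsAffineClass fun (k : Type) [Fintype k] (X : Ω → k → ℝ) => MemLp X 2 μ where
  const _ _ c := memLp_const c
  add hX hY := hX.add hY
  mulVec M _ hX := MemLp.mulVec hX M

namespace CPS

variable {n m p s : ℕ} (S : CPS n m p s) (q : Vec n × Vec n) (e : ℕ → Vec s) (w : ℕ → Vec n)
  (v : ℕ → Vec p)

/-- The projection of `ξ` to its first component. -/
noncomputable def projEst (_S : CPS n m p s) : Matrix (Fin n) (XiIdx n) ℝ :=
  Matrix.fromCols 1 (Matrix.fromCols 0 (Matrix.fromCols 0 0))

theorem attEst_eq_xi (xstar : Vec n) (t : ℕ) :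
    S.attEst q e w v t = S.projEst *ᵥ S.xi xstar q e w v t := by
  simp only [projEst, xi, Matrix.fromCols_mulVec_sumElim, Matrix.one_mulVec, Matrix.zero_mulVec,
    add_zero]

/-- The first block of `ξ_{t+1}` is the prediction plus `K ν_{t+1}`; cancelling the innovation
leaves a function of `ξ_t` and `e_t`. -/
theorem attPred_succ_eq_xi (xstar : Vec n) (t : ℕ) : S.attPred q e w v (t + 1) =
    S.projEst *ᵥ (S.calA *ᵥ S.xi xstar q e w v t + S.calB *ᵥ e t) := by
  have h1 : S.projEst *ᵥ (S.calG *ᵥ S.innov (q.1 - q.2) w v (t + 1)) =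
      S.K *ᵥ S.innov (q.1 - q.2) w v (t + 1) := by
    simp only [projEst, calG, Matrix.fromRows_mulVec, Matrix.fromCols_mulVec_sumElim,
      Matrix.one_mulVec, Matrix.zero_mulVec, add_zero]
  have h2 := attEst_eq_xi S q e w v xstar (t + 1)
  rw [xi_succ, Matrix.mulVec_add, h1, attEst, attInnov_eq] at h2
  exact add_right_cancel h2

theorem xi_zero_eq (xstar : Vec n) : S.xi xstar q e w v 0 =
    Matrix.fromRows 1 (Matrix.fromRows 0 (Matrix.fromRows 1 0)) *ᵥ
      (q.2 + S.K *ᵥ S.innov (q.1 - q.2) w v 0) +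
        Sum.elim (0 : Vec n) (Sum.elim (0 : ThetaIdx n → ℝ) (Sum.elim (0 : Vec n) xstar)) := by
  simp only [xi_zero, Matrix.fromRows_mulVec, Matrix.one_mulVec, Matrix.zero_mulVec,
    ← Sum.elim_add_add, add_zero, zero_add]

end CPS

namespace RandomCPS

variable {n m p s : ℕ} {Ω : Type*} (D : RandomCPS n p Ω) (S : CPS n m p s)

/-- The innovations of the attacker's filter, which do not depend on the attack. -/
noncomputable def innov (t : ℕ) (ω : Ω) : Vec p :=
  S.innov (D.x 0 ω - D.z 0 ω) (D.wPos ω) (D.vPos ω) t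

/-- The prediction error of the attacker's filter. -/
noncomputable def predErr (t : ℕ) (ω : Ω) : Vec n :=
  S.err (D.x 0 ω - D.z 0 ω) (D.wPos ω) (D.vPos ω) t

/-- The estimation error of the attacker's filter. -/
noncomputable def estErr (t : ℕ) (ω : Ω) : Vec n :=
  S.ferr (D.x 0 ω - D.z 0 ω) (D.wPos ω) (D.vPos ω) t

variable {D S} {e : ℕ → Ω → Vec s} {xstar : Vec n}
  {Φ : (k : Type) → [Fintype k] → (Ω → k → ℝ) → Prop}

/-- `ξ_t` is an affine function of `z_0`, `ν_0, …, ν_t` and `e_0, …, e_{t-1}`. The class `Φ` stands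
for measurability with respect to some σ-algebra or for square integrability. -/
theorem xi_mem (hΦ : IsAffineClass Φ) {t : ℕ} (hz : Φ (Fin n) (D.z 0))
    (hν : ∀ j ≤ t, Φ (Fin p) (D.innov S j)) (he : ∀ j < t, Φ (Fin s) (e j)) :
    Φ (CPS.XiIdx n) (D.xi S xstar e t) := by
  induction t with
  | zero =>
    have h : D.xi S xstar e 0 = fun ω => _ := funext fun ω =>
      CPS.xi_zero_eq S (D.q0 ω) (path e ω) (D.wPos ω) (D.vPos ω) xstar
    rw [h]
    exact hΦ.add (hΦ.mulVec _ (hΦ.add hz (hΦ.mulVec _ (hν 0 le_rfl)))) (hΦ.const _ _)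
  | succ t ih =>
    have h : D.xi S xstar e (t + 1) = fun ω => _ := funext fun ω =>
      CPS.xi_succ S (D.q0 ω) (path e ω) (D.wPos ω) (D.vPos ω) xstar t
    rw [h]
    have h1 := ih (fun j hj => hν j (hj.trans t.le_succ)) fun j hj => he j (hj.trans t.lt_succ_self)
    exact hΦ.add (hΦ.add (hΦ.mulVec _ h1) (hΦ.mulVec _ (he t t.lt_succ_self)))
      (hΦ.mulVec _ (hν _ le_rfl))

theorem attPred_mem (hΦ : IsAffineClass Φ) {t : ℕ} (hz : Φ (Fin n) (D.z 0))
    (hν : ∀ j < t, Φ (Fin p) (D.innov S j)) (he : ∀ j < t, Φ (Fin s) (e j)) :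
    Φ (Fin n) (D.attPred S e t) := by
  cases t with
  | zero => exact hz
  | succ t =>
    have h : D.attPred S e (t + 1) = fun ω => _ := funext fun ω =>
      CPS.attPred_succ_eq_xi S (D.q0 ω) (path e ω) (D.wPos ω) (D.vPos ω) 0 t
    rw [h]
    have h1 : Φ (CPS.XiIdx n) (D.xi S 0 e t) :=
      xi_mem hΦ hz (fun j hj => hν j (Nat.lt_succ_of_le hj)) fun j hj =>
        he j (hj.trans t.lt_succ_self)
    exact hΦ.mulVec _ (hΦ.add (hΦ.mulVec _ h1) (hΦ.mulVec _ (he t t.lt_succ_self)))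

theorem attEst_mem (hΦ : IsAffineClass Φ) {t : ℕ} (hz : Φ (Fin n) (D.z 0))
    (hν : ∀ j ≤ t, Φ (Fin p) (D.innov S j)) (he : ∀ j < t, Φ (Fin s) (e j)) :
    Φ (Fin n) (D.attEst S e t) := by
  have h : D.attEst S e t = fun ω => _ := funext fun ω =>
    CPS.attEst_eq_xi S (D.q0 ω) (path e ω) (D.wPos ω) (D.vPos ω) 0 t
  rw [h]
  exact hΦ.mulVec _ (xi_mem hΦ hz hν he)

theorem ytilde_mem (hΦ : IsAffineClass Φ) {t : ℕ} (hz : Φ (Fin n) (D.z 0))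
    (hν : ∀ j ≤ t, Φ (Fin p) (D.innov S j)) (he : ∀ j < t, Φ (Fin s) (e j)) :
    Φ (Fin p) (D.ytilde S e t) := by
  have h : D.ytilde S e t = fun ω => _ := funext fun ω =>
    CPS.ytilde_eq S (D.q0 ω) (path e ω) (D.wPos ω) (D.vPos ω) t
  rw [h]
  exact hΦ.add (hΦ.mulVec _ (attPred_mem hΦ hz (fun j hj => hν j hj.le) he)) (hν t le_rfl)

/-- The innovations can be computed from the measurements and the attack. -/
theorem innov_mem (hΦ : IsAffineClass Φ) {t : ℕ} (hz : Φ (Fin n) (D.z 0))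
    (hy : ∀ j ≤ t, Φ (Fin p) (D.ytilde S e j)) (he : ∀ j < t, Φ (Fin s) (e j)) :
    Φ (Fin p) (D.innov S t) := by
  -- `ν_t` is `ỹ_t` minus `C` times a prediction that involves only earlier innovations and attacks.
  induction t using Nat.strong_induction_on with
  | _ t ih =>
    have h : D.innov S t = fun ω => D.ytilde S e t ω + (-S.C) *ᵥ D.attPred S e t ω := by
      funext ω
      have := CPS.ytilde_eq S (D.q0 ω) (path e ω) (D.wPos ω) (D.vPos ω) t
      rw [Matrix.neg_mulVec, ytilde, this, attPred, innov, q0]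
      abel
    rw [h]
    refine hΦ.add (hy t le_rfl) (hΦ.mulVec _ (attPred_mem hΦ hz (fun j hj => ?_) he))
    exact ih j hj (fun i hi => hy i (hi.trans hj.le)) fun i hi => he i (hi.trans hj)

end RandomCPS

namespace RandomCPS

variable {n m p s : ℕ} {Ω : Type*} {mΩ : MeasurableSpace Ω} {μ : Measure Ω}
  {S : CPS n m p s} {D : RandomCPS n p Ω}

/-! ### The information of the attacker -/

/-- The information in the measurements before time `0`, the prediction of the state at time `0`,
and the innovations before time `t`. -/
@[reducible] noncomputable def past (D : RandomCPS n p Ω) (S : CPS n m p s) (t : ℕ) :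
    MeasurableSpace Ω :=
  S.innovInfo (D.initInfo S) (fun ω => D.x 0 ω - D.z 0 ω) (fun k => D.w k) (fun k => D.v k) t

theorem isSteady_predErr [IsProbabilityMeasure μ] (hS : S.Standing) (hD : D.IsModel S μ) (t : ℕ) :
    S.IsSteady μ (D.predErr S t) (D.past S t) (D.futureInfo t) ∧
      S.IsInnovation μ (D.innov S t) (D.estErr S t) (D.past S t) := by
  have hn : S.IsNoise μ (fun k : ℕ => D.w k) (fun k : ℕ => D.v k)
      (fun k : ℕ => D.futureInfo k) := by
    simpa using isNoise hS hD 0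
  have h0 : S.IsSteady μ (fun ω => D.x 0 ω - D.z 0 ω) (D.initInfo S) (D.futureInfo (0 : ℕ)) :=
    isSteady_zero hS hD
  exact h0.innovations (𝒩 := fun k : ℕ => D.futureInfo k) hS hn t

theorem isWhite_innov [IsProbabilityMeasure μ] (hS : S.Standing) (hD : D.IsModel S μ) :
    LQProblem.IsWhite μ (D.past S) (D.innov S) where
  le t := (isSteady_predErr hS hD t).1.le
  measurable t := (isSteady_predErr hS hD t).2.measurable_innov
  memLp t := (isSteady_predErr hS hD t).2.memLp_innov
  mean t := (isSteady_predErr hS hD t).2.mean_innov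
  indep t := (isSteady_predErr hS hD t).2.indep_innov

theorem measurable_innov_past {k t : ℕ} (h : k < t) : Measurable[D.past S t] (D.innov S k) :=
  CPS.measurable_innov_innovInfo h

theorem past_mono : Monotone (D.past S) := CPS.innovInfo_mono

theorem measurable_z_past (t : ℕ) : Measurable[D.past S t] (D.z 0) :=
  (comap_measurable (D.z 0)).mono (le_sup_right.trans (past_mono (Nat.zero_le t))) le_rfl

variable {e : ℕ → Ω → Vec s} {xstar : Vec n} {N : ℕ}

theorem measurable_xi_past {t : ℕ} (he : ∀ j < t, Measurable[D.past S (j + 1)] (e j)) :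
    Measurable[D.past S (t + 1)] (D.xi S xstar e t) :=
  xi_mem (isAffineClass_measurable (D.past S (t + 1))) (measurable_z_past _)
    (fun _ hj => measurable_innov_past (Nat.lt_succ_of_le hj))
    fun j hj => (he j hj).mono (past_mono (by omega)) le_rfl

theorem measurable_ytilde_past {t : ℕ} (he : ∀ j < t, Measurable[D.past S (j + 1)] (e j)) :
    Measurable[D.past S (t + 1)] (D.ytilde S e t) :=
  ytilde_mem (isAffineClass_measurable (D.past S (t + 1))) (measurable_z_past _)
    (fun _ hj => measurable_innov_past (Nat.lt_succ_of_le hj))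
    fun j hj => (he j hj).mono (past_mono (by omega)) le_rfl

theorem priorInfo_le_past {t : ℕ} (he : ∀ j < t, Measurable[D.past S (j + 1)] (e j)) :
    D.priorInfo S e t ≤ D.past S t := by
  refine sup_le (sup_le (past_mono (Nat.zero_le t)) (iSup₂_le fun j hj => ?_))
    (iSup₂_le fun j hj => ?_)
  · exact (measurable_ytilde_past fun i hi => he i (hi.trans hj)).comap_le.trans (past_mono hj)
  · exact (he j hj).comap_le.trans (past_mono hj)

theorem info_le_past {t : ℕ} (he : ∀ j < t, Measurable[D.past S (j + 1)] (e j)) :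
    D.info S e t ≤ D.past S (t + 1) :=
  sup_le ((priorInfo_le_past he).trans (past_mono t.le_succ)) (measurable_ytilde_past he).comap_le

/-- The information `I_t` depends on the attack, but only on its earlier values. By induction these
are functions of the innovations, so `I_t` lies in a filtration common to all attacks. -/
theorem Admissible.measurable_past (he : D.Admissible S N e) {t : ℕ} (ht : t ≤ N) :
    Measurable[D.past S (t + 1)] (e t) := by
  induction t using Nat.strong_induction_on with
  | _ t ih =>
    exact (he t ht).mono (info_le_past fun j hj => ih j hj (hj.le.trans ht)) le_rfl

theorem measurable_z_priorInfo (t : ℕ) : Measurable[D.priorInfo S e t] (D.z 0) :=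
  (comap_measurable (D.z 0)).mono
    (le_sup_right.trans (le_sup_left.trans le_sup_left)) le_rfl

theorem measurable_ytilde_priorInfo {j t : ℕ} (h : j < t) :
    Measurable[D.priorInfo S e t] (D.ytilde S e j) :=
  (comap_measurable (D.ytilde S e j)).mono
    ((le_iSup₂ (f := fun j (_ : j < t) => MeasurableSpace.comap (D.ytilde S e j) inferInstance)
      j h).trans (le_sup_right.trans le_sup_left)) le_rfl

theorem measurable_control_priorInfo {j t : ℕ} (h : j < t) :
    Measurable[D.priorInfo S e t] (e j) :=
  (comap_measurable (e j)).mono ((le_iSup₂ (f := fun j (_ : j < t) =>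
    MeasurableSpace.comap (e j) inferInstance) j h).trans le_sup_right) le_rfl

theorem measurable_innov_priorInfo {j t : ℕ} (h : j < t) :
    Measurable[D.priorInfo S e t] (D.innov S j) :=
  innov_mem (isAffineClass_measurable (D.priorInfo S e t)) (measurable_z_priorInfo t)
    (fun _ hi => measurable_ytilde_priorInfo (hi.trans_lt h))
    fun _ hi => measurable_control_priorInfo (hi.trans h)

theorem measurable_attPred_priorInfo (t : ℕ) :
    Measurable[D.priorInfo S e t] (D.attPred S e t) :=
  attPred_mem (isAffineClass_measurable (D.priorInfo S e t)) (measurable_z_priorInfo t)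
    (fun _ hi => measurable_innov_priorInfo hi) fun _ hi => measurable_control_priorInfo hi

theorem measurable_innov_info {j t : ℕ} (h : j ≤ t) : Measurable[D.info S e t] (D.innov S j) := by
  refine innov_mem (isAffineClass_measurable (D.info S e t))
    ((measurable_z_priorInfo t).mono le_sup_left le_rfl) (fun i hi => ?_)
    fun i hi => (measurable_control_priorInfo (hi.trans_le h)).mono le_sup_left le_rfl
  rcases (hi.trans h).lt_or_eq with hlt | rfl
  · exact (measurable_ytilde_priorInfo hlt).mono le_sup_left le_rfl
  · exact (comap_measurable _).mono le_sup_right le_rfl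

theorem measurable_xi_info (t : ℕ) : Measurable[D.info S e t] (D.xi S xstar e t) :=
  xi_mem (isAffineClass_measurable (D.info S e t))
    ((measurable_z_priorInfo t).mono le_sup_left le_rfl) (fun _ hi => measurable_innov_info hi)
    fun _ hi => (measurable_control_priorInfo hi).mono le_sup_left le_rfl

theorem measurable_attEst_info (t : ℕ) : Measurable[D.info S e t] (D.attEst S e t) :=
  attEst_mem (isAffineClass_measurable (D.info S e t))
    ((measurable_z_priorInfo t).mono le_sup_left le_rfl) (fun _ hi => measurable_innov_info hi)
    fun _ hi => (measurable_control_priorInfo hi).mono le_sup_left le_rfl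

/-! ### Linear feedback -/

theorem attInnov_eq_innov (t : ℕ) : D.attInnov S e t = D.innov S t :=
  funext fun ω => CPS.attInnov_eq S (D.q0 ω) (path e ω) (D.wPos ω) (D.vPos ω) t

variable {Lg : ℕ → Matrix (Fin s) (CPS.XiIdx n) ℝ} {Og : ℕ → Matrix (Fin s) (Fin p) ℝ}

theorem IsLinearFeedback.eq_fun (h : D.IsLinearFeedback S N xstar Lg Og e) {t : ℕ} (ht : t ≤ N) :
    e t = fun ω => Lg t *ᵥ D.xi S xstar e t ω + Og t *ᵥ D.innov S t ω := by
  funext ω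
  rw [h t ht ω, attInnov_eq_innov]

theorem IsLinearFeedback.admissible (h : D.IsLinearFeedback S N xstar Lg Og e) :
    D.Admissible S N e := by
  intro t ht
  rw [h.eq_fun ht]
  exact ((measurable_mulVec (Lg t)).comp (measurable_xi_info t)).add
    ((measurable_mulVec (Og t)).comp (measurable_innov_info le_rfl))

/-- The vectors `ξ_t` under linear feedback. -/
noncomputable def feedbackXi (D : RandomCPS n p Ω) (S : CPS n m p s) (xstar : Vec n)
    (Lg : ℕ → Matrix (Fin s) (CPS.XiIdx n) ℝ) (Og : ℕ → Matrix (Fin s) (Fin p) ℝ) :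
    ℕ → Ω → CPS.XiIdx n → ℝ
  | 0 => D.xi S xstar 0 0
  | t + 1 => fun ω => S.calA *ᵥ feedbackXi D S xstar Lg Og t ω
      + S.calB *ᵥ (Lg t *ᵥ feedbackXi D S xstar Lg Og t ω + Og t *ᵥ D.innov S t ω)
      + S.calG *ᵥ D.innov S (t + 1) ω

/-- The feedback law refers to `ξ_t`, which depends on the attack. The closed loop driven by the
attack-independent innovations removes the circularity: it defines the attack, and its state is then
shown to be the `ξ_t` of this attack. -/
theorem exists_isLinearFeedback (D : RandomCPS n p Ω) (S : CPS n m p s) (N : ℕ) (xstar : Vec n)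
    (Lg : ℕ → Matrix (Fin s) (CPS.XiIdx n) ℝ) (Og : ℕ → Matrix (Fin s) (Fin p) ℝ) :
    ∃ e : ℕ → Ω → Vec s, D.IsLinearFeedback S N xstar Lg Og e := by
  let e : ℕ → Ω → Vec s := fun t ω => Lg t *ᵥ D.feedbackXi S xstar Lg Og t ω
    + Og t *ᵥ D.innov S t ω
  have hxi : ∀ t ω, D.xi S xstar e t ω = D.feedbackXi S xstar Lg Og t ω := by
    intro t ω
    induction t with
    | zero =>
      rw [feedbackXi, xi, xi, CPS.xi_zero, CPS.xi_zero]
    | succ t ih =>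
      have h := CPS.xi_succ S (D.q0 ω) (path e ω) (D.wPos ω) (D.vPos ω) xstar t
      rw [xi] at ih
      rw [xi, h, ih]
      rfl
  exact ⟨e, fun t _ ω => by rw [hxi, attInnov_eq_innov]⟩

theorem memLp_z [IsProbabilityMeasure μ] (hS : S.Standing) (hD : D.IsModel S μ) :
    MemLp (D.z 0) 2 μ := by
  simpa [pastState] using (pastState_moments hS hD 0).2.2

theorem IsLinearFeedback.memLp [IsProbabilityMeasure μ] (hS : S.Standing) (hD : D.IsModel S μ)
    (h : D.IsLinearFeedback S N xstar Lg Og e) {t : ℕ} (ht : t ≤ N) : MemLp (e t) 2 μ := by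
  have hΦ := isAffineClass_memLp μ
  have hν := (isWhite_innov hS hD).memLp
  induction t using Nat.strong_induction_on with
  | _ t ih =>
    have hξ : MemLp (D.xi S xstar e t) 2 μ := xi_mem hΦ (memLp_z hS hD) (fun j _ => hν j)
      fun j hj => ih j hj (hj.le.trans ht)
    rw [h.eq_fun ht]
    exact hΦ.add (hΦ.mulVec (Lg t) hξ) (hΦ.mulVec (Og t) (hν t))

/-! ### Minimum mean square error estimates -/

theorem condExp_add_of_indep [IsProbabilityMeasure μ] {X Y : Ω → Vec n} {ℱ : MeasurableSpace Ω}
    (hℱ : ℱ ≤ mΩ) (hX : Measurable[ℱ] X) (hXi : Integrable X μ) (hY : Measurable[mΩ] Y)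
    (hYi : Integrable Y μ) (hmean : meanVec μ Y = 0)
    (hi : Indep (MeasurableSpace.comap Y inferInstance) ℱ μ) :
    X =ᵐ[μ] μ[fun ω => X ω + Y ω | ℱ] := by
  have h1 : μ[X | ℱ] = X := condExp_of_stronglyMeasurable hℱ hX.stronglyMeasurable hXi
  have h2 : μ[Y | ℱ] =ᵐ[μ] fun _ => μ[Y] :=
    condExp_indep_eq hY.comap_le hℱ (comap_measurable Y).stronglyMeasurable hi
  have h3 : μ[Y] = 0 := by
    funext i
    rw [eval_integral fun i => hYi.eval i]
    exact congrFun hmean i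
  have h4 : μ[fun ω => X ω + Y ω | ℱ] =ᵐ[μ] μ[X | ℱ] + μ[Y | ℱ] := condExp_add hXi hYi ℱ
  filter_upwards [h2, h4] with ω h2 h4
  rw [h4, Pi.add_apply, h1, h2, h3, add_zero]

/-- The state is the attacker's prediction (or estimate) plus an error that is centred and
independent of the information. Integrability of the attack is needed only to make the estimates
integrable. -/
theorem isMMSE_of_admissible [IsProbabilityMeasure μ] (hS : S.Standing) (hD : D.IsModel S μ)
    (hA : D.Admissible S N e) (hL : ∀ t ≤ N, MemLp (e t) 2 μ) : D.IsMMSE S μ N e := by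
  intro t ht
  have hΦ := isAffineClass_memLp μ
  have hν := (isWhite_innov hS hD).memLp
  obtain ⟨hst, hin⟩ := isSteady_predErr hS hD t
  have hpast : ∀ j < t, Measurable[D.past S (j + 1)] (e j) := fun j hj =>
    hA.measurable_past (hj.le.trans ht)
  have he : ∀ j < t, MemLp (e j) 2 μ := fun j hj => hL j (hj.le.trans ht)
  have hle := priorInfo_le_past hpast
  have hle' := info_le_past hpast
  have hmΩ := (isWhite_innov hS hD).le
  constructor
  · have h : D.state S e t = fun ω => D.attPred S e t ω + D.predErr S t ω := funext fun ω =>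
      CPS.run_fst_eq S (D.q0 ω) (path e ω) (D.wPos ω) (D.vPos ω) t
    have hm : MemLp (D.attPred S e t) 2 μ :=
      attPred_mem hΦ (memLp_z hS hD) (fun j _ => hν j) he
    rw [h]
    exact condExp_add_of_indep (hle.trans (hmΩ t)) (measurable_attPred_priorInfo t)
      (hm.integrable one_le_two) hst.err.measurable
      (hst.err.gaussian.memLp_two.integrable one_le_two) hst.err.mean
      (hst.indep_err.mono le_rfl hle)
  · have h : D.state S e t = fun ω => D.attEst S e t ω + D.estErr S t ω := funext fun ω =>
      CPS.state_eq S (D.q0 ω) (path e ω) (D.wPos ω) (D.vPos ω) t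
    have hm : MemLp (D.attEst S e t) 2 μ :=
      attEst_mem hΦ (memLp_z hS hD) (fun j _ => hν j) he
    rw [h]
    exact condExp_add_of_indep (hle'.trans (hmΩ _)) (measurable_attEst_info t)
      (hm.integrable one_le_two) hin.measurable_ferr
      (hin.memLp_ferr.integrable one_le_two) hin.mean_ferr
      (hin.indep_ferr.mono le_rfl hle')

end RandomCPS

/-! ### The two costs as linear-quadratic problems -/

theorem lintegral_ofReal_sum_quad {Ω κ : Type*} {mΩ : MeasurableSpace Ω} {μ : Measure Ω} [Fintype κ]
    (N : ℕ) {M : ℕ → Matrix κ κ ℝ} (hM : ∀ t ≤ N, (M t).PosSemidef) {Y : ℕ → Ω → κ → ℝ}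
    (hY : ∀ t ≤ N, Measurable (Y t)) :
    ∫⁻ ω, ENNReal.ofReal (∑ t ∈ Finset.range (N + 1), Y t ω ⬝ᵥ (M t *ᵥ Y t ω)) ∂μ =
      ∑ t ∈ Finset.range (N + 1), ∫⁻ ω, ENNReal.ofReal (quad (M t) (Y t ω)) ∂μ := by
  rw [← lintegral_finsetSum']
  · refine lintegral_congr fun ω => ENNReal.ofReal_sum_of_nonneg fun t ht => ?_
    exact quad_nonneg (hM t (Finset.mem_range_succ_iff.1 ht)) _
  · intro t ht
    exact ((measurable_quad _).comp
      (hY t (Finset.mem_range_succ_iff.1 ht))).ennreal_ofReal.aemeasurable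

/-- The detection problem. -/
noncomputable def CPS.detLQ {n m p s : ℕ} (S : CPS n m p s) (R : ℕ → Matrix (Fin p) (Fin p) ℝ) :
    LQProblem (CPS.XiIdx n) (Fin s) (Fin p) (Fin p) :=
  ⟨S.calA, S.calB, S.calG, S.Ctilde, S.Ψ, 1, R⟩

/-- The control problem. -/
noncomputable def CPS.ctrlLQ {n m p s : ℕ} (S : CPS n m p s) (Q : ℕ → Matrix (Fin n) (Fin n) ℝ) :
    LQProblem (CPS.XiIdx n) (Fin s) (Fin n) (Fin p) :=
  ⟨S.calA, S.calB, S.calG, S.calH, 0, 0, Q⟩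

namespace RandomCPS

variable {n m p s : ℕ} {Ω : Type*} {mΩ : MeasurableSpace Ω} {μ : Measure Ω}
  {S : CPS n m p s} {D : RandomCPS n p Ω} {e : ℕ → Ω → Vec s} {xstar : Vec n} {N : ℕ}

theorem Admissible.isControlled (he : D.Admissible S N e) {κ : Type*} (C : Matrix κ (CPS.XiIdx n) ℝ)
    (F : Matrix κ (Fin s) ℝ) (E : Matrix κ (Fin p) ℝ) (R : ℕ → Matrix κ κ ℝ) :
    (LQProblem.mk S.calA S.calB S.calG C F E R).IsControlled N (D.past S) (D.innov S)
      (D.xi S xstar e) e where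
  succ t ω := CPS.xi_succ S (D.q0 ω) (path e ω) (D.wPos ω) (D.vPos ω) xstar t
  measurable_state _ ht := measurable_xi_past fun _ hj => he.measurable_past (hj.le.trans ht)
  measurable_control _ ht := he.measurable_past ht

theorem xi_zero_eq_xi_zero (e' : ℕ → Ω → Vec s) : D.xi S xstar e 0 = D.xi S xstar e' 0 := by
  funext ω
  rw [xi, xi, CPS.xi_zero, CPS.xi_zero]

/-- The optimality of linear feedback for a cost that is, up to a constant, that of a
linear-quadratic problem. -/
theorem isOptimal_of_isValue [IsProbabilityMeasure μ] (hS : S.Standing) (hD : D.IsModel S μ)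
    {κ : Type*} [Fintype κ] {C : Matrix κ (CPS.XiIdx n) ℝ}
    {F : Matrix κ (Fin s) ℝ} {E : Matrix κ (Fin p) ℝ} {R : ℕ → Matrix κ κ ℝ}
    {V : ℕ → Matrix (CPS.XiIdx n) (CPS.XiIdx n) ℝ}
    (hV : (LQProblem.mk S.calA S.calB S.calG C F E R).IsValue N V)
    {Lg : ℕ → Matrix (Fin s) (CPS.XiIdx n) ℝ} {Og : ℕ → Matrix (Fin s) (Fin p) ℝ}
    (hLg : ∀ t ≤ N, Lg t = (LQProblem.mk S.calA S.calB S.calG C F E R).stateGain V t)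
    (hOg : ∀ t ≤ N, Og t = (LQProblem.mk S.calA S.calB S.calG C F E R).innovGain V t)
    {cost : (ℕ → Ω → Vec s) → ℝ≥0∞} {c : ℝ≥0∞} (hc : c < ∞)
    (hcost : ∀ e, D.Admissible S N e → cost e = ∑ t ∈ Finset.range (N + 1),
      (LQProblem.mk S.calA S.calB S.calG C F E R).meanCost μ (D.innov S) (D.xi S xstar e) e t + c)
    (he : D.IsLinearFeedback S N xstar Lg Og e) : D.IsOptimal S N cost e := by
  have hw := isWhite_innov hS hD
  have hA := he.admissible
  have heq := LQProblem.optValue_eq hV hw (hA.isControlled (xstar := xstar) C F E R)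
    fun t ht ω => by rw [he.eq_fun ht, LQProblem.feedback, hLg t ht, hOg t ht]
  have hξ : MemLp (D.xi S xstar e 0) 2 μ :=
    xi_mem (isAffineClass_memLp μ) (memLp_z hS hD) (fun j _ => hw.memLp j)
      fun j hj => absurd hj j.not_lt_zero
  refine ⟨hA, ?_, fun e' he' => ?_⟩
  · rw [hcost e hA, ← heq]
    exact ENNReal.add_lt_top.2 ⟨LQProblem.optValue_lt_top hw hξ, hc⟩
  -- The state `ξ_0` does not depend on the attack, so all attacks are compared with the same
  -- optimal value.
  · rw [hcost e hA, hcost e' he', ← heq, xi_zero_eq_xi_zero e']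
    exact add_le_add_left (LQProblem.optValue_le hV hw (he'.isControlled C F E R)) c

theorem detCost_eq [IsProbabilityMeasure μ] (hS : S.Standing) (hD : D.IsModel S μ)
    {R : ℕ → Matrix (Fin p) (Fin p) ℝ} (hR : ∀ t ≤ N, (R t).PosSemidef) (he : D.Admissible S N e) :
    D.detCost S μ N R e = ∑ t ∈ Finset.range (N + 1),
      (S.detLQ R).meanCost μ (D.innov S) (D.xi S xstar e) e t := by
  have hw := isWhite_innov hS hD
  have hc := he.isControlled (xstar := xstar) S.Ctilde S.Ψ 1 R
  have hY : ∀ t, D.sysInnov S e t = fun ω => S.Ctilde *ᵥ D.xi S xstar e t ω + S.Ψ *ᵥ e t ω +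
      (1 : Matrix (Fin p) (Fin p) ℝ) *ᵥ D.innov S t ω := fun t => funext fun ω => by
    rw [Matrix.one_mulVec]
    exact CPS.sysInnov_eq_xi S (D.q0 ω) (path e ω) (D.wPos ω) (D.vPos ω) xstar t
  rw [detCost, lintegral_ofReal_sum_quad N hR]
  · simp only [hY]
    rfl
  · intro t ht
    rw [hY]
    exact (((measurable_mulVec _).comp ((hc.measurable_state t ht).mono (hw.le _) le_rfl)).add
      ((measurable_mulVec _).comp ((hc.measurable_control t ht).mono (hw.le _) le_rfl))).add
      ((measurable_mulVec _).comp (hw.measurable t))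

/-- The filtered error is centred and independent of the past including `ν_t`, hence of `ℋ ξ_t`. It
contributes a sum that is the same for all attacks. -/
theorem ctrlCost_eq [IsProbabilityMeasure μ] (hS : S.Standing) (hD : D.IsModel S μ)
    {Q : ℕ → Matrix (Fin n) (Fin n) ℝ} (hQ : ∀ t ≤ N, (Q t).PosSemidef) (he : D.Admissible S N e) :
    D.ctrlCost S μ N xstar Q e = ∑ t ∈ Finset.range (N + 1),
      (S.ctrlLQ Q).meanCost μ (D.innov S) (D.xi S xstar e) e t +
      ∑ t ∈ Finset.range (N + 1), ∫⁻ ω, ENNReal.ofReal (quad (Q t) (D.estErr S t ω)) ∂μ := by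
  have hw := isWhite_innov hS hD
  have hc := he.isControlled (xstar := xstar) S.calH 0 0 Q
  have hY : ∀ t, (fun ω => D.state S e t ω - xstar) =
      fun ω => S.calH *ᵥ D.xi S xstar e t ω + D.estErr S t ω := fun t => funext fun ω =>
    CPS.state_sub_eq_xi S (D.q0 ω) (path e ω) (D.wPos ω) (D.vPos ω) xstar t
  have hm : ∀ t ≤ N, Measurable[D.past S (t + 1)] fun ω => S.calH *ᵥ D.xi S xstar e t ω :=
    fun t ht => (measurable_mulVec _).comp (hc.measurable_state t ht)
  rw [ctrlCost, lintegral_ofReal_sum_quad N hQ, ← Finset.sum_add_distrib]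
  · refine Finset.sum_congr rfl fun t ht => ?_
    have ht' := Finset.mem_range_succ_iff.1 ht
    have hin := (isSteady_predErr hS hD t).2
    have h := lintegral_quad_add_of_indepFun (hQ t ht') ((hm t ht').mono (hw.le _) le_rfl)
      hin.measurable_ferr hin.memLp_ferr hin.mean_ferr
      (IndepFun.of_indep hin.indep_ferr.symm (hm t ht') (comap_measurable _))
    have hmean : (S.ctrlLQ Q).meanCost μ (D.innov S) (D.xi S xstar e) e t =
        ∫⁻ ω, ENNReal.ofReal (quad (Q t) (S.calH *ᵥ D.xi S xstar e t ω)) ∂μ := by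
      simp only [LQProblem.meanCost, LQProblem.stageCost, CPS.ctrlLQ, Matrix.zero_mulVec, add_zero]
    rw [hmean, ← h]
    exact lintegral_congr fun ω => by rw [congrFun (hY t) ω]
  · intro t ht
    rw [hY]
    exact ((hm t ht).mono (hw.le _) le_rfl).add (isSteady_predErr hS hD t).2.measurable_ferr

end RandomCPS

theorem theorem3 {n m p s : ℕ} (S : CPS n m p s) (hS : S.Standing)
    {Ω : Type*} [MeasurableSpace Ω] (μ : Measure Ω) [IsProbabilityMeasure μ]
    (D : RandomCPS n p Ω) (hD : D.IsModel S μ)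
    (N : ℕ) (xstar : Vec n)
    (Q : ℕ → Matrix (Fin n) (Fin n) ℝ) (hQ : ∀ t ≤ N, (Q t).PosDef)
    (R : ℕ → Matrix (Fin p) (Fin p) ℝ) (hR : ∀ t ≤ N, (R t).PosDef)
    (V W : ℕ → Matrix (CPS.XiIdx n) (CPS.XiIdx n) ℝ)
    (hV_end : V (N + 1) = 0)
    (hV : ∀ t ≤ N, V t =
      S.Ctildeᵀ * R t * S.Ctilde + S.calAᵀ * V (t + 1) * S.calA
        - (S.Ψᵀ * R t * S.Ctilde + S.calBᵀ * V (t + 1) * S.calA)ᵀ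
          * pinv (S.Ψᵀ * R t * S.Ψ + S.calBᵀ * V (t + 1) * S.calB)
          * (S.Ψᵀ * R t * S.Ctilde + S.calBᵀ * V (t + 1) * S.calA))
    (hW_end : W (N + 1) = 0)
    (hW : ∀ t ≤ N, W t =
      S.calHᵀ * Q t * S.calH + S.calAᵀ * W (t + 1) * S.calA
        - S.calAᵀ * W (t + 1) * S.calB * pinv (S.calBᵀ * W (t + 1) * S.calB)
          * S.calBᵀ * W (t + 1) * S.calA)
    (L₀ Linf : ℕ → Matrix (Fin s) (CPS.XiIdx n) ℝ)
    (O₀ Oinf : ℕ → Matrix (Fin s) (Fin p) ℝ)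
    (hL₀ : ∀ t ≤ N, L₀ t =
      -(pinv (S.Ψᵀ * R t * S.Ψ + S.calBᵀ * V (t + 1) * S.calB)
        * (S.Ψᵀ * R t * S.Ctilde + S.calBᵀ * V (t + 1) * S.calA)))
    (hO₀ : ∀ t ≤ N, O₀ t =
      -(pinv (S.Ψᵀ * R t * S.Ψ + S.calBᵀ * V (t + 1) * S.calB) * (S.Ψᵀ * R t)))
    (hLinf : ∀ t ≤ N, Linf t =
      -(pinv (S.calBᵀ * W (t + 1) * S.calB) * (S.calBᵀ * W (t + 1) * S.calA)))
    (hOinf : ∀ t ≤ N, Oinf t = 0) :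
    ((∃ e : ℕ → Ω → Vec s, D.IsLinearFeedback S N xstar L₀ O₀ e) ∧
      ∀ e : ℕ → Ω → Vec s, D.IsLinearFeedback S N xstar L₀ O₀ e →
        D.IsOptimal S N (D.detCost S μ N R) e ∧ D.IsMMSE S μ N e) ∧
    ((∃ e : ℕ → Ω → Vec s, D.IsLinearFeedback S N xstar Linf Oinf e) ∧
      ∀ e : ℕ → Ω → Vec s, D.IsLinearFeedback S N xstar Linf Oinf e →
        D.IsOptimal S N (D.ctrlCost S μ N xstar Q) e ∧ D.IsMMSE S μ N e) := by
  have hR' : ∀ t ≤ N, (R t).PosSemidef := fun t ht => (hR t ht).posSemidef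
  have hQ' : ∀ t ≤ N, (Q t).PosSemidef := fun t ht => (hQ t ht).posSemidef
  have hdet : (S.detLQ R).IsValue N V := ⟨hR', hV_end, hV⟩
  have hctrl : (S.ctrlLQ Q).IsValue N W := by
    -- The recursion for `W` is written with `𝒜ᵀ W ℬ` where the general one has the transpose of `ℬᵀ
    -- W 𝒜`, so they agree only once `W (t + 1)` is known to be symmetric.
    have hsymm : ∀ t ≤ N + 1, (W t)ᵀ = W t := by
      intro t ht
      induction ht using Nat.decreasingInduction with
      | self => rw [hW_end, Matrix.transpose_zero]
      | of_succ k hk ih =>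
        have h := riccati_transpose (transpose_eq_of_posSemidef (hQ' k (by omega))) ih S.calH
          (0 : Matrix (Fin n) (Fin s) ℝ) S.calA S.calB
        rw [hW k (by omega)]
        simpa [ih, Matrix.transpose_mul, Matrix.mul_assoc] using h
    refine ⟨hQ', hW_end, fun t ht => ?_⟩
    rw [hW t ht]
    simp [CPS.ctrlLQ, hsymm (t + 1) (by omega), Matrix.transpose_mul, Matrix.mul_assoc]
  refine ⟨⟨D.exists_isLinearFeedback S N xstar L₀ O₀, fun e he => ⟨?_, ?_⟩⟩,
    ⟨D.exists_isLinearFeedback S N xstar Linf Oinf, fun e he => ⟨?_, ?_⟩⟩⟩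
  -- No constant is left over for detection: the innovation is part of the stage cost and produces
  -- the gain on `ν_t`. For the control cost the constant is the cost of the filtered errors, and `D
  -- = E = 0` makes the gain on `ν_t` vanish.
  · refine RandomCPS.isOptimal_of_isValue hS hD hdet hL₀ (fun t ht => ?_) (c := 0) (by simp)
      (fun e' he' => ?_) he
    · rw [hO₀ t ht, LQProblem.innovGain, Matrix.mul_one]
    · rw [add_zero]
      exact RandomCPS.detCost_eq hS hD hR' he'
  · exact RandomCPS.isMMSE_of_admissible hS hD he.admissible fun t ht => he.memLp hS hD ht
  · refine RandomCPS.isOptimal_of_isValue hS hD hctrl (fun t ht => ?_) (fun t ht => ?_)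
      (ENNReal.sum_lt_top.2 fun t _ =>
        lintegral_quad_lt_top (RandomCPS.isSteady_predErr hS hD t).2.memLp_ferr (Q t))
      (fun e' he' => RandomCPS.ctrlCost_eq hS hD hQ' he') he
    · rw [hLinf t ht]
      simp [LQProblem.stateGain]
    · rw [hOinf t ht]
      simp [LQProblem.innovGain]
  · exact RandomCPS.isMMSE_of_admissible hS hD he.admissible fun t ht => he.memLp hS hD ht
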